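/- Consider an array $A[1..n]$ of real numbers, all entries initially zero, and the following range operations, where $i,j$ are positions in $\{1,\dots,n\}$, $[i..j]=\{k\in\mathbb{Z}: i\le k\le j\}$, and $c,g,\alpha$ are real numbers: <ul> <li>$\mathsf{Lookup}(i)$: return $A[i]$.</li> <li>$\mathsf{AddConst}(i,j,c)$: for every $k\in[i..j]$, set $A[k]\leftarrow A[k]+c$.</li> <li>$\mathsf{AddGradient}(i,j,g)$: for every $k\in[i..j]$, set $A[k]\leftarrow A[k]+k\cdot g$.</li> <li>$\mathsf{LeftLinearWave}(i,j,\alpha)$: for every $k\in[i..j]$, set $A[k]\leftarrow\min_{t\in[i..k]}\big(A[t]+(k-t)\alpha\big)$.</li> <li>$\mathsf{RightLinearWave}(i,j,\alpha)$: for every $k\in[i..j]$, set $A[k]\leftarrow\min_{t\in[k..j]}\big(A[t]+(t-k)\alpha\big)$.</li> </ul> (In each operation all values on the right-hand side are those before the operation.) There are a data structure and constants $C,d$, independent of $n$ and of the operations, such that for every array size $n$ the data structure is initialized in at most $C$ steps and then performs every sequence of $s$ operations on-line (each operation is completed, and each $\mathsf{Lookup}$ answered correctly, before the next operation is revealed;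 $s$ and $n$ are arbitrary and $s$ is not known in advance) in at most $C\cdot s\cdot(1+\lfloor\log_2 s\rfloor)^d$ steps in total for $s\ge 1$; that is, in amortized $O(\mathrm{polylog}(s))$ time per operation. Time is counted in a unit-cost model with exact real arithmetic: a fixed finite program of recursive procedures, in which each of the following costs one step: reading a variable or an integer constant, one of $+,-,\times,\div$ on real numbers, a comparison of two real numbers, allocating an (immutable) two-field record of numbers and pointers, reading a field of a record, testing whether a value is a pointer, binding a variable, and calling a procedure. (The model has no rounding and no address arithmetic, and each of its steps takes constant time on a real RAM.) -/

import Mathlib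

/-! # Range operations on an array of reals, and a cost model for programs that serve them -/

namespace RangeArray

/-! ## The range operations

An array of size `n` has positions `1, …, n`.  It is written as a function `A : ℕ → ℝ`, of which
only the values at `1, …, n` are ever used (see `Op.Valid`). -/

/-- The five range operations. -/
inductive Op where
  | lookup (i : ℕ)
  | addConst (i j : ℕ) (c : ℝ)
  | addGradient (i j : ℕ) (g : ℝ)
  | leftLinearWave (i j : ℕ) (α : ℝ)
  | rightLinearWave (i j : ℕ) (α : ℝ)

/-- The indices of the operation are positions of an array of size `n`.  A range `[i..j]` with
`j < i` is allowed and empty. -/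
def Op.Valid (n : ℕ) : Op → Prop
  | .lookup i => 1 ≤ i ∧ i ≤ n
  | .addConst i j _ => (1 ≤ i ∧ i ≤ n) ∧ (1 ≤ j ∧ j ≤ n)
  | .addGradient i j _ => (1 ≤ i ∧ i ≤ n) ∧ (1 ≤ j ∧ j ≤ n)
  | .leftLinearWave i j _ => (1 ≤ i ∧ i ≤ n) ∧ (1 ≤ j ∧ j ≤ n)
  | .rightLinearWave i j _ => (1 ≤ i ∧ i ≤ n) ∧ (1 ≤ j ∧ j ≤ n)

/-- The array after the operation.  All the values on the right-hand sides are those of the array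
before the operation. -/
noncomputable def Op.apply : Op → (ℕ → ℝ) → (ℕ → ℝ)
  | .lookup _, A => A
  | .addConst i j c, A => fun k => if i ≤ k ∧ k ≤ j then A k + c else A k
  | .addGradient i j g, A => fun k => if i ≤ k ∧ k ≤ j then A k + (k : ℝ) * g else A k
  | .leftLinearWave i j α, A => fun k =>
      if h : i ≤ k ∧ k ≤ j then
        (Finset.Icc i k).inf' (Finset.nonempty_Icc.mpr h.1) (fun t => A t + ((k : ℝ) - (t : ℝ)) * α)
      else A k
  | .rightLinearWave i j α, A => fun k =>
      if h : i ≤ k ∧ k ≤ j then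
        (Finset.Icc k j).inf' (Finset.nonempty_Icc.mpr h.2) (fun t => A t + ((t : ℝ) - (k : ℝ)) * α)
      else A k

/-- The values that the lookups of a sequence of operations have to return, in order, when the
sequence is performed on the array `A`. -/
noncomputable def answers : (ℕ → ℝ) → List Op → List ℝ
  | _, [] => []
  | A, .lookup i :: ops => A i :: answers A ops
  | A, o :: ops => answers (o.apply A) ops

/-! ## The cost model

Programs are finite lists of (mutually recursive) procedures that work with exact real numbers and
with pointers to immutable two-field records.  Every elementary action costs one unit of time and
takes constant time on a real RAM (an expression has a fixed size, so that the number of variables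
in scope is bounded by a constant of the program).  There is no rounding, no address arithmetic, and
no real constant other than the integers that are written in the program. -/

/-- What a variable or a field of a record can hold: a real number, or a pointer to a record with
two fields. -/
inductive Val where
  | num (r : ℝ)
  | cell (a b : Val)

/-- Expressions of the programming language. -/
inductive Exp where
  /-- the variable introduced `k` binders ago -/
  | var (k : ℕ)
  /-- an integer constant -/
  | const (z : ℤ)
  | add (a b : Exp)
  | sub (a b : Exp)
  | mul (a b : Exp)
  | div (a b : Exp)
  /-- allocate a record with the given fields -/
  | cell (a b : Exp)
  /-- read the first field of a record -/
  | fst (a : Exp)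
  /-- read the second field of a record -/
  | snd (a : Exp)
  /-- compare two numbers: if `a < b` then `p` else `q` -/
  | ifLt (a b p q : Exp)
  /-- test a value: if `a` is a pointer to a record then `p` else `q` -/
  | ifCell (a p q : Exp)
  /-- evaluate `a`, bind the result to a new variable, and continue with `b` -/
  | letIn (a b : Exp)
  /-- call the procedure number `f` of the program with the argument `a` -/
  | call (f : ℕ) (a : Exp)

/-- `Eval P env e v t`: with the procedures `P` (given by their bodies) and the variables in scope
bound to the values `env`, the expression `e` evaluates to `v` in exactly `t` steps.  There is no
such `v` and `t` if the evaluation runs forever or fails: by a division by zero, by arithmetic on a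
pointer, by reading a field of a number, or by using a variable or procedure that does not exist. -/
inductive Eval (P : List Exp) : List Val → Exp → Val → ℕ → Prop
  | var {env k v} : env[k]? = some v → Eval P env (.var k) v 1
  | const {env z} : Eval P env (.const z) (.num (z : ℝ)) 1
  | add {env a b x y s t} : Eval P env a (.num x) s → Eval P env b (.num y) t →
      Eval P env (.add a b) (.num (x + y)) (s + t + 1)
  | sub {env a b x y s t} : Eval P env a (.num x) s → Eval P env b (.num y) t →
      Eval P env (.sub a b) (.num (x - y)) (s + t + 1)
  | mul {env a b x y s t} : Eval P env a (.num x) s → Eval P env b (.num y) t →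
      Eval P env (.mul a b) (.num (x * y)) (s + t + 1)
  | div {env a b x y s t} : Eval P env a (.num x) s → Eval P env b (.num y) t → y ≠ 0 →
      Eval P env (.div a b) (.num (x / y)) (s + t + 1)
  | cell {env a b v w s t} : Eval P env a v s → Eval P env b w t →
      Eval P env (.cell a b) (.cell v w) (s + t + 1)
  | fst {env a v w s} : Eval P env a (.cell v w) s → Eval P env (.fst a) v (s + 1)
  | snd {env a v w s} : Eval P env a (.cell v w) s → Eval P env (.snd a) w (s + 1)
  | ifLt_true {env a b p q x y v s t u} : Eval P env a (.num x) s → Eval P env b (.num y) t →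
      x < y → Eval P env p v u → Eval P env (.ifLt a b p q) v (s + t + u + 1)
  | ifLt_false {env a b p q x y v s t u} : Eval P env a (.num x) s → Eval P env b (.num y) t →
      ¬ x < y → Eval P env q v u → Eval P env (.ifLt a b p q) v (s + t + u + 1)
  | ifCell_true {env a p q x y v s u} : Eval P env a (.cell x y) s → Eval P env p v u →
      Eval P env (.ifCell a p q) v (s + u + 1)
  | ifCell_false {env a p q r v s u} : Eval P env a (.num r) s → Eval P env q v u →
      Eval P env (.ifCell a p q) v (s + u + 1)
  | letIn {env a b v w s t} : Eval P env a v s → Eval P (v :: env) b w t →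
      Eval P env (.letIn a b) w (s + t + 1)
  | call {env f e a v w s t} : Eval P env a v s → P[f]? = some e → Eval P [v] e w t →
      Eval P env (.call f a) w (s + t + 1)

/-- The outcome of an evaluation and its number of steps are unique. -/
theorem Eval.unique {P : List Exp} {env : List Val} {e : Exp} {v w : Val} {s t : ℕ}
    (h : Eval P env e v s) (k : Eval P env e w t) : v = w ∧ s = t := by
  induction h generalizing w t <;> cases k <;> grind

/-! ## Data structures for the range operations -/

/-- A data structure: auxiliary procedures, an expression that creates the initial state from the
size of the array, and one expression for each of the operations. -/
structure DataStructure where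
  procs : List Exp
  init : Exp
  lookup : Exp
  addConst : Exp
  addGradient : Exp
  leftLinearWave : Exp
  rightLinearWave : Exp

/-- The input of an update: the current state `st`, the indices `i`, `j` and the parameter `c`. -/
def updateInput (st : Val) (i j : ℕ) (c : ℝ) : Val :=
  .cell st (.cell (.num i) (.cell (.num j) (.num c)))

/-- `D.Runs st ops out T`: started in the state `st`, the data structure performs the operations
`ops` one after the other, in `T` steps altogether, and `out` is the list of the values returned by
the lookups.  An operation sees only its own arguments and the state left by the previous operation.
A lookup returns a value together with the new state, since it may reorganize the state. -/
inductive DataStructure.Runs (D : DataStructure) : Val → List Op → List ℝ → ℕ → Prop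
  | nil {st} : D.Runs st [] [] 0
  | lookup {st st'} {i : ℕ} {r t ops out T} :
      Eval D.procs [.cell st (.num (i : ℝ))] D.lookup (.cell st' (.num r)) t →
      D.Runs st' ops out T → D.Runs st (.lookup i :: ops) (r :: out) (t + T)
  | addConst {st st'} {i j : ℕ} {c : ℝ} {t ops out T} :
      Eval D.procs [updateInput st i j c] D.addConst st' t →
      D.Runs st' ops out T → D.Runs st (.addConst i j c :: ops) out (t + T)
  | addGradient {st st'} {i j : ℕ} {g : ℝ} {t ops out T} :
      Eval D.procs [updateInput st i j g] D.addGradient st' t →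
      D.Runs st' ops out T → D.Runs st (.addGradient i j g :: ops) out (t + T)
  | leftLinearWave {st st'} {i j : ℕ} {α : ℝ} {t ops out T} :
      Eval D.procs [updateInput st i j α] D.leftLinearWave st' t →
      D.Runs st' ops out T → D.Runs st (.leftLinearWave i j α :: ops) out (t + T)
  | rightLinearWave {st st'} {i j : ℕ} {α : ℝ} {t ops out T} :
      Eval D.procs [updateInput st i j α] D.rightLinearWave st' t →
      D.Runs st' ops out T → D.Runs st (.rightLinearWave i j α :: ops) out (t + T)

end RangeArray

namespace RangeArray

/-! ## Symbolic execution -/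

/-! The array is stored as a function on the integers `0, …, n + 1` (the outer two positions are
sentinels, so that every range has a neighbour on each side), interpolated by a sequence of concave
arcs with integer end points that join up. An arc consists of a concave `F` together with two slope
caps still to be applied: its true graph `Arc.G` is the minimum of `F`, a line of slope `lam`
through the left end and a line of slope `rho` through the right end. Caps are `Tight`, that is,
they never move the end values.

A left wave with slope `α` limits the ascent to `α`. On an arc whose chord slope is at most `α` the
right end keeps its value and the minimum over `t` is attained at `t = k` or at the left end, so the
wave only lowers `lam` to `α` (`wave_prefix`). A whole run of such arcs is treated by one lazy cap
on a tree. At the first arc `X` with a steeper chord, `X` lies above the line of slope `α` through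
its left end. If the next arc `Y` ends on or above the line, its values are irrelevant too and one
segment may replace `X` and `Y` (`merge_seg`); otherwise the line followed by what `Y` leaves below
it is again concave and becomes one arc (`merge_arc`); if there is no next arc, the line itself
replaces `X` (`wave_last`). A merge removes an arc, while an operation creates only boundedly many,
so the number of arcs serves as the potential of the amortization (`wave_spec`, `runs_of_state`).
The right wave is the left wave of the reflected array. Additions are affine maps of the graph, with
a fresh segment in each unit gap next to the range.

The arcs are the leaves of an AVL tree. Its inner nodes carry an affine tag, possibly reflecting,
and caps, both pushed down lazily, along with the extreme chord slopes needed to find the first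
steep arc. The graph `F` of a leaf is itself such a tree, a chain of segments. The caps of a leaf
are worked into its chain only when the arc is cut or clipped (`mat_spec`), which costs at most
three more segments. Joins cost `O(log)` and splits `O(log²)`, where the sizes are linear in the
number of operations, whence the exponent two.

Running times and outcomes are derived together from the weakest-precondition semantics `Sem`. It
treats calls as opaque, so each procedure gets one specification and recursion becomes induction. -/

/-- The call of procedure `f` on `v` terminates, with an outcome and a running time that
satisfy `Q`. -/
@[irreducible] def Calls (P : List Exp) (f : ℕ) (v : Val) (Q : Val → ℕ → Prop) : Prop :=
  ∃ e w t, P[f]? = some e ∧ Eval P [v] e w t ∧ Q w t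

theorem Calls.mono {P : List Exp} {f : ℕ} {v : Val} {Q Q' : Val → ℕ → Prop}
    (h : Calls P f v Q) (hQ : ∀ w t, Q w t → Q' w t) : Calls P f v Q' := by
  unfold Calls at *
  obtain ⟨e, w, t, h1, h2, h3⟩ := h
  exact ⟨e, w, t, h1, h2, hQ _ _ h3⟩

def onNum (k : ℝ → ℕ → Prop) : Val → ℕ → Prop
  | .num x, t => k x t
  | .cell _ _, _ => False

def onCell (k : Val → Val → ℕ → Prop) : Val → ℕ → Prop
  | .num _, _ => False
  | .cell v w, t => k v w t

def onEither (p : ℕ → Prop) (q : ℕ → Prop) : Val → ℕ → Prop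
  | .num _, t => q t
  | .cell _ _, t => p t

def onVar (t : ℕ) (Q : Val → ℕ → Prop) : Option Val → Prop
  | some v => Q v (t + 1)
  | none => False

/-- Weakest precondition: `Sem P e env t Q` says that `e`, started at time `t`, ends in a
value and at a time that satisfy `Q`. -/
def Sem (P : List Exp) : Exp → List Val → ℕ → (Val → ℕ → Prop) → Prop
  | .var k, env, t, Q => onVar t Q env[k]?
  | .const z, _, t, Q => Q (.num (z : ℝ)) (t + 1)
  | .add a b, env, t, Q => Sem P a env t (onNum fun x t =>
      Sem P b env t (onNum fun y t => Q (.num (x + y)) (t + 1)))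
  | .sub a b, env, t, Q => Sem P a env t (onNum fun x t =>
      Sem P b env t (onNum fun y t => Q (.num (x - y)) (t + 1)))
  | .mul a b, env, t, Q => Sem P a env t (onNum fun x t =>
      Sem P b env t (onNum fun y t => Q (.num (x * y)) (t + 1)))
  | .div a b, env, t, Q => Sem P a env t (onNum fun x t =>
      Sem P b env t (onNum fun y t => y ≠ 0 ∧ Q (.num (x / y)) (t + 1)))
  | .cell a b, env, t, Q => Sem P a env t fun v t =>
      Sem P b env t fun w t => Q (.cell v w) (t + 1)
  | .fst a, env, t, Q => Sem P a env t (onCell fun v _ t => Q v (t + 1))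
  | .snd a, env, t, Q => Sem P a env t (onCell fun _ w t => Q w (t + 1))
  | .ifLt a b p q, env, t, Q => Sem P a env t (onNum fun x t =>
      Sem P b env t (onNum fun y t =>
        (x < y → Sem P p env (t + 1) Q) ∧ (¬ x < y → Sem P q env (t + 1) Q)))
  | .ifCell a p q, env, t, Q => Sem P a env t fun v t =>
      onEither (fun t => Sem P p env (t + 1) Q) (fun t => Sem P q env (t + 1) Q) v t
  | .letIn a b, env, t, Q => Sem P a env t fun v t => Sem P b (v :: env) (t + 1) Q
  | .call f a, env, t, Q => Sem P a env t fun v t =>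
      Calls P f v fun w s => Q w (t + s + 1)

/-- Induction on the expression alone suffices, since `Calls` already contains a finished evaluation
of the callee. Recursive procedures are therefore handled by induction in their own specifications.
-/
theorem Sem.sound {P : List Exp} {e : Exp} {env : List Val} {t : ℕ} {Q : Val → ℕ → Prop}
    (h : Sem P e env t Q) : ∃ v s, Eval P env e v s ∧ Q v (t + s) := by
  induction e generalizing env t Q with
  | var k =>
    simp only [Sem] at h
    cases hk : env[k]? with
    | none => simp [hk, onVar] at h
    | some v => exact ⟨v, 1, .var hk, by simpa [hk, onVar] using h⟩
  | const z => exact ⟨_, 1, .const, h⟩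
  | add a b iha ihb =>
    obtain ⟨v, s, h1, h2⟩ := iha h
    cases v with
    | cell => exact h2.elim
    | num x =>
      obtain ⟨w, s', h3, h4⟩ := ihb h2
      cases w with
      | cell => exact h4.elim
      | num y => exact ⟨_, _, .add h1 h3, by simpa [onNum, add_assoc] using h4⟩
  | sub a b iha ihb =>
    obtain ⟨v, s, h1, h2⟩ := iha h
    cases v with
    | cell => exact h2.elim
    | num x =>
      obtain ⟨w, s', h3, h4⟩ := ihb h2
      cases w with
      | cell => exact h4.elim
      | num y => exact ⟨_, _, .sub h1 h3, by simpa [onNum, add_assoc] using h4⟩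
  | mul a b iha ihb =>
    obtain ⟨v, s, h1, h2⟩ := iha h
    cases v with
    | cell => exact h2.elim
    | num x =>
      obtain ⟨w, s', h3, h4⟩ := ihb h2
      cases w with
      | cell => exact h4.elim
      | num y => exact ⟨_, _, .mul h1 h3, by simpa [onNum, add_assoc] using h4⟩
  | div a b iha ihb =>
    obtain ⟨v, s, h1, h2⟩ := iha h
    cases v with
    | cell => exact h2.elim
    | num x =>
      obtain ⟨w, s', h3, h4⟩ := ihb h2
      cases w with
      | cell => exact h4.elim
      | num y => exact ⟨_, _, .div h1 h3 h4.1, by simpa [onNum, add_assoc] using h4.2⟩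
  | cell a b iha ihb =>
    obtain ⟨v, s, h1, h2⟩ := iha h
    obtain ⟨w, s', h3, h4⟩ := ihb h2
    exact ⟨_, _, .cell h1 h3, by simpa [add_assoc] using h4⟩
  | fst a iha =>
    obtain ⟨v, s, h1, h2⟩ := iha h
    cases v with
    | num => exact h2.elim
    | cell v w => exact ⟨_, _, .fst h1, by simpa [onCell, add_assoc] using h2⟩
  | snd a iha =>
    obtain ⟨v, s, h1, h2⟩ := iha h
    cases v with
    | num => exact h2.elim
    | cell v w => exact ⟨_, _, .snd h1, by simpa [onCell, add_assoc] using h2⟩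
  | ifLt a b p q iha ihb ihp ihq =>
    obtain ⟨v, s, h1, h2⟩ := iha h
    cases v with
    | cell => exact h2.elim
    | num x =>
      obtain ⟨w, s', h3, h4⟩ := ihb h2
      cases w with
      | cell => exact h4.elim
      | num y =>
        by_cases hxy : x < y
        · obtain ⟨v, u, h5, h6⟩ := ihp (h4.1 hxy)
          exact ⟨_, _, .ifLt_true h1 h3 hxy h5, by convert h6 using 1; omega⟩
        · obtain ⟨v, u, h5, h6⟩ := ihq (h4.2 hxy)
          exact ⟨_, _, .ifLt_false h1 h3 hxy h5, by convert h6 using 1; omega⟩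
  | ifCell a p q iha ihp ihq =>
    obtain ⟨v, s, h1, h2⟩ := iha h
    cases v with
    | num r =>
      obtain ⟨v, u, h5, h6⟩ := ihq h2
      exact ⟨_, _, .ifCell_false h1 h5, by convert h6 using 1; omega⟩
    | cell x y =>
      obtain ⟨v, u, h5, h6⟩ := ihp h2
      exact ⟨_, _, .ifCell_true h1 h5, by convert h6 using 1; omega⟩
  | letIn a b iha ihb =>
    obtain ⟨v, s, h1, h2⟩ := iha h
    obtain ⟨w, s', h3, h4⟩ := ihb h2
    exact ⟨_, _, .letIn h1 h3, by convert h4 using 1; omega⟩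
  | call f a iha =>
    obtain ⟨v, s, h1, h2⟩ := iha h
    unfold Calls at h2
    obtain ⟨e, w, u, h3, h4, h5⟩ := h2
    exact ⟨_, _, .call h1 h3 h4, by convert h5 using 1; omega⟩

theorem Calls.of_sem {P : List Exp} {f : ℕ} {v : Val} {Q : Val → ℕ → Prop} (e : Exp)
    (h : P[f]? = some e) (hs : Sem P e [v] 0 Q) : Calls P f v Q := by
  obtain ⟨w, t, h1, h2⟩ := hs.sound
  unfold Calls
  exact ⟨e, w, t, h, h1, by simpa using h2⟩

/-! ## The program -/

namespace Exp

/-! Fields of a tree: end points, extreme chord slopes, caps, height, tag and children. -/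

def lPt (e : Exp) : Exp := fst (fst (fst e))
def rPt (e : Exp) : Exp := snd (fst (fst e))
def slopes (e : Exp) : Exp := fst (fst (snd (fst e)))
def caps (e : Exp) : Exp := snd (fst (snd (fst e)))
def height (e : Exp) : Exp := snd (snd (fst e))
def tag (e : Exp) : Exp := fst (snd e)
def left (e : Exp) : Exp := fst (snd (snd e))
def right (e : Exp) : Exp := snd (snd (snd e))

def call₂ (f : ℕ) (a b : Exp) : Exp := call f (cell a b)

/-- The image of a point under a tag. -/
def movePt (p t : Exp) : Exp :=
  cell (mul (fst t) (fst p)) (add (snd p) (add (fst (snd t)) (mul (snd (snd t)) (fst p))))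

def shiftSlopes (p t : Exp) : Exp := cell (add (fst p) (snd (snd t))) (add (snd p) (snd (snd t)))

def flipSlopes (p t : Exp) : Exp :=
  cell (sub (const 0) (add (snd p) (snd (snd t)))) (sub (const 0) (add (fst p) (snd (snd t))))

/-- The tag that applies `s` first and then `t`. -/
def compTag (s t : Exp) : Exp :=
  cell (mul (fst s) (fst t)) (cell (add (fst (snd s)) (fst (snd t)))
    (add (snd (snd s)) (mul (fst s) (snd (snd t)))))

def flipTag : Exp := cell (const (-1)) (cell (const 0) (const 0))
def idTag : Exp := cell (const 1) (cell (const 0) (const 0))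
def nil : Exp := const 0

end Exp

def fHdr : ℕ := 0
def fApp : ℕ := 1
def fCap : ℕ := 2
def fPush : ℕ := 3
def fMk : ℕ := 4
def fBal : ℕ := 5
def fJoin : ℕ := 6
def fSplit : ℕ := 7
def fUncons : ℕ := 8
def fSeg : ℕ := 9
def fArc : ℕ := 10
def fClip : ℕ := 11
def fMat : ℕ := 12
def fSplitAt : ℕ := 13
def fWave : ℕ := 14
def fLeftWave : ℕ := 15
def fAddLin : ℕ := 16
def fTrim : ℕ := 17
def fMax : ℕ := 18
def fMin : ℕ := 19
def fHalve : ℕ := 20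
def fCapHi : ℕ := 21

open Exp

def maxBody : Exp := ifLt (fst (var 0)) (snd (var 0)) (snd (var 0)) (fst (var 0))
def minBody : Exp := ifLt (fst (var 0)) (snd (var 0)) (fst (var 0)) (snd (var 0))

/-- The header of a tree, moved by a tag. -/
def hdrBody : Exp :=
  letIn (fst (var 0)) <| letIn (snd (var 1)) <|
  ifLt (fst (var 0)) (const 0)
    (cell (cell (movePt (snd (fst (var 1))) (var 0)) (movePt (fst (fst (var 1))) (var 0)))
      (cell (cell (flipSlopes (fst (fst (snd (var 1)))) (var 0))
        (flipSlopes (snd (fst (snd (var 1)))) (var 0))) (snd (snd (var 1)))))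
    (cell (cell (movePt (fst (fst (var 1))) (var 0)) (movePt (snd (fst (var 1))) (var 0)))
      (cell (cell (shiftSlopes (fst (fst (snd (var 1)))) (var 0))
        (shiftSlopes (snd (fst (snd (var 1)))) (var 0))) (snd (snd (var 1)))))

/-- A tree and a tag: move the tree by the tag. -/
def appBody : Exp :=
  letIn (fst (var 0)) <| letIn (snd (var 1)) <|
  ifCell (var 1)
    (cell (call₂ fHdr (fst (var 1)) (var 0))
      (cell (compTag (tag (var 1)) (var 0))
        (cell (ifLt (height (var 1)) (const 1) (call₂ fApp (left (var 1)) (var 0)) (left (var 1)))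
          (right (var 1)))))
    (var 1)

/-- A tree and a pair of slopes: cap the slopes of the tree from above and from below. -/
def capBody : Exp :=
  letIn (fst (var 0)) <| letIn (snd (var 1)) <|
  ifCell (var 1)
    (cell (cell (fst (fst (var 1))) (cell (cell (slopes (var 1))
      (cell (call₂ fMin (fst (caps (var 1))) (fst (var 0))) (call₂ fMax (snd (caps (var 1))) (snd (var 0)))))
        (height (var 1)))) (snd (var 1)))
    (var 1)

/-- The children of an inner node, with tag and caps pushed down. -/
def pushBody : Exp :=
  letIn (call₂ fCap (call₂ fApp (left (var 0)) (tag (var 0))) (caps (var 0))) <|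
  letIn (call₂ fCap (call₂ fApp (right (var 1)) (tag (var 1))) (caps (var 1))) <|
  ifLt (fst (tag (var 2))) (const 0) (cell (var 0) (var 1)) (cell (var 1) (var 0))

/-- The caps of a new node are the weakest ones among its children, so applying them changes
nothing. This replaces infinite caps, which are not real numbers. -/
def mkBody : Exp :=
  letIn (fst (var 0)) <| letIn (snd (var 1)) <|
  cell (cell (cell (lPt (var 1)) (rPt (var 0)))
    (cell (cell
      (cell (call₂ fMax (fst (slopes (var 1))) (fst (slopes (var 0))))
        (call₂ fMin (snd (slopes (var 1))) (snd (slopes (var 0)))))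
      (cell (call₂ fMax (fst (caps (var 1))) (fst (caps (var 0))))
        (call₂ fMin (snd (caps (var 1))) (snd (caps (var 0))))))
      (add (call₂ fMax (height (var 1)) (height (var 0))) (const 1))))
    (cell idTag (cell (var 1) (var 0)))

/-- Join two trees, the right one at most two higher than the left one. -/
def balBody : Exp :=
  letIn (fst (var 0)) <| letIn (snd (var 1)) <|
  ifLt (add (height (var 1)) (const 1)) (height (var 0))
    (letIn (call fPush (var 0)) <|
      ifLt (height (snd (var 0))) (height (fst (var 0)))
        (letIn (call fPush (fst (var 0))) <|
          call₂ fMk (call₂ fMk (var 3) (fst (var 0))) (call₂ fMk (snd (var 0)) (snd (var 1))))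
        (call₂ fMk (call₂ fMk (var 2) (fst (var 0))) (snd (var 0))))
    (call₂ fMk (var 1) (var 0))

def joinBody : Exp :=
  letIn (fst (var 0)) <| letIn (snd (var 1)) <|
  ifCell (var 1)
    (ifCell (var 0)
      (ifLt (add (height (var 0)) (const 1)) (height (var 1))
        (letIn (call fPush (var 1)) <|
          call₂ fBal (fst (var 0)) (call₂ fJoin (snd (var 0)) (var 1)))
        (ifLt (add (height (var 1)) (const 1)) (height (var 0))
          (call₂ fApp
            (call₂ fJoin (call₂ fApp (var 0) flipTag) (call₂ fApp (var 1) flipTag)) flipTag)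
          (call₂ fMk (var 1) (var 0))))
      (var 1))
    (var 0)

/-- A tree and coefficients `p, q, w, r`: split the tree after the maximal prefix found by the test
`p * xb + q * yb + w * hi ≤ r`. -/
def splitBody : Exp :=
  letIn (fst (var 0)) <| letIn (snd (var 1)) <|
  ifCell (var 1)
    (ifLt (height (var 1)) (const 1)
      (ifLt (snd (snd (snd (var 0))))
        (add (mul (fst (var 0)) (fst (rPt (var 1))))
          (add (mul (fst (snd (var 0))) (snd (rPt (var 1))))
            (mul (fst (snd (snd (var 0)))) (fst (slopes (var 1))))))
        (cell nil (var 1)) (cell (var 1) nil))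
      (letIn (call fPush (var 1)) <|
        ifLt (snd (snd (snd (var 1))))
          (add (mul (fst (var 1)) (fst (rPt (fst (var 0)))))
            (add (mul (fst (snd (var 1))) (snd (rPt (fst (var 0)))))
              (mul (fst (snd (snd (var 1)))) (fst (slopes (fst (var 0)))))))
          (letIn (call₂ fSplit (fst (var 0)) (var 1)) <|
            cell (fst (var 0)) (call₂ fJoin (snd (var 0)) (snd (var 1))))
          (letIn (call₂ fSplit (snd (var 0)) (var 1)) <|
            cell (call₂ fJoin (fst (var 1)) (fst (var 0))) (snd (var 0)))))
    (cell nil nil)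

/-- The first leaf of a tree, and the rest. -/
def unconsBody : Exp :=
  ifLt (height (var 0)) (const 1) (cell (var 0) nil)
    (letIn (call fPush (var 0)) <| letIn (call fUncons (fst (var 0))) <|
      cell (fst (var 0)) (call₂ fJoin (snd (var 0)) (snd (var 1))))

/-- The segment between two points. -/
def segBody : Exp :=
  letIn (fst (var 0)) <| letIn (snd (var 1)) <|
  letIn (div (sub (snd (var 0)) (snd (var 1))) (sub (fst (var 0)) (fst (var 1)))) <|
  cell (cell (cell (var 2) (var 1))
    (cell (cell (cell (var 0) (var 0)) (cell (var 0) (var 0))) (const 0)))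
    (cell idTag (cell nil nil))

/-- The arc with a given chain and given caps. -/
def arcBody : Exp :=
  letIn (fst (var 0)) <| letIn (snd (var 1)) <|
  letIn (div (sub (snd (rPt (var 1))) (snd (lPt (var 1))))
    (sub (fst (rPt (var 1))) (fst (lPt (var 1))))) <|
  cell (cell (fst (fst (var 2)))
    (cell (cell (cell (var 0) (var 0)) (var 1)) (const 0)))
    (cell idTag (cell (var 2) nil))

/-- A segment `W`, the rest `K` of a chain, a point and a slope: the line with the slope through the
point up to its intersection with `W`, and then what is left of `W`, and `K`. -/
def trimBody : Exp :=
  letIn (fst (fst (var 0))) <| letIn (snd (fst (var 1))) <|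
  letIn (fst (snd (var 2))) <| letIn (snd (snd (var 3))) <|
  letIn (fst (slopes (var 3))) <|
  letIn (div (add (sub (sub (snd (var 2)) (mul (var 1) (fst (var 2)))) (snd (rPt (var 4))))
    (mul (var 0) (fst (rPt (var 4))))) (sub (var 0) (var 1))) <|
  letIn (cell (var 0) (add (snd (var 3)) (mul (var 2) (sub (var 0) (fst (var 3)))))) <|
  letIn (call₂ fJoin (call₂ fSeg (var 0) (rPt (var 6))) (var 5)) <|
  ifLt (fst (var 5)) (var 2)
    (call₂ fJoin (call₂ fSeg (var 5) (var 1)) (var 0))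
    (var 0)

/-- A chain, a point to the left of it and a slope: the minimum of the chain and of the line
with the slope through the point. -/
def clipBody : Exp :=
  letIn (fst (var 0)) <| letIn (fst (snd (var 1))) <| letIn (snd (snd (var 2))) <|
  letIn (call₂ fSplit (var 2) (cell (var 0) (cell (const (-1)) (cell (const 0)
    (sub (mul (var 0) (fst (var 1))) (snd (var 1))))))) <|
  ifCell (snd (var 0))
    (call₂ fTrim (call fUncons (snd (var 0))) (cell (var 2) (var 1)))
    (call₂ fSeg (var 2) (cell (fst (rPt (var 3)))
      (add (snd (var 2)) (mul (var 1) (sub (fst (rPt (var 3))) (fst (var 2)))))))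

/-- The chain of a leaf, with the caps applied. -/
def matBody : Exp :=
  letIn (call₂ fClip (ifCell (left (var 0)) (left (var 0)) (var 0))
    (cell (lPt (var 0)) (fst (caps (var 0))))) <|
  letIn (call₂ fApp (var 0) flipTag) <|
  call₂ fApp (call₂ fClip (var 0) (cell (lPt (var 0))
    (sub (const 0) (snd (caps (var 2)))))) flipTag

/-- A leaf and a position inside it: cut the leaf into two leaves. -/
def halveBody : Exp :=
  letIn (fst (var 0)) <| letIn (snd (var 1)) <|
  ifCell (left (var 1))
    (letIn (call₂ fSplitAt (call fMat (var 1)) (var 0)) <|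
      cell (call₂ fArc (fst (var 0)) (caps (var 2))) (call₂ fArc (snd (var 0)) (caps (var 2))))
    (letIn (cell (var 0) (add (snd (lPt (var 1))) (mul (fst (slopes (var 1)))
        (sub (var 0) (fst (lPt (var 1))))))) <|
      cell (call₂ fSeg (lPt (var 2)) (var 0)) (call₂ fSeg (var 0) (rPt (var 2))))

/-- A tree and a position: cut the tree at the position. -/
def splitAtBody : Exp :=
  letIn (fst (var 0)) <| letIn (snd (var 1)) <|
  letIn (call₂ fSplit (var 1)
    (cell (const 1) (cell (const 0) (cell (const 0) (var 0))))) <|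
  ifCell (snd (var 0))
    (letIn (call fUncons (snd (var 0))) <|
      ifLt (fst (lPt (fst (var 0)))) (var 2)
        (letIn (call₂ fHalve (fst (var 0)) (var 2)) <|
          cell (call₂ fJoin (fst (var 2)) (fst (var 0)))
            (call₂ fJoin (snd (var 0)) (snd (var 1))))
        (var 1))
    (var 0)

/-- A tree and a slope: cap the slopes of the tree from above. -/
def capHiBody : Exp :=
  ifCell (fst (var 0))
    (call₂ fCap (fst (var 0)) (cell (snd (var 0)) (snd (caps (fst (var 0)))))) nil

/-- A tree and a slope: perform the left wave on the whole tree. -/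
def waveBody : Exp :=
  letIn (fst (var 0)) <| letIn (snd (var 1)) <|
  ifLt (var 0) (fst (slopes (var 1)))
    (letIn (call₂ fSplit (var 1)
        (cell (const 0) (cell (const 0) (cell (const 1) (var 0))))) <|
      letIn (call₂ fCapHi (fst (var 0)) (var 1)) <|
      letIn (call fUncons (snd (var 1))) <|
      letIn (lPt (fst (var 0))) <|
      call₂ fJoin (var 2)
        (ifCell (snd (var 1))
          (letIn (call fUncons (snd (var 1))) <|
            letIn (add (snd (var 1))
              (mul (var 5) (sub (fst (rPt (fst (var 0)))) (fst (var 1))))) <|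
            letIn (ifLt (snd (rPt (fst (var 1)))) (var 0)
              (call₂ fArc (call₂ fClip (call fMat (fst (var 1))) (cell (var 2) (var 6)))
                (cell (var 6) (snd (caps (fst (var 1))))))
              (call₂ fSeg (var 2) (rPt (fst (var 1))))) <|
            call₂ fWave (call₂ fJoin (var 0) (snd (var 2))) (var 7))
          (call₂ fSeg (var 0) (cell (fst (rPt (fst (var 1))))
            (add (snd (var 0)) (mul (var 4) (sub (fst (rPt (fst (var 1)))) (fst (var 0)))))))))
    (call₂ fCapHi (var 1) (var 0))

/-- A tree and `i, j, α`: perform the left wave on the range from `i` to `j`. -/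
def leftWaveBody : Exp :=
  letIn (fst (var 0)) <| letIn (fst (snd (var 1))) <| letIn (fst (snd (snd (var 2)))) <|
  letIn (snd (snd (snd (var 3)))) <|
  ifLt (var 2) (var 1)
    (letIn (call₂ fSplitAt (var 3) (var 2)) <|
      letIn (call₂ fSplitAt (snd (var 0)) (var 2)) <|
      letIn (call₂ fSplitAt (snd (var 0)) (add (var 3) (const 1))) <|
      letIn (call₂ fWave (fst (var 1)) (var 3)) <|
      call₂ fJoin (fst (var 3)) (call₂ fJoin (var 0)
        (call₂ fJoin (call₂ fSeg (rPt (var 0)) (rPt (fst (var 1)))) (snd (var 1)))))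
    (var 3)

/-- A tree and `i, j, c, g`: add `c + k * g` at the positions `k` from `i` to `j`. -/
def addLinBody : Exp :=
  letIn (fst (var 0)) <| letIn (fst (snd (var 1))) <| letIn (fst (snd (snd (var 2)))) <|
  letIn (snd (snd (snd (var 3)))) <|
  ifLt (var 1) (var 2) (var 3)
    (letIn (call₂ fSplitAt (var 3) (sub (var 2) (const 1))) <|
      letIn (call₂ fSplitAt (snd (var 0)) (var 3)) <|
      letIn (call₂ fSplitAt (snd (var 0)) (var 3)) <|
      letIn (call₂ fSplitAt (snd (var 0)) (add (var 4) (const 1))) <|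
      letIn (cell (const 1) (var 4)) <|
      call₂ fJoin (fst (var 4)) (call₂ fJoin
        (call₂ fSeg (lPt (fst (var 3))) (movePt (rPt (fst (var 3))) (var 0)))
        (call₂ fJoin (call₂ fApp (fst (var 2)) (var 0)) (call₂ fJoin
          (call₂ fSeg (movePt (lPt (fst (var 1))) (var 0)) (rPt (fst (var 1))))
          (snd (var 1))))))

def program : List Exp :=
  [hdrBody, appBody, capBody, pushBody, mkBody, balBody, joinBody, splitBody, unconsBody, segBody,
    arcBody, clipBody, matBody, splitAtBody, waveBody, leftWaveBody, addLinBody, trimBody,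
    maxBody, minBody, halveBody, capHiBody]

def theDataStructure : DataStructure where
  procs := program
  init := call₂ fSeg (cell (const 0) (const 0)) (cell (add (var 0) (const 1)) (const 0))
  lookup := cell (fst (var 0)) (snd (rPt (fst (call fSplitAt (var 0)))))
  addConst := call₂ fAddLin (fst (var 0)) (cell (fst (snd (var 0)))
    (cell (fst (snd (snd (var 0)))) (cell (snd (snd (snd (var 0)))) (const 0))))
  addGradient := call₂ fAddLin (fst (var 0)) (cell (fst (snd (var 0)))
    (cell (fst (snd (snd (var 0)))) (cell (const 0) (snd (snd (snd (var 0)))))))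
  leftLinearWave := call fLeftWave (var 0)
  rightLinearWave := call₂ fApp (call₂ fLeftWave (call₂ fApp (fst (var 0)) flipTag)
    (cell (sub (const 0) (fst (snd (snd (var 0))))) (cell (sub (const 0) (fst (snd (var 0))))
      (snd (snd (snd (var 0))))))) flipTag

/-! ## Arcs -/

/-- Three-point form of concavity on `[a, b]`. -/
def Conc (a b : ℝ) (F : ℝ → ℝ) : Prop :=
  ∀ x y z, a ≤ x → x ≤ y → y ≤ z → z ≤ b → F x * (z - y) + F z * (y - x) ≤ F y * (z - x)

theorem Conc.min {a b : ℝ} {F G : ℝ → ℝ} (hF : Conc a b F) (hG : Conc a b G) :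
    Conc a b (fun x => min (F x) (G x)) := by
  intro x y z h1 h2 h3 h4
  have e1 := hF x y z h1 h2 h3 h4
  have e2 := hG x y z h1 h2 h3 h4
  have hzy : 0 ≤ z - y := by linarith
  have hyx : 0 ≤ y - x := by linarith
  have m1 := mul_le_mul_of_nonneg_right (min_le_left (F x) (G x)) hzy
  have m2 := mul_le_mul_of_nonneg_right (min_le_right (F x) (G x)) hzy
  have m3 := mul_le_mul_of_nonneg_right (min_le_left (F z) (G z)) hyx
  have m4 := mul_le_mul_of_nonneg_right (min_le_right (F z) (G z)) hyx
  rcases min_choice (F y) (G y) with h | h <;> simp only [h] <;> linarith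

theorem Conc.line (a b u v w : ℝ) : Conc a b (fun x => u + v * (x - w)) := by
  intro x y z _ _ _ _
  apply le_of_eq
  ring

theorem Conc.mono {a b a' b' : ℝ} {F : ℝ → ℝ} (h : Conc a b F) (ha : a ≤ a') (hb : b' ≤ b) :
    Conc a' b' F :=
  fun x y z h1 h2 h3 h4 => h x y z (ha.trans h1) h2 h3 (h4.trans hb)

/-- A concave function on `[a, b]`, with caps `lam` and `rho` for its slopes that are still to be
applied.  The function is given by a chain of `len` segments, or is linear if `len = 0`. -/
structure Arc where
  a : ℝ
  b : ℝ
  lam : ℝ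
  rho : ℝ
  F : ℝ → ℝ
  len : ℕ
  lt : a < b
  conc : Conc a b F
  lin : len = 0 → ∀ x, a ≤ x → x ≤ b → F x = F a + (F b - F a) / (b - a) * (x - a)

/-- The affine map `(x, y) ↦ (± x, y + c + g * x)`. -/
structure Tag where
  f : Bool
  c : ℝ
  g : ℝ

namespace Tag

/-- The sign of a tag. -/
noncomputable def sg : Bool → ℝ
  | true => -1
  | false => 1

@[simp] theorem sg_true : sg true = -1 := rfl
@[simp] theorem sg_false : sg false = 1 := rfl

theorem sg_xor (f f' : Bool) : sg (f ^^ f') = sg f * sg f' := by cases f <;> cases f' <;> simp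

noncomputable def comp (s t : Tag) : Tag := ⟨s.f ^^ t.f, s.c + t.c, s.g + sg s.f * t.g⟩

def one : Tag := ⟨false, 0, 0⟩
def flip : Tag := ⟨true, 0, 0⟩

noncomputable def enc (t : Tag) : Val := .cell (.num (sg t.f)) (.cell (.num t.c) (.num t.g))

end Tag

theorem Arc.ext' {A B : Arc} (h1 : A.a = B.a) (h2 : A.b = B.b) (h3 : A.lam = B.lam)
    (h4 : A.rho = B.rho) (h5 : A.F = B.F) (h6 : A.len = B.len) : A = B := by
  cases A; cases B; simp_all

namespace Arc

noncomputable def chord (A : Arc) : ℝ := (A.F A.b - A.F A.a) / (A.b - A.a)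

theorem chord_mul (A : Arc) : A.chord * (A.b - A.a) = A.F A.b - A.F A.a := by
  have := A.lt
  unfold chord
  field_simp [sub_ne_zero.mpr this.ne']

/-- The function with the caps applied. -/
noncomputable def G (A : Arc) (x : ℝ) : ℝ :=
  min (A.F x) (min (A.F A.a + A.lam * (x - A.a)) (A.F A.b + A.rho * (x - A.b)))

/-- The caps do not change the values at the end points. -/
def Tight (A : Arc) : Prop := A.rho ≤ A.chord ∧ A.chord ≤ A.lam

/-- A sign is its own inverse, so `Tag.sg t.f * x` is the preimage of `x`. A reflection exchanges
the ends and negates slopes, which exchanges the two caps. -/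
noncomputable def app (t : Tag) (A : Arc) : Arc where
  a := if t.f then -A.b else A.a
  b := if t.f then -A.a else A.b
  lam := if t.f then -(A.rho + t.g) else A.lam + t.g
  rho := if t.f then -(A.lam + t.g) else A.rho + t.g
  F x := A.F (Tag.sg t.f * x) + (t.c + t.g * (Tag.sg t.f * x))
  len := A.len
  lt := by have := A.lt; split_ifs <;> linarith
  conc := by
    intro x y z h1 h2 h3 h4
    cases hf : t.f <;> simp only [hf, if_true, if_false, Bool.false_eq_true] at *
    · have := A.conc x y z h1 h2 h3 h4
      simp only [Tag.sg_false, one_mul]; linarith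
    · have := A.conc (-z) (-y) (-x) (by linarith) (by linarith) (by linarith) (by linarith)
      simp only [Tag.sg_true, neg_one_mul]; linarith
  lin := by
    intro h x h1 h2
    have hlt := A.lt
    have hne : A.b - A.a ≠ 0 := by linarith
    cases hf : t.f <;> simp only [hf, if_true, if_false, Bool.false_eq_true] at *
    · have e := A.lin h x h1 h2
      simp only [Tag.sg_false, one_mul, e]; field_simp; ring
    · have e := A.lin h (-x) (by linarith) (by linarith)
      have hne' : -A.a - -A.b ≠ 0 := by linarith
      have : -A.a - -A.b = A.b - A.a := by ring
      simp only [Tag.sg_true, neg_one_mul, e, neg_neg, this]; field_simp; ring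

/-- `F` stays untouched, so capping a leaf costs no work on its chain. -/
noncomputable def cap (l r : ℝ) (A : Arc) : Arc := { A with lam := min A.lam l, rho := max A.rho r }

@[simp] theorem cap_a (l r : ℝ) (A : Arc) : (A.cap l r).a = A.a := rfl
@[simp] theorem cap_b (l r : ℝ) (A : Arc) : (A.cap l r).b = A.b := rfl
@[simp] theorem cap_F (l r : ℝ) (A : Arc) : (A.cap l r).F = A.F := rfl
@[simp] theorem cap_len (l r : ℝ) (A : Arc) : (A.cap l r).len = A.len := rfl
@[simp] theorem cap_lam (l r : ℝ) (A : Arc) : (A.cap l r).lam = min A.lam l := rfl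
@[simp] theorem cap_rho (l r : ℝ) (A : Arc) : (A.cap l r).rho = max A.rho r := rfl
@[simp] theorem cap_chord (l r : ℝ) (A : Arc) : (A.cap l r).chord = A.chord := rfl
@[simp] theorem app_len (t : Tag) (A : Arc) : (A.app t).len = A.len := rfl

theorem app_F_a (t : Tag) (A : Arc) : (A.app t).F (A.app t).a =
    if t.f then A.F A.b + (t.c + t.g * A.b) else A.F A.a + (t.c + t.g * A.a) := by
  cases hf : t.f <;> simp [app, hf]

theorem app_F_b (t : Tag) (A : Arc) : (A.app t).F (A.app t).b =
    if t.f then A.F A.a + (t.c + t.g * A.a) else A.F A.b + (t.c + t.g * A.b) := by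
  cases hf : t.f <;> simp [app, hf]

theorem app_chord (t : Tag) (A : Arc) :
    (A.app t).chord = if t.f then -(A.chord + t.g) else A.chord + t.g := by
  have hlt := A.lt
  have hne : A.b - A.a ≠ 0 := by linarith
  unfold chord
  rw [app_F_a, app_F_b]
  cases hf : t.f
  · simp [app, hf]; field_simp; ring
  · have : -A.a + A.b ≠ 0 := by linarith
    simp [app, hf]; field_simp; ring

theorem app_app (s t : Tag) (A : Arc) : (A.app s).app t = A.app (s.comp t) := by
  apply Arc.ext'
  · cases hs : s.f <;> cases ht : t.f <;> simp [app, Tag.comp, hs, ht]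
  · cases hs : s.f <;> cases ht : t.f <;> simp [app, Tag.comp, hs, ht]
  · cases hs : s.f <;> cases ht : t.f <;> simp [app, Tag.comp, hs, ht] <;> ring
  · cases hs : s.f <;> cases ht : t.f <;> simp [app, Tag.comp, hs, ht] <;> ring
  · funext x
    cases hs : s.f <;> cases ht : t.f <;> simp [app, Tag.comp, hs, ht] <;> ring
  · rfl

theorem app_one (A : Arc) : A.app Tag.one = A := by
  apply Arc.ext' <;> simp [app, Tag.one]

theorem cap_cap (l r l' r' : ℝ) (A : Arc) :
    (A.cap l r).cap l' r' = A.cap (min l l') (max r r') := by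
  apply Arc.ext' <;> simp [min_assoc, max_assoc]

theorem cap_eq_self {l r : ℝ} {A : Arc} (hl : A.lam ≤ l) (hr : r ≤ A.rho) : A.cap l r = A := by
  apply Arc.ext' <;> simp [hl, hr]

theorem app_cap (l r : ℝ) (t : Tag) (A : Arc) : (A.cap l r).app t =
    (A.app t).cap (if t.f then -(r + t.g) else l + t.g) (if t.f then -(l + t.g) else r + t.g) := by
  apply Arc.ext'
  · simp [app]
  · simp [app]
  · cases hf : t.f <;> simp [app, hf]
    · rw [min_add_add_right]
    · rw [max_def, min_def]; split_ifs <;> linarith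
  · cases hf : t.f <;> simp [app, hf]
    · rw [max_add_add_right]
    · rw [max_def, min_def]; split_ifs <;> linarith
  · simp [app]
  · rfl

theorem Tight.app {A : Arc} (h : A.Tight) (t : Tag) : (A.app t).Tight := by
  obtain ⟨h1, h2⟩ := h
  unfold Tight
  rw [app_chord]
  cases hf : t.f <;> simp [Arc.app, hf] <;> constructor <;> linarith

theorem Tight.cap {A : Arc} {l r : ℝ} (h : A.Tight) (hl : A.chord ≤ l) (hr : r ≤ A.chord) :
    (A.cap l r).Tight :=
  ⟨max_le h.1 hr, le_min h.2 hl⟩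

theorem app_G (t : Tag) (A : Arc) (x : ℝ) :
    (A.app t).G x = A.G (Tag.sg t.f * x) + (t.c + t.g * (Tag.sg t.f * x)) := by
  unfold G
  rw [app_F_a, app_F_b, min_add, min_add]
  cases hf : t.f <;> simp [app, hf]
  · congr 2 <;> ring_nf
  · congr 1
    rw [min_comm]
    congr 1 <;> ring

/-- Since `rho` does not exceed the chord slope, the line through the right end passes on or above
the left end value; the other line goes through it. -/
theorem G_a {A : Arc} (h : A.Tight) : A.G A.a = A.F A.a := by
  have := A.lt
  have e := A.chord_mul
  have h1 := mul_le_mul_of_nonneg_right h.1 (sub_nonneg.mpr this.le)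
  unfold G
  rw [min_eq_left]
  apply le_min <;> linarith

theorem G_b {A : Arc} (h : A.Tight) : A.G A.b = A.F A.b := by
  have := A.lt
  have e := A.chord_mul
  have h1 := mul_le_mul_of_nonneg_right h.2 (sub_nonneg.mpr this.le)
  unfold G
  rw [min_eq_left]
  apply le_min <;> linarith

theorem G_conc (A : Arc) : Conc A.a A.b A.G :=
  A.conc.min ((Conc.line _ _ _ _ _).min (Conc.line _ _ _ _ _))

end Arc

/-! ## Lists of arcs -/

/-- The arcs, moved by a tag. -/
noncomputable def appL (t : Tag) (As : List Arc) : List Arc :=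
  if t.f then (As.map (Arc.app t)).reverse else As.map (Arc.app t)

theorem mem_appL {t : Tag} {As : List Arc} {A : Arc} :
    A ∈ appL t As ↔ ∃ B ∈ As, B.app t = A := by
  unfold appL; split_ifs <;> simp

@[simp] theorem length_appL (t : Tag) (As : List Arc) : (appL t As).length = As.length := by
  unfold appL; split_ifs <;> simp

@[simp] theorem appL_nil (t : Tag) : appL t [] = [] := by
  unfold appL; split_ifs <;> simp

@[simp] theorem appL_singleton (t : Tag) (A : Arc) : appL t [A] = [A.app t] := by
  unfold appL; split_ifs <;> simp

theorem appL_append (t : Tag) (As Bs : List Arc) : appL t (As ++ Bs) =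
    if t.f then appL t Bs ++ appL t As else appL t As ++ appL t Bs := by
  unfold appL; split_ifs <;> simp

theorem appL_appL (s t : Tag) (As : List Arc) : appL t (appL s As) = appL (s.comp t) As := by
  cases hs : s.f <;> cases ht : t.f <;> simp [appL, Tag.comp, hs, ht, Function.comp_def, Arc.app_app]

@[simp] theorem appL_one (As : List Arc) : appL Tag.one As = As := by
  have : Arc.app Tag.one = id := funext Arc.app_one
  rw [appL, this]; simp [Tag.one]

@[simp] theorem appL_flip_flip (As : List Arc) : appL Tag.flip (appL Tag.flip As) = As := by
  rw [appL_appL]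
  have : Tag.flip.comp Tag.flip = Tag.one := by simp [Tag.flip, Tag.comp, Tag.one]
  rw [this, appL_one]

theorem appL_map_cap (l r : ℝ) (t : Tag) (As : List Arc) : appL t (As.map (Arc.cap l r)) =
    (appL t As).map (Arc.cap (if t.f then -(r + t.g) else l + t.g)
      (if t.f then -(l + t.g) else r + t.g)) := by
  unfold appL
  cases hf : t.f <;> simp [Function.comp_def, Arc.app_cap, hf]

/-- The arcs join up, from the point `(p, y)` to the point `(q, z)`. -/
def Path (p y : ℝ) : List Arc → ℝ → ℝ → Prop
  | [], q, z => p = q ∧ y = z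
  | A :: As, q, z => (p = A.a ∧ y = A.F A.a) ∧ Path A.b (A.F A.b) As q z

theorem path_append {p y q z : ℝ} {As Bs : List Arc} :
    Path p y (As ++ Bs) q z ↔ ∃ m w, Path p y As m w ∧ Path m w Bs q z := by
  induction As generalizing p y with
  | nil =>
    simp only [Path, List.nil_append]
    constructor
    · exact fun h => ⟨p, y, ⟨rfl, rfl⟩, h⟩
    · rintro ⟨m, w, ⟨rfl, rfl⟩, h⟩; exact h
  | cons A As ih =>
    simp only [Path, List.cons_append, ih]
    constructor
    · rintro ⟨h, m, w, h1, h2⟩; exact ⟨m, w, ⟨h, h1⟩, h2⟩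
    · rintro ⟨m, w, ⟨h, h1⟩, h2⟩; exact ⟨h, m, w, h1, h2⟩

theorem path_map_cap {p y q z l r : ℝ} {As : List Arc} :
    Path p y (As.map (Arc.cap l r)) q z ↔ Path p y As q z := by
  induction As generalizing p y with
  | nil => rfl
  | cons A As ih => simp [Path, ih]

theorem Path.app {p y q z : ℝ} {As : List Arc} (h : Path p y As q z) (t : Tag) :
    if t.f then Path (-q) (z + (t.c + t.g * q)) (appL t As) (-p) (y + (t.c + t.g * p))
    else Path p (y + (t.c + t.g * p)) (appL t As) q (z + (t.c + t.g * q)) := by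
  induction As generalizing p y with
  | nil =>
    obtain ⟨rfl, rfl⟩ := h
    simp [Path]
  | cons A As ih =>
    obtain ⟨⟨rfl, rfl⟩, h⟩ := h
    have := ih h
    rw [← List.singleton_append, appL_append]
    cases hf : t.f <;> simp only [hf, if_true, if_false, Bool.false_eq_true] at this ⊢
    · rw [path_append]
      refine ⟨_, _, ?_, this⟩
      simp [Path, Arc.app_F_a, Arc.app_F_b, hf]
      simp [Arc.app, hf]
    · rw [path_append]
      refine ⟨_, _, this, ?_⟩
      simp [Path, Arc.app_F_a, Arc.app_F_b, hf]
      simp [Arc.app, hf]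

theorem Path.unique {p y q z q' z' : ℝ} {As : List Arc} (h : Path p y As q z)
    (h' : Path p y As q' z') : q = q' ∧ z = z' := by
  induction As generalizing p y with
  | nil => obtain ⟨rfl, rfl⟩ := h; exact h'
  | cons A As ih => exact ih h.2 h'.2

theorem Path.le {p y q z : ℝ} {As : List Arc} (h : Path p y As q z) : p ≤ q := by
  induction As generalizing p y with
  | nil => exact h.1.le
  | cons A As ih =>
    have := A.lt
    have := ih h.2
    rw [h.1.1]; linarith

theorem Path.mem {p y q z : ℝ} {As : List Arc} (h : Path p y As q z) {A : Arc} (hA : A ∈ As) :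
    p ≤ A.a ∧ A.b ≤ q := by
  induction As generalizing p y with
  | nil => simp at hA
  | cons B As ih =>
    have h1 := h.2.le
    rcases List.mem_cons.mp hA with rfl | hA
    · exact ⟨h.1.1.le, h1⟩
    · have h2 := ih h.2 hA
      have := B.lt
      exact ⟨by rw [h.1.1]; linarith, h2.2⟩

theorem Path.lt {p y q z : ℝ} {As : List Arc} (h : Path p y As q z) (hne : As ≠ []) : p < q := by
  obtain ⟨A, hA⟩ := List.exists_mem_of_ne_nil _ hne
  have h1 := h.mem hA
  have := A.lt
  linarith

/-! ## Trees -/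

/-- The header of a tree. -/
structure Hdr where
  xa : ℝ
  ya : ℝ
  xb : ℝ
  yb : ℝ
  hi : ℝ
  lo : ℝ
  lam : ℝ
  rho : ℝ
  h : ℕ

namespace Hdr

def enc (H : Hdr) : Val :=
  .cell (.cell (.cell (.num H.xa) (.num H.ya)) (.cell (.num H.xb) (.num H.yb)))
    (.cell (.cell (.cell (.num H.hi) (.num H.lo)) (.cell (.num H.lam) (.num H.rho)))
      (.num (H.h : ℝ)))

noncomputable def app (t : Tag) (H : Hdr) : Hdr :=
  if t.f then
    ⟨-H.xb, H.yb + (t.c + t.g * H.xb), -H.xa, H.ya + (t.c + t.g * H.xa),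
      -(H.lo + t.g), -(H.hi + t.g), -(H.rho + t.g), -(H.lam + t.g), H.h⟩
  else
    ⟨H.xa, H.ya + (t.c + t.g * H.xa), H.xb, H.yb + (t.c + t.g * H.xb),
      H.hi + t.g, H.lo + t.g, H.lam + t.g, H.rho + t.g, H.h⟩

noncomputable def cap (l r : ℝ) (H : Hdr) : Hdr := { H with lam := min H.lam l, rho := max H.rho r }

@[simp] theorem app_h (t : Tag) (H : Hdr) : (H.app t).h = H.h := by
  unfold app; split_ifs <;> rfl

/-- The header describes the list of arcs. -/
structure For (H : Hdr) (As : List Arc) : Prop where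
  ne : As ≠ []
  path : Path H.xa H.ya As H.xb H.yb
  hi : ∀ r, H.hi ≤ r ↔ ∀ A ∈ As, A.chord ≤ r
  lo : ∀ r, r ≤ H.lo ↔ ∀ A ∈ As, r ≤ A.chord
  caps : ∀ A ∈ As, A.lam ≤ H.lam ∧ H.rho ≤ A.rho

/-- Reflection turns the largest chord slope into the negative of the smallest one, which is why
headers keep both extremes. -/
theorem For.app {H : Hdr} {As : List Arc} (h : H.For As) (t : Tag) :
    (H.app t).For (appL t As) where
  ne := by
    intro h0
    have := congrArg List.length h0
    rw [length_appL] at this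
    exact h.ne (List.length_eq_zero_iff.mp this)
  path := by
    have := h.path.app t
    unfold Hdr.app
    split_ifs at this ⊢ <;> exact this
  hi := by
    intro r
    simp only [mem_appL, forall_exists_index, and_imp, forall_apply_eq_imp_iff₂, Arc.app_chord,
      Hdr.app]
    cases t.f
    · have := h.hi (r - t.g)
      simp only [le_sub_iff_add_le] at this
      simpa using this
    · have := h.lo (-r - t.g)
      simp only [sub_le_iff_le_add] at this
      simp only [if_true, neg_le (b := r)]
      exact this
  lo := by
    intro r
    simp only [mem_appL, forall_exists_index, and_imp, forall_apply_eq_imp_iff₂, Arc.app_chord,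
      Hdr.app]
    cases t.f
    · have := h.lo (r - t.g)
      simp only [sub_le_iff_le_add] at this
      simpa using this
    · have := h.hi (-r - t.g)
      simp only [le_sub_iff_add_le] at this
      simp only [if_true, le_neg (a := r)]
      exact this
  caps := by
    intro A hA
    obtain ⟨B, hB, rfl⟩ := mem_appL.mp hA
    have := h.caps B hB
    unfold Hdr.app Arc.app
    split_ifs <;> constructor <;> simp <;> linarith

theorem For.cap {H : Hdr} {As : List Arc} (h : H.For As) (l r : ℝ) :
    (H.cap l r).For (As.map (Arc.cap l r)) where
  ne := by simpa using h.ne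
  path := path_map_cap.mpr h.path
  hi := by intro x; simpa [Hdr.cap] using h.hi x
  lo := by intro x; simpa [Hdr.cap] using h.lo x
  caps := by
    intro A hA
    obtain ⟨B, hB, rfl⟩ := List.mem_map.mp hA
    exact ⟨min_le_min_right _ (h.caps B hB).1, max_le_max_right _ (h.caps B hB).2⟩

end Hdr

/-- The header of a leaf. -/
noncomputable def Arc.hdr (A : Arc) : Hdr :=
  ⟨A.a, A.F A.a, A.b, A.F A.b, A.chord, A.chord, A.lam, A.rho, 0⟩

theorem Arc.hdr_for (A : Arc) : A.hdr.For [A] := by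
  constructor <;> simp [hdr, Path]

theorem Arc.hdr_app (t : Tag) (A : Arc) : (A.app t).hdr = A.hdr.app t := by
  unfold hdr
  rw [app_F_a, app_F_b, app_chord]
  cases hf : t.f <;> simp [Hdr.app, hf, Arc.app]

/-- `Rep H v As`: the tree with header `H` and body `v` stands for the arcs `As`. -/
inductive Rep : Hdr → Val → List Arc → Prop
  | seg {A : Arc} (t : Tag) : A.len = 0 →
      Rep A.hdr (.cell t.enc (.cell (.num 0) (.num 0))) [A]
  | arc {A : Arc} (t : Tag) {H : Hdr} {v : Val} {Ss : List Arc} : Rep H v Ss →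
      (∀ S ∈ Ss, S.len = 0) → Path A.a (A.F A.a) Ss A.b (A.F A.b) → A.len = Ss.length →
      (∀ S ∈ Ss, ∀ x, S.a ≤ x → x ≤ S.b → S.F x = A.F x) →
      Rep A.hdr (.cell t.enc (.cell (.cell H.enc v) (.num 0))) [A]
  | node {H : Hdr} (t : Tag) {Hl : Hdr} {l : Val} {Hr : Hdr} {r : Val} {As Bs Cs : List Arc} :
      Rep Hl l Bs → Rep Hr r Cs → Hl.h ≤ Hr.h + 1 → Hr.h ≤ Hl.h + 1 →
      H.h = max Hl.h Hr.h + 1 → H.For As →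
      As = (appL t (Bs ++ Cs)).map (Arc.cap H.lam H.rho) →
      Rep H (.cell t.enc (.cell (.cell Hl.enc l) (.cell Hr.enc r))) As

theorem Rep.hdr_for {H : Hdr} {v : Val} {As : List Arc} (h : Rep H v As) : H.For As := by
  cases h with
  | seg => exact Arc.hdr_for _
  | arc => exact Arc.hdr_for _
  | node => assumption

/-- The value `v` is a tree with header `H` for the arcs `As`. -/
def Tree (v : Val) (H : Hdr) (As : List Arc) : Prop := ∃ b, v = .cell H.enc b ∧ Rep H b As

/-! ### Moving, capping and opening trees -/

theorem Tag.sg_neg_iff {f : Bool} : sg f < ((0 : ℤ) : ℝ) ↔ f = true := by cases f <;> simp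

theorem Tag.sg_nonneg_iff {f : Bool} : ¬ sg f < ((0 : ℤ) : ℝ) ↔ f = false := by
  cases f <;> simp

theorem hdr_spec (H : Hdr) (t : Tag) : Calls program fHdr (.cell H.enc t.enc)
    fun w s => w = (H.app t).enc ∧ s ≤ 150 := by
  refine Calls.of_sem hdrBody rfl ?_
  -- `Sem` recurses on the program text, so weak head reduction executes the body symbolically up to
  -- the next comparison, or up to the next call, where the irreducible `Calls` stops it.
  conv => whnf
  constructor
  · intro h
    conv => whnf
    refine ⟨?_, by omega⟩
    have : t.f = true := Tag.sg_neg_iff.mp h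
    simp [Hdr.app, Hdr.enc, this]
  · intro h
    conv => whnf
    refine ⟨?_, by omega⟩
    have : t.f = false := Tag.sg_nonneg_iff.mp h
    simp [Hdr.app, Hdr.enc, this]

theorem Tag.comp_enc (s t : Tag) : (s.comp t).enc = .cell (.num (sg s.f * sg t.f))
    (.cell (.num (s.c + t.c)) (.num (s.g + sg s.f * t.g))) := by
  simp [comp, enc, sg_xor]

/-- The header is moved at once and the tag is composed lazily. Only a leaf passes the tag on, to
its chain, and the leaves of a chain are segments without chains. So the recursion has depth at most
two, which gives the bounds 250 and 500. The tag stored at a leaf has no meaning. -/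
theorem Rep.app {H : Hdr} {b : Val} {As : List Arc} (h : Rep H b As) (t : Tag) :
    Calls program fApp (.cell (.cell H.enc b) t.enc) fun w s =>
      Tree w (H.app t) (appL t As) ∧ s ≤ 500 ∧ ((∀ A ∈ As, A.len = 0) → s ≤ 250) := by
  induction h with
  | @seg A t' hA =>
    refine Calls.of_sem appBody rfl ?_
    conv => whnf
    refine (hdr_spec _ _).mono ?_
    rintro _ s ⟨rfl, hs⟩
    conv => whnf
    refine ⟨fun _ => ?_, fun h => absurd (by simp [Arc.hdr]) h⟩
    conv => whnf
    -- A segment has the number 0 in place of a chain, and the inner call returns it unchanged.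
    refine Calls.of_sem appBody rfl ?_
    conv => whnf
    refine ⟨?_, by omega, fun _ => by omega⟩
    rw [← Arc.hdr_app, ← Tag.comp_enc, appL_singleton]
    exact ⟨_, rfl, .seg _ hA⟩
  | @arc A t' H v Ss hR hS hp hl hF ih =>
    refine Calls.of_sem appBody rfl ?_
    conv => whnf
    refine (hdr_spec _ _).mono ?_
    rintro _ s ⟨rfl, hs⟩
    conv => whnf
    refine ⟨fun _ => ?_, fun h => absurd (by simp [Arc.hdr]) h⟩
    conv => whnf
    refine ih.mono ?_
    rintro _ s' ⟨⟨w, rfl, hw⟩, -, hs'⟩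
    replace hs' := hs' hS
    conv => whnf
    refine ⟨?_, by omega, fun h0 => ?_⟩
    · rw [← Arc.hdr_app, ← Tag.comp_enc, appL_singleton]
      refine ⟨_, rfl, .arc _ hw ?_ ?_ ?_ ?_⟩
      · intro S hS'
        obtain ⟨B, hB, rfl⟩ := mem_appL.mp hS'
        exact hS B hB
      · rw [Arc.app_F_a, Arc.app_F_b]
        have := hp.app t
        cases hf : t.f <;> simpa [Arc.app, hf] using this
      · simpa using hl
      · intro S hS' x h1 h2
        obtain ⟨B, hB, rfl⟩ := mem_appL.mp hS'
        simp only [Arc.app] at h1 h2 ⊢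
        rw [hF B hB]
        · cases hf : t.f <;> simp [hf] at h1 h2 ⊢ <;> linarith
        · cases hf : t.f <;> simp [hf] at h1 h2 ⊢ <;> linarith
    -- An arc with a chain has positive length, so the sharper bound is not claimed for it.
    · have h1 := h0 A (by simp)
      have := hR.hdr_for.ne
      rw [h1, eq_comm, List.length_eq_zero_iff] at hl
      contradiction
  | @node H t' Hl l Hr r As Bs Cs hl hr h1 h2 h3 h4 h5 _ _ =>
    refine Calls.of_sem appBody rfl ?_
    conv => whnf
    refine (hdr_spec _ _).mono ?_
    rintro _ s ⟨rfl, hs⟩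
    conv => whnf
    refine ⟨fun h => ?_, fun _ => ?_⟩
    · have : ((H.h : ℕ) : ℝ) < ((1 : ℤ) : ℝ) := h
      norm_num at this
      omega
    conv => whnf
    refine ⟨?_, by omega, fun _ => by omega⟩
    rw [← Tag.comp_enc]
    refine ⟨_, rfl, .node _ hl hr h1 h2 (by simpa using h3) (h4.app t) ?_⟩
    rw [h5, appL_map_cap, appL_appL]
    cases hf : t.f <;> simp [Hdr.app, hf]

theorem max_spec (x y : ℝ) : Calls program fMax (.cell (.num x) (.num y))
    fun w s => w = .num (max x y) ∧ s ≤ 20 := by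
  refine Calls.of_sem maxBody rfl ?_
  conv => whnf
  refine ⟨fun h => ?_, fun h => ?_⟩
  · conv => whnf
    exact ⟨by rw [max_eq_right h.le], by omega⟩
  · conv => whnf
    exact ⟨by rw [max_eq_left (not_lt.mp h)], by omega⟩

theorem min_spec (x y : ℝ) : Calls program fMin (.cell (.num x) (.num y))
    fun w s => w = .num (min x y) ∧ s ≤ 20 := by
  refine Calls.of_sem minBody rfl ?_
  conv => whnf
  refine ⟨fun h => ?_, fun h => ?_⟩
  · conv => whnf
    exact ⟨by rw [min_eq_left h.le], by omega⟩
  · conv => whnf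
    exact ⟨by rw [min_eq_right (not_lt.mp h)], by omega⟩

theorem Hdr.cap_enc (H : Hdr) (l r : ℝ) : (H.cap l r).enc =
    .cell (.cell (.cell (.num H.xa) (.num H.ya)) (.cell (.num H.xb) (.num H.yb)))
    (.cell (.cell (.cell (.num H.hi) (.num H.lo)) (.cell (.num (min H.lam l)) (.num (max H.rho r))))
      (.num (H.h : ℝ))) := rfl

/-- Caps live in headers only. In a node they act after the tag, so new caps simply combine with the
old ones and the body stays. -/
theorem Rep.cap' {H : Hdr} {b : Val} {As : List Arc} (h : Rep H b As) (l r : ℝ) :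
    Rep (H.cap l r) b (As.map (Arc.cap l r)) := by
  cases h with
  | @seg A t' hA => exact Rep.seg (A := A.cap l r) t' hA
  | @arc A t' H v Ss hR hS hp hl hF => exact Rep.arc (A := A.cap l r) t' hR hS hp hl hF
  | @node H t' Hl l Hr r As Bs Cs hl hr h1 h2 h3 h4 h5 =>
    refine .node _ hl hr h1 h2 h3 (h4.cap _ _) ?_
    rw [h5, List.map_map]
    exact List.map_congr_left fun A _ => Arc.cap_cap _ _ _ _ A

theorem Rep.cap {H : Hdr} {b : Val} {As : List Arc} (h : Rep H b As) (l r : ℝ) :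
    Calls program fCap (.cell (.cell H.enc b) (.cell (.num l) (.num r))) fun w s =>
      Tree w (H.cap l r) (As.map (Arc.cap l r)) ∧ s ≤ 150 := by
  refine Calls.of_sem capBody rfl ?_
  conv => whnf
  refine (min_spec _ _).mono ?_
  rintro _ s1 ⟨rfl, hs1⟩
  conv => whnf
  refine (max_spec _ _).mono ?_
  rintro _ s2 ⟨rfl, hs2⟩
  conv => whnf
  exact ⟨⟨_, by rw [Hdr.cap_enc], h.cap' l r⟩, by omega⟩

/-- The tag acts on the children before the caps of the node. A reflecting tag reverses the order of
the arcs, so the old right child becomes the left one. -/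
theorem Rep.push {H : Hdr} {b : Val} {As : List Arc} (h : Rep H b As) (h0 : H.h ≠ 0) :
    Calls program fPush (.cell H.enc b) fun w s => ∃ l r Hl Hr Bs Cs, w = .cell l r ∧
      Tree l Hl Bs ∧ Tree r Hr Cs ∧ As = Bs ++ Cs ∧ Hl.h ≤ Hr.h + 1 ∧ Hr.h ≤ Hl.h + 1 ∧
      H.h = max Hl.h Hr.h + 1 ∧ s ≤ 1500 := by
  cases h with
  | @seg A t' hA => exact absurd rfl h0
  | @arc A t' H v Ss hR hS hp hl hF => exact absurd rfl h0
  | @node H t Hl l Hr r As Bs Cs hl hr h1 h2 h3 h4 h5 =>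
    refine Calls.of_sem pushBody rfl ?_
    conv => whnf
    refine (hl.app t).mono ?_
    rintro _ s1 ⟨⟨l1, rfl, hl1⟩, hs1, -⟩
    conv => whnf
    refine (hl1.cap H.lam H.rho).mono ?_
    rintro _ s2 ⟨⟨l2, rfl, hl2⟩, hs2⟩
    conv => whnf
    refine (hr.app t).mono ?_
    rintro _ s3 ⟨⟨r1, rfl, hr1⟩, hs3, -⟩
    conv => whnf
    refine (hr1.cap H.lam H.rho).mono ?_
    rintro _ s4 ⟨⟨r2, rfl, hr2⟩, hs4⟩
    conv => whnf
    rw [appL_append] at h5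
    refine ⟨fun h => ?_, fun h => ?_⟩
    · have hf : t.f = true := Tag.sg_neg_iff.mp h
      conv => whnf
      rw [if_pos hf, List.map_append] at h5
      exact ⟨_, _, _, _, _, _, rfl, ⟨_, rfl, hr2⟩, ⟨_, rfl, hl2⟩, h5, by simpa [Hdr.cap] using h2,
        by simpa [Hdr.cap] using h1, by simpa [Hdr.cap, max_comm] using h3, by omega⟩
    · have hf : t.f = false := Tag.sg_nonneg_iff.mp h
      conv => whnf
      rw [hf, if_neg (by simp), List.map_append] at h5
      exact ⟨_, _, _, _, _, _, rfl, ⟨_, rfl, hl2⟩, ⟨_, rfl, hr2⟩, h5, by simpa [Hdr.cap] using h1,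
        by simpa [Hdr.cap] using h2, by simpa [Hdr.cap] using h3, by omega⟩

/-! ### Joining balanced trees -/

/-- The arcs join up. -/
def Linked (As : List Arc) : Prop := ∃ p y q z, Path p y As q z

theorem Linked.left {As Bs : List Arc} (h : Linked (As ++ Bs)) : Linked As := by
  obtain ⟨p, y, q, z, h⟩ := h
  obtain ⟨m, w, h1, h2⟩ := path_append.mp h
  exact ⟨_, _, _, _, h1⟩

theorem Linked.right {As Bs : List Arc} (h : Linked (As ++ Bs)) : Linked Bs := by
  obtain ⟨p, y, q, z, h⟩ := h
  obtain ⟨m, w, h1, h2⟩ := path_append.mp h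
  exact ⟨_, _, _, _, h2⟩

theorem Linked.app {As : List Arc} (h : Linked As) (t : Tag) : Linked (appL t As) := by
  obtain ⟨p, y, q, z, h⟩ := h
  have := h.app t
  split_ifs at this <;> exact ⟨_, _, _, _, this⟩

theorem Path.start {p y q z p' y' q' z' : ℝ} {As : List Arc} (h : Path p y As q z)
    (h' : Path p' y' As q' z') (hne : As ≠ []) : p = p' ∧ y = y' := by
  cases As with
  | nil => exact absurd rfl hne
  | cons A As =>
    have h1 := h.1
    have h2 := h'.1
    exact ⟨h1.1.trans h2.1.symm, h1.2.trans h2.2.symm⟩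

theorem Hdr.For.linked {H : Hdr} {As : List Arc} (h : H.For As) : Linked As :=
  ⟨_, _, _, _, h.path⟩

theorem Tree.hdr_for {v : Val} {H : Hdr} {As : List Arc} (h : Tree v H As) : H.For As := by
  obtain ⟨b, rfl, h⟩ := h
  exact h.hdr_for

theorem Hdr.For.join {H K : Hdr} {As Bs : List Arc} (h : H.For As) (k : K.For Bs)
    (hl : Linked (As ++ Bs)) : H.xb = K.xa ∧ H.yb = K.ya := by
  obtain ⟨p, y, q, z, hp⟩ := hl
  obtain ⟨m, w, h1, h2⟩ := path_append.mp hp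
  obtain ⟨rfl, rfl⟩ := h.path.start h1 h.ne
  obtain ⟨rfl, rfl⟩ := h.path.unique h1
  exact h2.start k.path k.ne

theorem tree_mk {l r : Val} {Hl Hr : Hdr} {Bs Cs : List Arc} (hl : Tree l Hl Bs) (hr : Tree r Hr Cs)
    (hlink : Linked (Bs ++ Cs)) (h1 : Hl.h ≤ Hr.h + 1) (h2 : Hr.h ≤ Hl.h + 1) :
    Calls program fMk (.cell l r) fun w s => ∃ H, Tree w H (Bs ++ Cs) ∧ H.h = max Hl.h Hr.h + 1 ∧
      s ≤ 300 := by
  have hlf := hl.hdr_for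
  have hrf := hr.hdr_for
  obtain ⟨l, rfl, hl⟩ := hl
  obtain ⟨r, rfl, hr⟩ := hr
  refine Calls.of_sem mkBody rfl ?_
  conv => whnf
  refine (max_spec _ _).mono ?_
  rintro _ s1 ⟨rfl, hs1⟩
  conv => whnf
  refine (min_spec _ _).mono ?_
  rintro _ s2 ⟨rfl, hs2⟩
  conv => whnf
  refine (max_spec _ _).mono ?_
  rintro _ s3 ⟨rfl, hs3⟩
  conv => whnf
  refine (min_spec _ _).mono ?_
  rintro _ s4 ⟨rfl, hs4⟩
  conv => whnf
  refine (max_spec _ _).mono ?_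
  rintro _ s5 ⟨rfl, hs5⟩
  conv => whnf
  let H : Hdr := ⟨Hl.xa, Hl.ya, Hr.xb, Hr.yb, max Hl.hi Hr.hi, min Hl.lo Hr.lo,
    max Hl.lam Hr.lam, min Hl.rho Hr.rho, max Hl.h Hr.h + 1⟩
  have hF : H.For (Bs ++ Cs) := by
    refine ⟨by simp [hlf.ne], ?_, ?_, ?_, ?_⟩
    · obtain ⟨e1, e2⟩ := hlf.join hrf hlink
      refine path_append.mpr ⟨_, _, hlf.path, ?_⟩
      rw [e1, e2]; exact hrf.path
    · intro x
      simp only [H, max_le_iff, hlf.hi, hrf.hi, List.mem_append, or_imp, forall_and]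
    · intro x
      simp only [H, le_min_iff, hlf.lo, hrf.lo, List.mem_append, or_imp, forall_and]
    · intro A hA
      rcases List.mem_append.mp hA with hA | hA
      · exact ⟨(hlf.caps A hA).1.trans (le_max_left _ _), (min_le_left _ _).trans (hlf.caps A hA).2⟩
      · exact ⟨(hrf.caps A hA).1.trans (le_max_right _ _),
          (min_le_right _ _).trans (hrf.caps A hA).2⟩
  refine ⟨H, ⟨_, ?_, .node Tag.one hl hr h1 h2 rfl hF ?_⟩, rfl, by omega⟩
  · simp [H, Hdr.enc, Tag.one, Tag.enc]
  -- Every arc already satisfies the caps of the new header, so identity tag and caps together act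
  -- trivially.
  · rw [appL_one]
    conv_lhs => rw [← List.map_id (Bs ++ Cs)]
    exact List.map_congr_left fun A hA => (Arc.cap_eq_self (hF.caps A hA).1 (hF.caps A hA).2).symm

theorem Tree.push {v : Val} {H : Hdr} {As : List Arc} (h : Tree v H As) (h0 : H.h ≠ 0) :
    Calls program fPush v fun w s => ∃ l r Hl Hr Bs Cs, w = .cell l r ∧
      Tree l Hl Bs ∧ Tree r Hr Cs ∧ As = Bs ++ Cs ∧ Hl.h ≤ Hr.h + 1 ∧ Hr.h ≤ Hl.h + 1 ∧
      H.h = max Hl.h Hr.h + 1 ∧ s ≤ 1500 := by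
  obtain ⟨b, rfl, h⟩ := h
  exact h.push h0

/-- A single or a double AVL rotation repairs an excess of two. The exact height in the case without
rotation is needed to see in `tree_join_aux` that a join is no lower than either argument. -/
theorem tree_bal {l r : Val} {Hl Hr : Hdr} {Bs Cs : List Arc} (hl : Tree l Hl Bs) (hr : Tree r Hr Cs)
    (hlink : Linked (Bs ++ Cs)) (h1 : Hl.h ≤ Hr.h + 1) (h2 : Hr.h ≤ Hl.h + 2) :
    Calls program fBal (.cell l r) fun w s => ∃ H, Tree w H (Bs ++ Cs) ∧
      H.h ≤ max Hl.h Hr.h + 1 ∧ max Hl.h Hr.h ≤ H.h ∧ (Hr.h ≤ Hl.h + 1 → H.h = max Hl.h Hr.h + 1) ∧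
      s ≤ 5000 := by
  have hl' := hl
  have hr' := hr
  obtain ⟨l, rfl, hl⟩ := hl
  obtain ⟨r, rfl, hr⟩ := hr
  refine Calls.of_sem balBody rfl ?_
  conv => whnf
  refine ⟨fun h => ?_, fun h => ?_⟩
  · replace h : (Hl.h : ℝ) + ((1 : ℤ) : ℝ) < Hr.h := h
    have hlt : Hl.h + 1 < Hr.h := by exact_mod_cast h
    conv => whnf
    refine (hr'.push (by omega)).mono ?_
    rintro _ s1 ⟨rl, rr, Hrl, Hrr, Cs1, Cs2, rfl, hrl, hrr, rfl, k1, k2, k3, hs1⟩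
    have hrl' := hrl
    have hrr' := hrr
    obtain ⟨rl, rfl, hrl⟩ := hrl
    obtain ⟨rr, rfl, hrr⟩ := hrr
    rw [← List.append_assoc] at hlink ⊢
    conv => whnf
    refine ⟨fun h => ?_, fun h => ?_⟩
    · replace h : (Hrr.h : ℝ) < Hrl.h := h
      replace h : Hrr.h < Hrl.h := by exact_mod_cast h
      conv => whnf
      refine (hrl'.push (by omega)).mono ?_
      rintro _ s2 ⟨ra, rb, Ha, Hb, Cs3, Cs4, rfl, ha, hb, rfl, k4, k5, k6, hs2⟩
      have e : Bs ++ (Cs3 ++ Cs4) ++ Cs2 = (Bs ++ Cs3) ++ (Cs4 ++ Cs2) := by simp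
      rw [e] at hlink ⊢
      conv => whnf
      refine (tree_mk hl' ha hlink.left (by omega) (by omega)).mono ?_
      rintro w1 s3 ⟨H1, hw1, k7, hs3⟩
      conv => whnf
      refine (tree_mk hb hrr' hlink.right (by omega) (by omega)).mono ?_
      rintro w2 s4 ⟨H2, hw2, k8, hs4⟩
      refine (tree_mk hw1 hw2 hlink (by omega) (by omega)).mono ?_
      rintro w3 s5 ⟨H3, hw3, k9, hs5⟩
      exact ⟨H3, hw3, by omega, by omega, by omega, by omega⟩
    · replace h : ¬ (Hrr.h : ℝ) < Hrl.h := h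
      replace h : ¬ Hrr.h < Hrl.h := by exact_mod_cast h
      conv => whnf
      refine (tree_mk hl' hrl' hlink.left (by omega) (by omega)).mono ?_
      rintro w1 s3 ⟨H1, hw1, k7, hs3⟩
      conv => whnf
      refine (tree_mk hw1 hrr' hlink (by omega) (by omega)).mono ?_
      rintro w2 s4 ⟨H2, hw2, k8, hs4⟩
      exact ⟨H2, hw2, by omega, by omega, by omega, by omega⟩
  · replace h : ¬ (Hl.h : ℝ) + ((1 : ℤ) : ℝ) < Hr.h := h
    have hlt : ¬ Hl.h + 1 < Hr.h := by exact_mod_cast h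
    conv => whnf
    refine (tree_mk hl' hr' hlink (by omega) (by omega)).mono ?_
    rintro w1 s3 ⟨H1, hw1, k7, hs3⟩
    exact ⟨H1, hw1, by omega, by omega, by omega, by omega⟩

/-- The join descends the right spine of the left tree, with constant work per level. Because a join
is at most one higher than its higher argument, the imbalance met on the way back never exceeds two.
-/
theorem tree_join_aux (n : ℕ) {l r : Val} {Hl Hr : Hdr} {Bs Cs : List Arc} (hl : Tree l Hl Bs)
    (hr : Tree r Hr Cs) (hlink : Linked (Bs ++ Cs)) (h1 : Hr.h ≤ Hl.h + 1) (hn : Hl.h ≤ n) :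
    Calls program fJoin (.cell l r) fun w s => ∃ H, Tree w H (Bs ++ Cs) ∧
      H.h ≤ max Hl.h Hr.h + 1 ∧ max Hl.h Hr.h ≤ H.h ∧ s ≤ 8000 * (n + 1) := by
  induction n generalizing l r Hl Hr Bs Cs with
  | zero =>
    have hl' := hl
    have hr' := hr
    obtain ⟨l, rfl, hl⟩ := hl
    obtain ⟨r, rfl, hr⟩ := hr
    refine Calls.of_sem joinBody rfl ?_
    conv => whnf
    refine ⟨fun h => ?_, fun h => ?_⟩
    · replace h : (Hr.h : ℝ) + ((1 : ℤ) : ℝ) < Hl.h := h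
      have hlt : Hr.h + 1 < Hl.h := by exact_mod_cast h
      omega
    conv => whnf
    refine ⟨fun h => ?_, fun h => ?_⟩
    · replace h : (Hl.h : ℝ) + ((1 : ℤ) : ℝ) < Hr.h := h
      have hlt : Hl.h + 1 < Hr.h := by exact_mod_cast h
      omega
    conv => whnf
    refine (tree_mk hl' hr' hlink (by omega) (by omega)).mono ?_
    rintro w1 s3 ⟨H1, hw1, k7, hs3⟩
    exact ⟨H1, hw1, by omega, by omega, by omega⟩
  | succ n ih =>
    have hl' := hl
    have hr' := hr
    obtain ⟨l, rfl, hl⟩ := hl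
    obtain ⟨r, rfl, hr⟩ := hr
    refine Calls.of_sem joinBody rfl ?_
    conv => whnf
    refine ⟨fun h => ?_, fun h0 => ?_⟩
    · replace h : (Hr.h : ℝ) + ((1 : ℤ) : ℝ) < Hl.h := h
      have hlt : Hr.h + 1 < Hl.h := by exact_mod_cast h
      conv => whnf
      refine (hl'.push (by omega)).mono ?_
      rintro _ s1 ⟨ll, lr, Hll, Hlr, Bs1, Bs2, rfl, hll, hlr, rfl, k1, k2, k3, hs1⟩
      rw [List.append_assoc] at hlink ⊢
      conv => whnf
      refine (ih hlr hr' hlink.right (by omega) (by omega)).mono ?_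
      rintro w1 s2 ⟨H1, hw1, k4, k5, hs2⟩
      refine (tree_bal hll hw1 hlink (by omega) (by omega)).mono ?_
      rintro w2 s3 ⟨H2, hw2, k6, k7, k8, hs3⟩
      exact ⟨H2, hw2, by omega, by omega, by omega⟩
    replace h0 : ¬ (Hr.h : ℝ) + ((1 : ℤ) : ℝ) < Hl.h := h0
    have hlt0 : ¬ Hr.h + 1 < Hl.h := by exact_mod_cast h0
    conv => whnf
    refine ⟨fun h => ?_, fun h => ?_⟩
    · replace h : (Hl.h : ℝ) + ((1 : ℤ) : ℝ) < Hr.h := h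
      have hlt : Hl.h + 1 < Hr.h := by exact_mod_cast h
      omega
    conv => whnf
    refine (tree_mk hl' hr' hlink (by omega) (by omega)).mono ?_
    rintro w1 s3 ⟨H1, hw1, k7, hs3⟩
    exact ⟨H1, hw1, by omega, by omega, by omega⟩

theorem flipTag_enc : Val.cell (.num ((-1 : ℤ) : ℝ))
    (.cell (.num ((0 : ℤ) : ℝ)) (.num ((0 : ℤ) : ℝ))) = Tag.flip.enc := by
  simp [Tag.flip, Tag.enc]

theorem Tree.app {v : Val} {H : Hdr} {As : List Arc} (h : Tree v H As) (t : Tag) :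
    Calls program fApp (.cell v t.enc) fun w s =>
      Tree w (H.app t) (appL t As) ∧ s ≤ 500 := by
  obtain ⟨b, rfl, h⟩ := h
  exact (h.app t).mono fun _ _ h => ⟨h.1, h.2.1⟩

theorem Tree.flip {v : Val} {H : Hdr} {As : List Arc} (h : Tree v H As) :
    Calls program fApp (.cell v (.cell (.num ((-1 : ℤ) : ℝ))
      (.cell (.num ((0 : ℤ) : ℝ)) (.num ((0 : ℤ) : ℝ))))) fun w s =>
      Tree w (H.app Tag.flip) (appL Tag.flip As) ∧ s ≤ 500 := by
  rw [flipTag_enc]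
  exact h.app _

/-- If the right tree is the higher one, reflecting both trees exchanges their roles, and reflecting
the result restores the order. A lazy reflection takes constant time. -/
theorem tree_join {l r : Val} {Hl Hr : Hdr} {Bs Cs : List Arc} (hl : Tree l Hl Bs)
    (hr : Tree r Hr Cs) (hlink : Linked (Bs ++ Cs)) :
    Calls program fJoin (.cell l r) fun w s => ∃ H, Tree w H (Bs ++ Cs) ∧
      s ≤ 8000 * (max Hl.h Hr.h + 2) := by
  by_cases hle : Hr.h ≤ Hl.h + 1
  · refine (tree_join_aux Hl.h hl hr hlink hle le_rfl).mono ?_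
    rintro w s ⟨H, hw, -, -, hs⟩
    exact ⟨H, hw, hs.trans (Nat.mul_le_mul_left _ (by omega))⟩
  have hl' := hl
  have hr' := hr
  obtain ⟨l, rfl, hl⟩ := hl
  obtain ⟨r, rfl, hr⟩ := hr
  refine Calls.of_sem joinBody rfl ?_
  conv => whnf
  refine ⟨fun h => ?_, fun h => ?_⟩
  · replace h : (Hr.h : ℝ) + ((1 : ℤ) : ℝ) < Hl.h := h
    have hlt : Hr.h + 1 < Hl.h := by exact_mod_cast h
    omega
  conv => whnf
  refine ⟨fun h => ?_, fun h => ?_⟩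
  · conv => whnf
    refine hr'.flip.mono ?_
    rintro w1 s1 ⟨hw1, hs1⟩
    conv => whnf
    refine hl'.flip.mono ?_
    rintro w2 s2 ⟨hw2, hs2⟩
    have e : appL Tag.flip (Bs ++ Cs) = appL Tag.flip Cs ++ appL Tag.flip Bs := by
      rw [appL_append]; simp [Tag.flip]
    conv => whnf
    refine (tree_join_aux Hr.h hw1 hw2 (e ▸ hlink.app _) (by simp; omega) (by simp)).mono ?_
    rintro w3 s3 ⟨H3, hw3, -, -, hs3⟩
    conv => whnf
    refine hw3.flip.mono ?_
    rintro w4 s4 ⟨hw4, hs4⟩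
    rw [← e, appL_flip_flip] at hw4
    exact ⟨_, hw4, by omega⟩
  · replace h : ¬ (Hl.h : ℝ) + ((1 : ℤ) : ℝ) < Hr.h := h
    have hlt : ¬ Hl.h + 1 < Hr.h := by exact_mod_cast h
    omega

/-! ### Heights and possibly empty trees -/

/-- A bound for the heights of trees with at most `N` leaves. -/
def ht (N : ℕ) : ℕ := 2 * Nat.log 2 N + 3

/-- The child with fewer leaves is at least as high as the lower child, whose height is at least
`H.h - 2`. Two more levels cost a factor 4 on the left, and the square of doubling the smaller leaf
count on the right. -/
theorem Rep.two_pow_height {H : Hdr} {v : Val} {As : List Arc} (h : Rep H v As) :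
    2 ^ H.h ≤ As.length ^ 2 := by
  induction h with
  | seg => simp [Arc.hdr]
  | arc => simp [Arc.hdr]
  | @node H t' Hl l Hr r As Bs Cs hl hr h1 h2 h3 h4 h5 ih1 ih2 =>
    have e : As.length = Bs.length + Cs.length := by rw [h5]; simp
    set m := min Bs.length Cs.length with hm
    have h6 : 2 ^ (min Hl.h Hr.h) ≤ m ^ 2 := by
      rw [hm]
      rcases le_total Bs.length Cs.length with h | h
      · rw [min_eq_left h]; exact (Nat.pow_le_pow_right (by norm_num) (min_le_left _ _)).trans ih1
      · rw [min_eq_right h]; exact (Nat.pow_le_pow_right (by norm_num) (min_le_right _ _)).trans ih2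
    have h7 : 2 * m ≤ As.length := by omega
    calc 2 ^ H.h ≤ 2 ^ (min Hl.h Hr.h + 2) := Nat.pow_le_pow_right (by norm_num) (by omega)
      _ = 4 * 2 ^ (min Hl.h Hr.h) := by ring
      _ ≤ 4 * m ^ 2 := by omega
      _ = (2 * m) ^ 2 := by ring
      _ ≤ As.length ^ 2 := Nat.pow_le_pow_left h7 2

/-- The slack of two absorbs the additive constants in the costs of joins and splits. -/
theorem Tree.height {v : Val} {H : Hdr} {As : List Arc} {N : ℕ} (h : Tree v H As)
    (hN : As.length ≤ N) : H.h + 2 ≤ ht N := by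
  have hne := h.hdr_for.ne
  obtain ⟨b, rfl, h⟩ := h
  have h1 := h.two_pow_height
  have h2 : As.length < 2 ^ (Nat.log 2 N + 1) :=
    hN.trans_lt (Nat.lt_pow_succ_log_self (by norm_num) N)
  have h3 : 2 ^ H.h < 2 ^ (2 * (Nat.log 2 N + 1)) := by
    calc 2 ^ H.h ≤ As.length ^ 2 := h1
      _ < (2 ^ (Nat.log 2 N + 1)) ^ 2 := Nat.pow_lt_pow_left h2 (by norm_num)
      _ = _ := by rw [← pow_mul, mul_comm]
  have := (Nat.pow_lt_pow_iff_right (by norm_num)).mp h3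
  unfold ht
  omega

/-- A tree for a list of arcs that may be empty. -/
def OTree (v : Val) (As : List Arc) : Prop := (v = .num 0 ∧ As = []) ∨ ∃ H, Tree v H As

theorem Tree.o {v : Val} {H : Hdr} {As : List Arc} (h : Tree v H As) : OTree v As := .inr ⟨H, h⟩

theorem OTree.nil : OTree (.num 0) [] := .inl ⟨rfl, rfl⟩

theorem OTree.nil' : OTree (.num ((0 : ℤ) : ℝ)) [] := .inl ⟨by simp, rfl⟩

theorem OTree.tree {v : Val} {As : List Arc} (h : OTree v As) (hne : As ≠ []) :
    ∃ H, Tree v H As := by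
  rcases h with ⟨-, h⟩ | h
  · exact absurd h hne
  · exact h

theorem OTree.join {l r : Val} {Bs Cs : List Arc} {N : ℕ} (hl : OTree l Bs)
    (hr : OTree r Cs) (hlink : Linked (Bs ++ Cs)) (hN : (Bs ++ Cs).length ≤ N) :
    Calls program fJoin (.cell l r) fun w s => OTree w (Bs ++ Cs) ∧ s ≤ 8000 * ht N := by
  have h3 : 3 ≤ ht N := by unfold ht; omega
  rw [List.length_append] at hN
  rcases hl with ⟨rfl, rfl⟩ | ⟨Hl, hl⟩
  · refine Calls.of_sem joinBody rfl ?_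
    conv => whnf
    exact ⟨hr, by omega⟩
  rcases hr with ⟨rfl, rfl⟩ | ⟨Hr, hr⟩
  · have hl' := hl
    obtain ⟨b, rfl, hl⟩ := hl'
    refine Calls.of_sem joinBody rfl ?_
    conv => whnf
    rw [List.append_nil]
    exact ⟨.inr ⟨_, hl⟩, by omega⟩
  · refine (tree_join hl hr hlink).mono ?_
    rintro w s ⟨H, hw, hs⟩
    refine ⟨.inr ⟨_, hw⟩, hs.trans (Nat.mul_le_mul_left _ ?_)⟩
    have := hl.height (N := N) (by omega)
    have := hr.height (N := N) (by omega)
    omega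

/-! ### Splitting trees by a test on headers -/

/-- The test of `fSplit`. -/
def Passes (p q w r : ℝ) (H : Hdr) : Prop := p * H.xb + (q * H.yb + w * H.hi) ≤ r

theorem Hdr.For.xb_eq {H K : Hdr} {As Bs : List Arc} (h : H.For (As ++ Bs)) (k : K.For Bs) :
    H.xb = K.xb ∧ H.yb = K.yb := by
  obtain ⟨m, w, h1, h2⟩ := path_append.mp h.path
  obtain ⟨rfl, rfl⟩ := h2.start k.path k.ne
  exact h2.unique k.path

theorem Hdr.For.congr {H K : Hdr} {As : List Arc} (h : H.For As) (k : K.For As) :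
    H.xa = K.xa ∧ H.ya = K.ya ∧ H.xb = K.xb ∧ H.yb = K.yb ∧ H.hi = K.hi := by
  obtain ⟨h1, h2⟩ := h.path.start k.path h.ne
  obtain ⟨h3, h4⟩ := h.xb_eq (As := []) k
  refine ⟨h1, h2, h3, h4, le_antisymm ?_ ?_⟩
  · rw [h.hi, ← k.hi]
  · rw [k.hi, ← h.hi]

theorem Passes.congr {p q w r : ℝ} {H K : Hdr} {As : List Arc} (hp : Passes p q w r H)
    (h : H.For As) (k : K.For As) : Passes p q w r K := by
  obtain ⟨-, -, h1, h2, h3⟩ := h.congr k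
  unfold Passes at *
  rwa [← h1, ← h2, ← h3]

/-- Two kinds of tests survive concatenation: those that look only at the right end point, which is
that of the second list, and those that bound the largest chord slope, which is a maximum. -/
theorem Passes.append {p q w r : ℝ} (hc : w = 0 ∨ p = 0 ∧ q = 0) {H K J : Hdr} {As Bs : List Arc}
    (hp : Passes p q w r H) (kp : Passes p q w r K) (hw : 0 ≤ w)
    (h : H.For As) (k : K.For Bs) (j : J.For (As ++ Bs)) : Passes p q w r J := by
  obtain ⟨h1, h2⟩ := j.xb_eq k
  unfold Passes at *
  rcases hc with rfl | ⟨rfl, rfl⟩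
  · rw [h1, h2]; simpa using kp
  · have : J.hi ≤ max H.hi K.hi := by
      rw [j.hi]
      intro A hA
      rcases List.mem_append.mp hA with hA | hA
      · exact le_max_of_le_left ((h.hi _).mp le_rfl A hA)
      · exact le_max_of_le_right ((k.hi _).mp le_rfl A hA)
    have h3 := mul_le_mul_of_nonneg_left this hw
    rcases max_choice H.hi K.hi with h | h <;> rw [h] at h3 <;> linarith

theorem Rep.leaf {H : Hdr} {b : Val} {As : List Arc} (h : Rep H b As) (h0 : H.h = 0) :
    ∃ A, As = [A] ∧ H = A.hdr := by
  cases h with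
  | seg => exact ⟨_, rfl, rfl⟩
  | arc => exact ⟨_, rfl, rfl⟩
  | node => omega

/-- Each level costs one push and one join. The test need not be monotone along the list: it is only
claimed that the prefix passes as a whole and that the very next arc fails. -/
theorem Tree.split_aux (n : ℕ) {v : Val} {H : Hdr} {As : List Arc} {N : ℕ} (p q w r : ℝ)
    (hc : w = 0 ∨ p = 0 ∧ q = 0) (hw : 0 ≤ w) (h : Tree v H As) (hN : As.length ≤ N)
    (hn : H.h ≤ n) :
    Calls program fSplit (.cell v (.cell (.num p) (.cell (.num q) (.cell (.num w) (.num r)))))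
      fun x s => ∃ L R Ls Rs, x = .cell L R ∧ OTree L Ls ∧ OTree R Rs ∧ As = Ls ++ Rs ∧
        (∀ K : Hdr, K.For Ls → Passes p q w r K) ∧
        (∀ A Rs', Rs = A :: Rs' → ¬ Passes p q w r A.hdr) ∧ s ≤ 10000 * ht N * (n + 1) := by
  have h3 : 3 ≤ ht N := by unfold ht; omega
  have hF := h.hdr_for
  induction n generalizing v H As with
  | zero =>
    have hmul : 10000 * ht N * (0 + 1) = 10000 * ht N := by ring
    rw [hmul]
    have h' := h
    obtain ⟨b, rfl, h⟩ := h
    obtain ⟨A, rfl, e⟩ := h.leaf (by omega)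
    have e0 : H.h = 0 := by omega
    refine Calls.of_sem splitBody rfl ?_
    conv => whnf
    refine ⟨fun _ => ?_, fun h0 => absurd ?_ h0⟩
    · conv => whnf
      refine ⟨fun ht => ?_, fun ht => ?_⟩
      · conv => whnf
        refine ⟨_, _, _, _, rfl, .nil', h'.o, rfl, fun K hK => absurd rfl hK.ne, ?_, by omega⟩
        rintro A' Rs' h0
        obtain ⟨rfl, -⟩ := List.cons.inj h0
        rw [← e]
        exact not_le.mpr ht
      · conv => whnf
        refine ⟨_, _, _, _, rfl, h'.o, .nil', by simp, fun K hK => ?_, by simp, by omega⟩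
        exact Passes.congr (not_lt.mp ht) hF hK
    · show (H.h : ℝ) < ((1 : ℤ) : ℝ)
      simp [e0]
  | succ n ih =>
    by_cases e0 : H.h = 0
    · refine (ih h hN (by omega) hF).mono ?_
      rintro x s ⟨L, R, Ls, Rs, h1, h2, h3, h4, h5, h6, h7⟩
      exact ⟨L, R, Ls, Rs, h1, h2, h3, h4, h5, h6,
        h7.trans (Nat.mul_le_mul_left _ (by omega))⟩
    have hmul : 10000 * ht N * (n + 1 + 1) = 10000 * ht N * (n + 1) + 10000 * ht N := by ring
    rw [hmul]
    have h' := h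
    obtain ⟨b, rfl, h⟩ := h
    refine Calls.of_sem splitBody rfl ?_
    conv => whnf
    refine ⟨fun h0 => absurd ?_ e0, fun h0 => ?_⟩
    · replace h0 : (H.h : ℝ) < ((1 : ℤ) : ℝ) := h0
      norm_num at h0
      exact h0
    conv => whnf
    refine (h'.push e0).mono ?_
    rintro _ s1 ⟨l, r', Hl, Hr, Bs, Cs, rfl, hl, hr, rfl, k1, k2, k3, hs1⟩
    have hlF := hl.hdr_for
    have hrF := hr.hdr_for
    have hlink := hF.linked
    rw [List.length_append] at hN
    have hl' := hl
    obtain ⟨l, rfl, -⟩ := hl'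
    conv => whnf
    refine ⟨fun ht => ?_, fun ht => ?_⟩
    · conv => whnf
      refine (ih hl (by omega) (by omega) hlF).mono ?_
      rintro _ s2 ⟨L, R, Ls, Rs, rfl, j1, j2, rfl, j4, j5, hs2⟩
      rw [List.append_assoc] at hlink ⊢
      conv => whnf
      refine (j2.join hr.o hlink.right (N := N) (by simp at hN ⊢; omega)).mono ?_
      rintro R' s3 ⟨j6, hs3⟩
      refine ⟨_, _, _, _, rfl, j1, j6, rfl, j4, ?_, by omega⟩
      intro A Rs' hA
      -- If nothing of the left child remained, the left child would pass as a whole, against the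
      -- branch taken. So the arc after the cut belongs to the left child.
      cases Rs with
      | nil =>
        rw [List.append_nil] at hlF
        exact absurd (not_lt.mpr (j4 _ hlF)) (by simpa [Passes] using ht)
      | cons B Rs =>
        obtain ⟨rfl, -⟩ := List.cons.inj hA
        exact j5 B Rs rfl
    · conv => whnf
      refine (ih hr (by omega) (by omega) hrF).mono ?_
      rintro _ s2 ⟨L, R, Ls, Rs, rfl, j1, j2, rfl, j4, j5, hs2⟩
      rw [← List.append_assoc] at hlink ⊢
      conv => whnf
      refine (hl.o.join j1 hlink.left (N := N) (by simp at hN ⊢; omega)).mono ?_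
      rintro L' s3 ⟨j6, hs3⟩
      conv => whnf
      refine ⟨_, _, _, _, rfl, j6, j2, rfl, ?_, j5, by omega⟩
      intro K hK
      rcases j1 with ⟨-, rfl⟩ | ⟨HL, j1⟩
      · rw [List.append_nil] at hK
        exact Passes.congr (not_lt.mp ht) hlF hK
      · exact Passes.append hc (not_lt.mp ht) (j4 _ j1.hdr_for) hw hlF j1.hdr_for hK

theorem OTree.split {v : Val} {As : List Arc} {N : ℕ} (p q w r : ℝ)
    (hc : w = 0 ∨ p = 0 ∧ q = 0) (hw : 0 ≤ w) (h : OTree v As) (hN : As.length ≤ N) :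
    Calls program fSplit (.cell v (.cell (.num p) (.cell (.num q) (.cell (.num w) (.num r)))))
      fun x s => ∃ L R Ls Rs, x = .cell L R ∧ OTree L Ls ∧ OTree R Rs ∧ As = Ls ++ Rs ∧
        (∀ K : Hdr, K.For Ls → Passes p q w r K) ∧
        (∀ A Rs', Rs = A :: Rs' → ¬ Passes p q w r A.hdr) ∧ s ≤ 10000 * ht N ^ 2 := by
  have h3 : 3 ≤ ht N := by unfold ht; omega
  have h9 : 9 ≤ ht N ^ 2 := by nlinarith
  rcases h with ⟨rfl, rfl⟩ | ⟨H, h⟩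
  · refine Calls.of_sem splitBody rfl ?_
    conv => whnf
    exact ⟨_, _, _, _, rfl, .nil', .nil', rfl, fun K hK => absurd rfl hK.ne, by simp, by omega⟩
  · refine (h.split_aux H.h p q w r hc hw hN le_rfl).mono ?_
    rintro x s ⟨L, R, Ls, Rs, h1, h2, h3, h4, h5, h6, h7⟩
    refine ⟨L, R, Ls, Rs, h1, h2, h3, h4, h5, h6, h7.trans ?_⟩
    rw [pow_two, ← mul_assoc]
    have := h.height hN
    exact Nat.mul_le_mul_left _ (by omega)

theorem Tree.uncons_aux (n : ℕ) {v : Val} {H : Hdr} {As : List Arc} {N : ℕ} (h : Tree v H As)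
    (hN : As.length ≤ N) (hn : H.h ≤ n) :
    Calls program fUncons v fun x s => ∃ l r A Rs, x = .cell l r ∧ As = A :: Rs ∧
      Tree l A.hdr [A] ∧ OTree r Rs ∧ s ≤ 10000 * ht N * (n + 1) := by
  have h3 : 3 ≤ ht N := by unfold ht; omega
  induction n generalizing v H As with
  | zero =>
    have hmul : 10000 * ht N * (0 + 1) = 10000 * ht N := by ring
    rw [hmul]
    have h' := h
    obtain ⟨b, rfl, h⟩ := h
    have e0 : H.h = 0 := by omega
    obtain ⟨A, rfl, rfl⟩ := h.leaf e0
    refine Calls.of_sem unconsBody rfl ?_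
    conv => whnf
    refine ⟨fun _ => ?_, fun h0 => absurd ?_ h0⟩
    · conv => whnf
      exact ⟨_, _, _, _, rfl, rfl, h', .nil', by omega⟩
    · show (A.hdr.h : ℝ) < ((1 : ℤ) : ℝ)
      simp [e0]
  | succ n ih =>
    by_cases e0 : H.h = 0
    · refine (ih h hN (by omega)).mono ?_
      rintro x s ⟨l, r, A, Rs, h1, h2, h3, h4, h5⟩
      exact ⟨l, r, A, Rs, h1, h2, h3, h4, h5.trans (Nat.mul_le_mul_left _ (by omega))⟩
    have hmul : 10000 * ht N * (n + 1 + 1) = 10000 * ht N * (n + 1) + 10000 * ht N := by ring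
    rw [hmul]
    have hF := h.hdr_for
    have h' := h
    obtain ⟨b, rfl, h⟩ := h
    refine Calls.of_sem unconsBody rfl ?_
    conv => whnf
    refine ⟨fun h0 => absurd ?_ e0, fun h0 => ?_⟩
    · replace h0 : (H.h : ℝ) < ((1 : ℤ) : ℝ) := h0
      norm_num at h0
      exact h0
    conv => whnf
    refine (h'.push e0).mono ?_
    rintro _ s1 ⟨l, r', Hl, Hr, Bs, Cs, rfl, hl, hr, rfl, k1, k2, k3, hs1⟩
    have hlink := hF.linked
    rw [List.length_append] at hN
    conv => whnf
    refine (ih hl (by omega) (by omega)).mono ?_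
    rintro _ s2 ⟨l', r'', A, Rs, rfl, rfl, j1, j2, hs2⟩
    have e : A :: Rs ++ Cs = [A] ++ (Rs ++ Cs) := by simp
    conv => whnf
    refine (j2.join hr.o (e ▸ hlink).right (N := N) (by simp at hN ⊢; omega)).mono ?_
    rintro R' s3 ⟨j6, hs3⟩
    exact ⟨_, _, _, _, rfl, rfl, j1, j6, by omega⟩

theorem OTree.uncons {v : Val} {A : Arc} {Rs : List Arc} {N : ℕ} (h : OTree v (A :: Rs))
    (hN : (A :: Rs).length ≤ N) :
    Calls program fUncons v fun x s => ∃ l r, x = .cell l r ∧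
      Tree l A.hdr [A] ∧ OTree r Rs ∧ s ≤ 10000 * ht N ^ 2 := by
  obtain ⟨H, h⟩ := h.tree (by simp)
  refine (h.uncons_aux H.h hN le_rfl).mono ?_
  rintro x s ⟨l, r, A', Rs', h1, h2, h3, h4, h5⟩
  obtain ⟨rfl, rfl⟩ := List.cons.inj h2
  refine ⟨l, r, h1, h3, h4, h5.trans ?_⟩
  rw [pow_two, ← mul_assoc]
  have := h.height hN
  exact Nat.mul_le_mul_left _ (by omega)

theorem OTree.app {v : Val} {As : List Arc} (h : OTree v As) (t : Tag) :
    Calls program fApp (.cell v t.enc) fun w s => OTree w (appL t As) ∧ s ≤ 500 := by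
  rcases h with ⟨rfl, rfl⟩ | ⟨H, h⟩
  · refine Calls.of_sem appBody rfl ?_
    conv => whnf
    exact ⟨by simpa using OTree.nil, by omega⟩
  · exact (h.app t).mono fun w s h => ⟨h.1.o, h.2⟩

/-! ## Segments and chains -/

/-- The segment from `(p, y)` to `(q, z)`. -/
noncomputable def segArc (p y q z : ℝ) (h : p < q) : Arc where
  a := p
  b := q
  lam := (z - y) / (q - p)
  rho := (z - y) / (q - p)
  F x := y + (z - y) / (q - p) * (x - p)
  len := 0
  lt := h
  conc := Conc.line _ _ _ _ _
  lin := by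
    intro _ x _ _
    have : q - p ≠ 0 := by linarith
    field_simp; ring

theorem segArc_a (p y q z : ℝ) (h : p < q) : (segArc p y q z h).F p = y := by simp [segArc]

theorem segArc_b (p y q z : ℝ) (h : p < q) : (segArc p y q z h).F q = z := by
  have : q - p ≠ 0 := by linarith
  simp only [segArc]; field_simp; ring

theorem segArc_eq {p y q z : ℝ} (h : p < q) {u v w : ℝ} (hy : y = u + v * (p - w))
    (hz : z = u + v * (q - w)) (x : ℝ) : (segArc p y q z h).F x = u + v * (x - w) := by
  have : q - p ≠ 0 := by linarith
  simp only [segArc, hy, hz]; field_simp; ring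

theorem segArc_chord (p y q z : ℝ) (h : p < q) : (segArc p y q z h).chord = (z - y) / (q - p) := by
  have h1 := segArc_a p y q z h
  have h2 := segArc_b p y q z h
  unfold Arc.chord
  change ((segArc p y q z h).F q - (segArc p y q z h).F p) / (q - p) = _
  rw [h1, h2]

theorem segArc_tight (p y q z : ℝ) (h : p < q) : (segArc p y q z h).Tight := by
  unfold Arc.Tight
  rw [segArc_chord]
  exact ⟨le_rfl, le_rfl⟩

theorem segArc_G (p y q z : ℝ) (h : p < q) (x : ℝ) :
    (segArc p y q z h).G x = (segArc p y q z h).F x := by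
  unfold Arc.G
  have h1 : (segArc p y q z h).F x = z + (z - y) / (q - p) * (x - q) := by
    have : q - p ≠ 0 := by linarith
    simp only [segArc]; field_simp; ring
  have h2 : (segArc p y q z h).F x = y + (z - y) / (q - p) * (x - p) := rfl
  apply min_eq_left
  apply le_min
  · change _ ≤ (segArc p y q z h).F p + (z - y) / (q - p) * (x - p)
    rw [segArc_a, h2]
  · change _ ≤ (segArc p y q z h).F q + (z - y) / (q - p) * (x - q)
    rw [segArc_b, h1]

theorem seg_spec (p y q z : ℝ) (h : p < q) :
    Calls program fSeg (.cell (.cell (.num p) (.num y)) (.cell (.num q) (.num z)))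
      fun w s => Tree w (segArc p y q z h).hdr [segArc p y q z h] ∧ s ≤ 100 := by
  refine Calls.of_sem segBody rfl ?_
  conv => whnf
  refine ⟨by linarith, ?_⟩
  conv => whnf
  refine ⟨⟨_, ?_, .seg Tag.one rfl⟩, by omega⟩
  rw [Arc.hdr, segArc_chord]
  change _ = Val.cell (Val.cell (Val.cell (.cell (.num p) (.num ((segArc p y q z h).F p)))
    (.cell (.num q) (.num ((segArc p y q z h).F q)))) _) _
  rw [segArc_a, segArc_b]
  simp [segArc, Tag.enc, Tag.one]

/-- The segments `Ss` make up the graph of `F` on `[a, b]`. -/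
def Chain (F : ℝ → ℝ) : ℝ → List Arc → ℝ → Prop
  | a, [], b => a = b
  | a, S :: Ss, b => S.a = a ∧ S.len = 0 ∧ (∀ x, S.a ≤ x → x ≤ S.b → S.F x = F x) ∧
      Chain F S.b Ss b

theorem Chain.le {F : ℝ → ℝ} {a b : ℝ} {Ss : List Arc} (h : Chain F a Ss b) : a ≤ b := by
  induction Ss generalizing a with
  | nil => exact le_of_eq h
  | cons S Ss ih =>
    obtain ⟨rfl, -, -, h⟩ := h
    exact S.lt.le.trans (ih h)

theorem Chain.path {F : ℝ → ℝ} {a b : ℝ} {Ss : List Arc} (h : Chain F a Ss b) :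
    Path a (F a) Ss b (F b) := by
  induction Ss generalizing a with
  | nil => exact ⟨h, congrArg F h⟩
  | cons S Ss ih =>
    obtain ⟨rfl, -, h1, h⟩ := h
    refine ⟨⟨rfl, (h1 _ le_rfl S.lt.le).symm⟩, ?_⟩
    rw [h1 _ S.lt.le le_rfl]
    exact ih h

theorem Chain.linked {F : ℝ → ℝ} {a b : ℝ} {Ss : List Arc} (h : Chain F a Ss b) : Linked Ss :=
  ⟨_, _, _, _, h.path⟩

theorem Chain.flat {F : ℝ → ℝ} {a b : ℝ} {Ss : List Arc} (h : Chain F a Ss b) :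
    ∀ S ∈ Ss, S.len = 0 := by
  induction Ss generalizing a with
  | nil => simp
  | cons S Ss ih =>
    obtain ⟨-, h1, -, h⟩ := h
    simpa [h1] using ih h

theorem Chain.agree {F : ℝ → ℝ} {a b : ℝ} {Ss : List Arc} (h : Chain F a Ss b) :
    ∀ S ∈ Ss, ∀ x, S.a ≤ x → x ≤ S.b → S.F x = F x := by
  induction Ss generalizing a with
  | nil => simp
  | cons S Ss ih =>
    obtain ⟨-, -, h1, h⟩ := h
    simpa using ⟨h1, ih h⟩

theorem Chain.of_path {F : ℝ → ℝ} {a y b z : ℝ} {Ss : List Arc} (hp : Path a y Ss b z)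
    (h0 : ∀ S ∈ Ss, S.len = 0) (h : ∀ S ∈ Ss, ∀ x, S.a ≤ x → x ≤ S.b → S.F x = F x) :
    Chain F a Ss b := by
  induction Ss generalizing a y with
  | nil => exact hp.1
  | cons S Ss ih =>
    simp only [List.mem_cons, forall_eq_or_imp] at h0 h
    exact ⟨hp.1.1.symm, h0.1, h.1, ih hp.2 h0.2 h.2⟩

theorem Chain.congr {F G : ℝ → ℝ} {a b : ℝ} {Ss : List Arc} (h : Chain F a Ss b)
    (hG : ∀ x, a ≤ x → x ≤ b → G x = F x) : Chain G a Ss b := by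
  induction Ss generalizing a with
  | nil => exact h
  | cons S Ss ih =>
    obtain ⟨rfl, h0, h1, h⟩ := h
    have h2 := h.le
    have h3 := S.lt
    refine ⟨rfl, h0, fun x hx hx' => ?_, ih h fun x hx hx' => hG x (by linarith) hx'⟩
    rw [h1 x hx hx', hG x hx (by linarith)]

theorem chain_append {F : ℝ → ℝ} {a b : ℝ} {Ss Ts : List Arc} :
    Chain F a (Ss ++ Ts) b ↔ ∃ m, Chain F a Ss m ∧ Chain F m Ts b := by
  induction Ss generalizing a with
  | nil => simp [Chain]
  | cons S Ss ih =>
    simp only [List.cons_append, Chain, ih]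
    constructor
    · rintro ⟨h1, h2, h3, m, h4, h5⟩; exact ⟨m, ⟨h1, h2, h3, h4⟩, h5⟩
    · rintro ⟨m, ⟨h1, h2, h3, h4⟩, h5⟩; exact ⟨h1, h2, h3, m, h4, h5⟩

theorem Chain.ne_nil {F : ℝ → ℝ} {a b : ℝ} {Ss : List Arc} (h : Chain F a Ss b) (hab : a < b) :
    Ss ≠ [] := by
  rintro rfl
  exact hab.ne h

theorem Chain.flip {F : ℝ → ℝ} {a b : ℝ} {Ss : List Arc} (h : Chain F a Ss b) :
    Chain (fun x => F (-x)) (-b) (appL Tag.flip Ss) (-a) := by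
  have hp := h.path.app Tag.flip
  rw [if_pos (by rfl)] at hp
  refine Chain.of_path hp ?_ ?_
  · intro S hS
    obtain ⟨B, hB, rfl⟩ := mem_appL.mp hS
    exact h.flat B hB
  · intro S hS x h1 h2
    obtain ⟨B, hB, rfl⟩ := mem_appL.mp hS
    simp only [Arc.app, Tag.flip, if_true] at h1 h2 ⊢
    simp only [Tag.sg_true, neg_mul, one_mul, zero_mul, add_zero]
    exact h.agree B hB _ (by linarith) (by linarith)

/-- The arc with the graph `F` given by a chain. -/
def chainArc (F : ℝ → ℝ) (a b lam rho : ℝ) (n : ℕ) (h : a < b) (hF : Conc a b F) : Arc where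
  a := a
  b := b
  lam := lam
  rho := rho
  F := F
  len := n + 1
  lt := h
  conc := hF
  lin := by simp

/-- A chain over a nondegenerate interval is nonempty, and `chainArc` adds one to its length
argument so as to be visibly nonlinear; hence `Ss.length - 1`. -/
theorem arc_spec {F : ℝ → ℝ} {a b : ℝ} (lam rho : ℝ) {Ss : List Arc} {v : Val} (h : a < b)
    (hF : Conc a b F) (hv : OTree v Ss) (hc : Chain F a Ss b) :
    Calls program fArc (.cell v (.cell (.num lam) (.num rho))) fun w s =>
      Tree w (chainArc F a b lam rho (Ss.length - 1) h hF).hdr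
        [chainArc F a b lam rho (Ss.length - 1) h hF] ∧ s ≤ 100 := by
  have hne := hc.ne_nil h
  obtain ⟨H, hv⟩ := hv.tree hne
  have hp := hv.hdr_for.path
  obtain ⟨e1, e2⟩ := hp.start hc.path hne
  obtain ⟨e3, e4⟩ := hp.unique (e1 ▸ e2 ▸ hc.path)
  obtain ⟨c, rfl, hv'⟩ := hv
  refine Calls.of_sem arcBody rfl ?_
  conv => whnf
  rw [e1, e2, e3, e4]
  refine ⟨by linarith, ?_⟩
  conv => whnf
  have hpos := List.length_pos_of_ne_nil hne
  refine ⟨⟨_, ?_, .arc Tag.one hv' hc.flat hc.path ?_ hc.agree⟩, by omega⟩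
  · rw [e1, e2, e3, e4]
    simp [Arc.hdr, Hdr.enc, Tag.enc, Tag.one, chainArc, Arc.chord]
  · simp only [chainArc]; omega

/-! ## Clipping -/

theorem Conc.ge_line {a b : ℝ} {F : ℝ → ℝ} (hF : Conc a b F) {x0 y0 α : ℝ}
    (ha : y0 + α * (a - x0) ≤ F a) (hb : y0 + α * (b - x0) ≤ F b) (hab : a < b) {x : ℝ}
    (h1 : a ≤ x) (h2 : x ≤ b) : y0 + α * (x - x0) ≤ F x := by
  have h := hF a x b le_rfl h1 h2 le_rfl
  have e1 := mul_le_mul_of_nonneg_right ha (sub_nonneg.mpr h2)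
  have e2 := mul_le_mul_of_nonneg_right hb (sub_nonneg.mpr h1)
  have : (y0 + α * (x - x0)) * (b - a) ≤ F x * (b - a) := by linarith
  exact le_of_mul_le_mul_right this (by linarith)

/-- A concave function that meets a line at `m` and is not above it at a later point `c` cannot
return above it. -/
theorem Conc.le_line {a b : ℝ} {F : ℝ → ℝ} (hF : Conc a b F) {x0 y0 α m c : ℝ} (ham : a ≤ m)
    (hm : F m = y0 + α * (m - x0)) (hc : F c ≤ y0 + α * (c - x0)) (hmc : m < c) {x : ℝ}
    (h1 : c ≤ x) (h2 : x ≤ b) : F x ≤ y0 + α * (x - x0) := by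
  have h := hF m c x ham hmc.le h1 h2
  rw [hm] at h
  have e1 := mul_le_mul_of_nonneg_right hc (show 0 ≤ x - m by linarith)
  have : F x * (c - m) ≤ (y0 + α * (x - x0)) * (c - m) := by linarith
  exact le_of_mul_le_mul_right this (by linarith)

/-- The minimum of `F` and a line, continued by the line to the left of `a`. -/
noncomputable def clipped (F : ℝ → ℝ) (a x0 y0 α : ℝ) (x : ℝ) : ℝ :=
  if x < a then y0 + α * (x - x0) else min (F x) (y0 + α * (x - x0))

theorem clipped_of_le {F : ℝ → ℝ} {a x0 y0 α x : ℝ}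
    (h : a ≤ x → y0 + α * (x - x0) ≤ F x) : clipped F a x0 y0 α x = y0 + α * (x - x0) := by
  unfold clipped
  split_ifs with h1
  · rfl
  · exact min_eq_right (h (not_lt.mp h1))

theorem clipped_of_ge {F : ℝ → ℝ} {a x0 y0 α x : ℝ} (ha : a ≤ x)
    (h : F x ≤ y0 + α * (x - x0)) : clipped F a x0 y0 α x = F x := by
  unfold clipped
  rw [if_neg (not_lt.mpr ha), min_eq_left h]

theorem clipped_le {F : ℝ → ℝ} {a x0 y0 α x : ℝ} :
    clipped F a x0 y0 α x ≤ y0 + α * (x - x0) := by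
  unfold clipped
  split_ifs with h1
  · rfl
  · exact min_le_right _ _

/-- Clipping by a line that starts below the graph keeps it concave. -/
theorem clipped_conc {F : ℝ → ℝ} {a b x0 y0 α : ℝ} (hF : Conc a b F)
    (ha : y0 + α * (a - x0) ≤ F a) : Conc x0 b (clipped F a x0 y0 α) := by
  intro x y z h1 h2 h3 h4
  have hl : ∀ t, clipped F a x0 y0 α t ≤ y0 + α * (t - x0) := fun t => clipped_le
  have e1 := mul_le_mul_of_nonneg_right (hl x) (sub_nonneg.mpr h3)
  have e2 := mul_le_mul_of_nonneg_right (hl z) (sub_nonneg.mpr h2)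
  by_cases hy : y ≤ a
  · rw [show clipped F a x0 y0 α y = y0 + α * (y - x0) from clipped_of_le fun h => by
      rw [le_antisymm hy h]; exact ha]
    linarith
  push Not at hy
  have hm : Conc a b fun x => min (F x) (y0 + α * (x - x0)) := hF.min (Conc.line _ _ _ _ _)
  have hge : ∀ t, a ≤ t → clipped F a x0 y0 α t = min (F t) (y0 + α * (t - x0)) := by
    intro t ht
    unfold clipped
    rw [if_neg (not_lt.mpr ht)]
  by_cases hx : a ≤ x
  · have := hm x y z hx h2 h3 h4
    simp only at this
    rw [hge x hx, hge y hy.le, hge z (by linarith)]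
    exact this
  push Not at hx
  have := hm a y z le_rfl hy.le h3 h4
  simp only [← hge y hy.le, ← hge z (by linarith)] at this
  rw [min_eq_right ha] at this
  rw [show clipped F a x0 y0 α x = y0 + α * (x - x0) from
    clipped_of_le fun h => absurd hx (not_lt.mpr h)]
  set Y := clipped F a x0 y0 α y
  set Z := clipped F a x0 y0 α z
  have hZ : Z ≤ y0 + α * (z - x0) := hl z
  have hz : 0 < z - a := by linarith
  -- The deficit below the line is nonnegative at `z` and, on `[a, z]`, lies under the chord
  -- starting from zero at `a`. Moving the zero back to `x < a` only weakens the bound.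
  have key : (y0 + α * (y - x0) - Y) * (z - a) ≤ (y0 + α * (z - x0) - Z) * (y - a) := by linarith
  have h5 : (y - a) * (z - x) ≤ (y - x) * (z - a) := by nlinarith
  have h6 := mul_le_mul_of_nonneg_left h5 (sub_nonneg.mpr hZ)
  have h7 := mul_le_mul_of_nonneg_right key (show 0 ≤ z - x by linarith)
  have h8 : (y0 + α * (y - x0) - Y) * (z - x) * (z - a) ≤
      (y0 + α * (z - x0) - Z) * (y - x) * (z - a) := by linarith
  have h9 := le_of_mul_le_mul_right h8 hz
  linarith

theorem Arc.chord_lin {A : Arc} (h : A.len = 0) {x : ℝ} (h1 : A.a ≤ x) (h2 : x ≤ A.b) :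
    A.F x = A.F A.b + A.chord * (x - A.b) := by
  have h3 := A.chord_mul
  rw [A.lin h x h1 h2]
  change A.F A.a + A.chord * (x - A.a) = _
  linarith

/-- `W` is the segment on which the graph crosses the line downwards. By concavity the graph is
above the line before the crossing and below it afterwards, so the line, the rest of `W` and `Ks`
make up the minimum. -/
theorem trim_spec {F : ℝ → ℝ} {a b : ℝ} {W : Arc} {Ks : List Arc} {w k : Val} {N : ℕ}
    {x0 y0 α : ℝ} (hF : Conc a b F) (hx : x0 ≤ a) (hla : y0 + α * (a - x0) ≤ F a)
    (hw : Tree w W.hdr [W]) (hk : OTree k Ks) (haw : a ≤ W.a) (hc : Chain F W.a (W :: Ks) b)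
    (hWa : y0 + α * (W.a - x0) ≤ F W.a) (hWb : F W.b < y0 + α * (W.b - x0))
    (hN : Ks.length + 2 ≤ N) :
    Calls program fTrim (.cell (.cell w k) (.cell (.cell (.num x0) (.num y0)) (.num α)))
      fun v s => ∃ Ss, OTree v Ss ∧ Chain (clipped F a x0 y0 α) x0 Ss b ∧
        Ss.length ≤ Ks.length + 2 ∧ s ≤ 17000 * ht N := by
  have h3 : 3 ≤ ht N := by unfold ht; omega
  obtain ⟨-, hlen, hag, hcK⟩ := hc
  have hab := W.lt
  have hKb := hcK.le
  have eWa : W.F W.a = F W.a := hag _ le_rfl hab.le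
  have eWb : W.F W.b = F W.b := hag _ hab.le le_rfl
  have hch := W.chord_mul
  rw [eWa, eWb] at hch
  have hlt : W.chord < α := by
    by_contra hge
    push Not at hge
    nlinarith
  have hne : W.chord - α ≠ 0 := by linarith
  -- The abscissa of the intersection of the line with the line that carries `W`; the slopes differ
  -- because `W` falls below the line.
  set m := (y0 - α * x0 - W.F W.b + W.chord * W.b) / (W.chord - α) with hm
  have hm' : m * (W.chord - α) = y0 - α * x0 - W.F W.b + W.chord * W.b := by
    rw [hm]; field_simp
  rw [eWb] at hm'
  have hWm : W.a ≤ m := by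
    by_contra h
    push Not at h
    nlinarith
  have hmb : m < W.b := by
    by_contra h
    push Not at h
    nlinarith
  have eFm : F m = y0 + α * (m - x0) := by
    rw [← hag m hWm hmb.le, Arc.chord_lin hlen hWm hmb.le, eWb]
    linarith
  have hWline : ∀ x, W.a ≤ x → x ≤ W.b → F x = F W.b + W.chord * (x - W.b) := by
    intro x h1 h2
    rw [← hag x h1 h2, Arc.chord_lin hlen h1 h2, eWb]
  have hbelow : ∀ x, a ≤ x → x ≤ m → y0 + α * (x - x0) ≤ F x := by
    intro x h1 h2
    rcases eq_or_lt_of_le (haw.trans hWm) with h | h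
    · have : x = m := le_antisymm h2 (h ▸ h1)
      rw [this, eFm]
    · exact (hF.mono le_rfl (by linarith)).ge_line hla eFm.ge h h1 h2
  have habove : ∀ x, m ≤ x → x ≤ b → F x ≤ y0 + α * (x - x0) := by
    intro x h1 h2
    rcases le_total x W.b with h | h
    · rw [hWline x (by linarith) h]
      nlinarith
    · exact hF.le_line (by linarith) eFm hWb.le hmb h h2
  let R := segArc m (y0 + α * (m - x0)) W.b (W.F W.b) hmb
  have hR : ∀ x, m ≤ x → x ≤ W.b → R.F x = clipped F a x0 y0 α x := by
    intro x h1 h2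
    rw [clipped_of_ge (by linarith) (habove x h1 (by linarith)), hWline x (by linarith) h2]
    apply segArc_eq
    · rw [← eFm, hWline m hWm hmb.le]
    · rw [eWb]; ring
  have hcR : Chain (clipped F a x0 y0 α) m ([R] ++ Ks) b := by
    refine ⟨rfl, rfl, hR, hcK.congr fun x h1 h2 => ?_⟩
    have h1' : W.b ≤ x := h1
    exact clipped_of_ge (by linarith) (habove x (by linarith) h2)
  obtain ⟨w, rfl, hw⟩ := hw
  refine Calls.of_sem trimBody rfl ?_
  conv => whnf
  refine ⟨hne, ?_⟩
  conv => whnf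
  refine (seg_spec m (y0 + α * (m - x0)) W.b (W.F W.b) hmb).mono ?_
  rintro r s1 ⟨hr, hs1⟩
  conv => whnf
  refine (hr.o.join hk hcR.linked (N := N) (by simp; omega)).mono ?_
  rintro r' s2 ⟨hr', hs2⟩
  conv => whnf
  refine ⟨fun h => ?_, fun h => ?_⟩
  · replace h : x0 < m := h
    have hcL : Chain (clipped F a x0 y0 α) x0
        ([segArc x0 y0 m (y0 + α * (m - x0)) h] ++ ([R] ++ Ks)) b := by
      refine ⟨rfl, rfl, fun x h1 h2 => ?_, hcR⟩
      rw [clipped_of_le fun h3 => hbelow x h3 h2]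
      exact segArc_eq h (by ring) rfl x
    conv => whnf
    refine (seg_spec x0 y0 m (y0 + α * (m - x0)) h).mono ?_
    rintro l s3 ⟨hl, hs3⟩
    conv => whnf
    refine (hl.o.join hr' hcL.linked (N := N) (by simp; omega)).mono ?_
    rintro l' s4 ⟨hl', hs4⟩
    exact ⟨_, hl', hcL, by simp, by omega⟩
  · replace h : ¬ x0 < m := h
    -- The piece of the line is empty here and must be omitted, since segments have positive length.
    have : x0 = m := by linarith
    conv => whnf
    have hcR' : ∀ z, z = m → Chain (clipped F a x0 y0 α) z ([R] ++ Ks) b := by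
      rintro _ rfl; exact hcR
    exact ⟨_, hr', hcR' x0 this, by simp, by omega⟩

/-- Knowing that the prefix ends on or above the line and that the next segment ends below it is
enough: the graph is concave and starts on or above the line, so there is just one downward
crossing. -/
theorem clip_spec {F : ℝ → ℝ} {a b : ℝ} {Ss : List Arc} {v : Val} {N : ℕ}
    {x0 y0 α : ℝ} (hab : a < b) (hF : Conc a b F) (hx : x0 ≤ a) (hla : y0 + α * (a - x0) ≤ F a)
    (hv : OTree v Ss) (hc : Chain F a Ss b) (hN : Ss.length + 1 ≤ N) :
    Calls program fClip (.cell v (.cell (.cell (.num x0) (.num y0)) (.num α)))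
      fun v s => ∃ Ts, OTree v Ts ∧ Chain (clipped F a x0 y0 α) x0 Ts b ∧
        Ts.length ≤ Ss.length + 1 ∧ s ≤ 30000 * ht N ^ 2 := by
  have h3 : 3 ≤ ht N := by unfold ht; omega
  have h9 : 3 * ht N ≤ ht N ^ 2 := by nlinarith
  have hne := hc.ne_nil hab
  have hv' := hv
  obtain ⟨H, hv⟩ := hv.tree hne
  have hp := hv.hdr_for.path
  obtain ⟨e1, e2⟩ := hp.start hc.path hne
  obtain ⟨e3, e4⟩ := hp.unique (e1 ▸ e2 ▸ hc.path)
  refine Calls.of_sem clipBody rfl ?_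
  conv => whnf
  -- The test reads `α * x - y ≤ α * x0 - y0`: the end point is on or above the line.
  refine (hv'.split (N := N) α ((-1 : ℤ) : ℝ) ((0 : ℤ) : ℝ) (α * x0 - y0)
    (.inl (by simp)) (by simp) (by omega)).mono ?_
  rintro _ s1 ⟨L, R, Ls, Rs, rfl, hL, hR, rfl, k1, k2, hs1⟩
  obtain ⟨m, hcL, hcR⟩ := chain_append.mp hc
  have ham := hcL.le
  have hmb := hcR.le
  have hm : y0 + α * (m - x0) ≤ F m := by
    rcases hL with ⟨-, rfl⟩ | ⟨HL, hL⟩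
    · obtain rfl : a = m := hcL
      exact hla
    · have hLf := hL.hdr_for
      have := k1 _ hLf
      obtain ⟨e1, e2⟩ := hLf.path.start hcL.path hLf.ne
      obtain ⟨e3, e4⟩ := hLf.path.unique (e1 ▸ e2 ▸ hcL.path)
      unfold Passes at this
      rw [e3, e4] at this
      push_cast at this
      linarith
  simp only [List.length_append] at hN ⊢
  rcases hR with ⟨rfl, rfl⟩ | ⟨HR, hR⟩
  · obtain rfl : m = b := hcR
    obtain ⟨c, rfl, -⟩ := hv
    conv => whnf
    rw [e3]
    refine (seg_spec x0 y0 m (y0 + α * (m - x0)) (by linarith)).mono ?_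
    rintro w s2 ⟨hw, hs2⟩
    refine ⟨_, hw.o, ⟨rfl, rfl, fun x h1 h2 => ?_, rfl⟩, by simp, by omega⟩
    rw [segArc_eq _ (by ring) rfl x]
    exact (clipped_of_le fun h3 => hF.ge_line hla hm hab h3 h2).symm
  · cases Rs with
    | nil => exact absurd rfl hR.hdr_for.ne
    | cons W Ks =>
      have hR' := hR
      obtain ⟨c, rfl, -⟩ := hR'
      have hWa : W.a = m := hcR.1
      have hag := hcR.2.2.1
      simp only [List.length_cons] at hN ⊢
      conv => whnf
      refine (hR.o.uncons (N := N) (by simp; omega)).mono ?_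
      rintro _ s2 ⟨w, k, rfl, hw, hk, hs2⟩
      conv => whnf
      refine (trim_spec (N := N) hF hx hla hw hk (by linarith) (hWa ▸ hcR) (hWa ▸ hm) ?_
        (by omega)).mono ?_
      · have := k2 W Ks rfl
        unfold Passes at this
        simp only [Arc.hdr] at this
        rw [hag _ W.lt.le le_rfl] at this
        push_cast at this
        linarith
      · rintro v' s3 ⟨Ts, hT, hcT, hTl, hs3⟩
        exact ⟨Ts, hT, hcT, by omega, by omega⟩

theorem Rep.leaf_chain {H : Hdr} {b : Val} {A : Arc} (h : Rep H b [A]) (h0 : H.h = 0) :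
    ∃ t c, b = .cell t (.cell c (.num 0)) ∧ (c = .num 0 ∧ A.len = 0 ∨
      ∃ K Ss, Tree c K Ss ∧ Chain A.F A.a Ss A.b ∧ A.len = Ss.length) := by
  cases h with
  | seg t h => exact ⟨_, _, rfl, .inl ⟨rfl, h⟩⟩
  | arc t h1 h2 h3 h4 h5 =>
    exact ⟨_, _, rfl, .inr ⟨_, _, ⟨_, rfl, h1⟩, Chain.of_path h3 h2 h5, h4⟩⟩
  | node => omega

/-- The upper cap is a clip from the left end, the lower cap the same clip after a reflection. A
leaf without chain counts as one segment and each clip adds at most one, hence `A.len + 3`. -/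
theorem mat_spec {A : Arc} {v : Val} {N : ℕ} (hv : Tree v A.hdr [A]) (hA : A.Tight)
    (hN : A.len + 4 ≤ N) : Calls program fMat v fun w s => ∃ Ss, OTree w Ss ∧
      Chain A.G A.a Ss A.b ∧ Ss.length ≤ A.len + 3 ∧ s ≤ 70000 * ht N ^ 2 := by
  have h3 : 3 ≤ ht N := by unfold ht; omega
  have h9 : 9 ≤ ht N ^ 2 := by nlinarith
  have hlt := A.lt
  have hv' := hv
  obtain ⟨b, rfl, hR⟩ := hv
  obtain ⟨t, c, rfl, hc⟩ := hR.leaf_chain rfl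
  have key : ∀ (u : Val) (Ss : List Arc), OTree u Ss → Chain A.F A.a Ss A.b →
      Ss.length ≤ A.len + 1 → Calls program fClip
        (.cell u (.cell (.cell (.num A.a) (.num (A.F A.a))) (.num A.lam))) fun w s =>
        ∃ Ts, OTree w Ts ∧ Chain (fun x => min (A.F x) (A.F A.a + A.lam * (x - A.a))) A.a Ts A.b ∧
          Ts.length ≤ A.len + 2 ∧ s ≤ 30000 * ht N ^ 2 := by
    intro u Ss hu hS hl
    refine (clip_spec (N := N) hlt A.conc le_rfl (by simp) hu hS (by omega)).mono ?_
    rintro w s ⟨Ts, h1, h2, h3, h4⟩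
    refine ⟨Ts, h1, h2.congr fun x h5 _ => ?_, by omega, h4⟩
    unfold clipped
    rw [if_neg (not_lt.mpr h5)]
  have hch := A.chord_mul
  have htb := mul_le_mul_of_nonneg_right hA.2 (sub_nonneg.mpr hlt.le)
  have key2 : ∀ (w : Val) (Ts : List Arc) (s0 : ℕ), OTree w Ts →
      Chain (fun x => min (A.F x) (A.F A.a + A.lam * (x - A.a))) A.a Ts A.b →
      Ts.length ≤ A.len + 2 → s0 ≤ 31000 * ht N ^ 2 →
      Sem program (letIn (call₂ fApp (var 0) flipTag) <|
        call₂ fApp (call₂ fClip (var 0) (cell (lPt (var 0))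
          (sub (const 0) (snd (caps (var 2)))))) flipTag)
        [w, .cell A.hdr.enc (.cell t (.cell c (.num 0)))] s0
        fun w s => ∃ Ss, OTree w Ss ∧
      Chain A.G A.a Ss A.b ∧ Ss.length ≤ A.len + 3 ∧ s ≤ 70000 * ht N ^ 2 := by
    intro w Ts s0 hw hT hTl hs0
    obtain ⟨H, hw⟩ := hw.tree (hT.ne_nil hlt)
    conv => whnf
    refine hw.flip.mono ?_
    rintro w1 s1 ⟨hw1, hs1⟩
    have hT1 := hT.flip
    have hw1' := hw1
    obtain ⟨b1, rfl, -⟩ := hw1'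
    have hT1ne := hT1.ne_nil (by linarith)
    have hp := hw1.hdr_for.path
    obtain ⟨e1, e2⟩ := hp.start hT1.path hT1ne
    conv => whnf
    rw [e1, e2]
    simp only [neg_neg]
    -- By tightness the first clip leaves the value at the right end, where the second line starts.
    rw [min_eq_left (by linarith)]
    refine (clip_spec (N := N) (by linarith) ?_ le_rfl ?_ hw1.o hT1 (by simp; omega)).mono ?_
    · intro x y z h1 h2 h3 h4
      have := (A.conc.min (Conc.line A.a A.b (A.F A.a) A.lam A.a)) (-z) (-y) (-x)
        (by linarith) (by linarith) (by linarith) (by linarith)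
      simp only at this ⊢
      linarith
    · simp only [neg_neg, sub_self, mul_zero, add_zero]
      apply le_min le_rfl; linarith
    rintro w2 s2 ⟨Us, hw2, hU, hUl, hs2⟩
    obtain ⟨K, hw2⟩ := hw2.tree (hU.ne_nil (by linarith))
    conv => whnf
    refine hw2.flip.mono ?_
    rintro w3 s3 ⟨hw3, hs3⟩
    refine ⟨_, hw3.o, ?_, ?_, by omega⟩
    · have := hU.flip
      simp only [neg_neg] at this
      refine this.congr fun x h1 h2 => ?_
      unfold clipped Arc.G
      rw [if_neg (by linarith)]
      simp only [neg_neg]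
      rw [min_assoc]
      congr 2
      change A.F A.b + A.rho * (x - A.b) = A.F A.b + (((0 : ℤ) : ℝ) - A.rho) * (-x - -A.b)
      push_cast
      ring
    · simp only [length_appL] at hUl ⊢; omega
  refine Calls.of_sem matBody rfl ?_
  rcases hc with ⟨rfl, h0⟩ | ⟨K, Ss, hc, hS, hl⟩
  · conv => whnf
    refine (key _ _ hv'.o ⟨rfl, h0, fun _ _ _ => rfl, rfl⟩ (by simp)).mono ?_
    rintro w s ⟨Ts, h1, h2, h3, h4⟩
    refine key2 w Ts _ h1 h2 h3 ?_
    omega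
  · have hc' := hc
    obtain ⟨c, rfl, -⟩ := hc'
    conv => whnf
    refine (key _ _ hc.o hS (by omega)).mono ?_
    rintro w s ⟨Ts, h1, h2, h3, h4⟩
    refine key2 w Ts _ h1 h2 h3 ?_
    omega

/-! ## Cutting -/

/-- What cutting the arcs `As` at `k` yields: a cut between two arcs, or through an arc `X` whose
halves `X₁`, `X₂` satisfy `Q X X₁ X₂`. -/
def Cut (Q : Arc → Arc → Arc → Prop) (p y k q z : ℝ) (As Ls Rs : List Arc) : Prop :=
  (As = Ls ++ Rs ∧ ∃ u, Path p y Ls k u ∧ Path k u Rs q z) ∨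
    ∃ Ls' X Rs' X₁ X₂, As = Ls' ++ X :: Rs' ∧ Ls = Ls' ++ [X₁] ∧ Rs = X₂ :: Rs' ∧ Q X X₁ X₂

/-- The halves of `X` at `k` have the right end points. -/
structure Ends (k : ℝ) (X X₁ X₂ : Arc) : Prop where
  a₁ : X₁.a = X.a
  fa : X₁.F X.a = X.F X.a
  b₁ : X₁.b = k
  a₂ : X₂.a = k
  fk : X₁.F k = X₂.F k
  b₂ : X₂.b = X.b
  fb : X₂.F X.b = X.F X.b

theorem Cut.path {Q : Arc → Arc → Arc → Prop} {p y k q z : ℝ} {As Ls Rs : List Arc}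
    (h : Cut Q p y k q z As Ls Rs) (hQ : ∀ X X₁ X₂, Q X X₁ X₂ → Ends k X X₁ X₂)
    (hp : Path p y As q z) : ∃ u, Path p y Ls k u ∧ Path k u Rs q z := by
  rcases h with ⟨-, h⟩ | ⟨Ls', X, Rs', X₁, X₂, rfl, rfl, rfl, h⟩
  · exact h
  · have e := hQ _ _ _ h
    obtain ⟨m, w, h1, ⟨rfl, rfl⟩, h3⟩ := path_append.mp hp
    refine ⟨X₁.F k, path_append.mpr ⟨_, _, h1, ?_⟩, ?_⟩
    · simp [Path, e.a₁, e.fa, e.b₁]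
    · refine ⟨⟨e.a₂.symm, ?_⟩, ?_⟩
      · rw [e.a₂, e.fk]
      · rw [e.b₂, e.fb]; exact h3

/-- Stated for an arbitrary relation `Q` between an arc and its halves, so that it serves both for
chains of segments and for lists of arcs. Cutting an arc means cutting its chain, so the second use
rests on the first. -/
theorem splitAt_core {Q : Arc → Arc → Arc → Prop} {p y k q z : ℝ} {As : List Arc} {v : Val}
    {N B : ℕ} (hv : OTree v As) (hp : Path p y As q z) (hpk : p ≤ k) (hkq : k ≤ q)
    (hN : As.length + 1 ≤ N) (hQ : ∀ X X₁ X₂, Q X X₁ X₂ → Ends k X X₁ X₂)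
    (hX : ∀ X ∈ As, ∀ u, Tree u X.hdr [X] → X.a < k → k < X.b →
      Calls program fHalve (.cell u (.num k)) fun w s => ∃ l r X₁ X₂, w = .cell l r ∧
        OTree l [X₁] ∧ OTree r [X₂] ∧ Q X X₁ X₂ ∧ s ≤ B) :
    Calls program fSplitAt (.cell v (.num k)) fun w s => ∃ l r Ls Rs, w = .cell l r ∧
      OTree l Ls ∧ OTree r Rs ∧ Cut Q p y k q z As Ls Rs ∧ s ≤ B + 30000 * ht N ^ 2 := by
  have h3 : 3 ≤ ht N := by unfold ht; omega
  have h9 : 3 * ht N ≤ ht N ^ 2 := by nlinarith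
  refine Calls.of_sem splitAtBody rfl ?_
  conv => whnf
  refine (hv.split (N := N) ((1 : ℤ) : ℝ) ((0 : ℤ) : ℝ) ((0 : ℤ) : ℝ) k
    (.inl (by simp)) (by simp) (by omega)).mono ?_
  rintro _ s1 ⟨L, R, Ls, Rs, rfl, hL, hR, rfl, k1, k2, hs1⟩
  obtain ⟨m, u, hpL, hpR⟩ := path_append.mp hp
  have hmk : m ≤ k := by
    rcases hL with ⟨-, rfl⟩ | ⟨HL, hL⟩
    · obtain ⟨rfl, -⟩ := hpL
      exact hpk
    · have hLf := hL.hdr_for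
      have := k1 _ hLf
      obtain ⟨e1, e2⟩ := hLf.path.start hpL hLf.ne
      obtain ⟨e3, e4⟩ := hLf.path.unique (e1 ▸ e2 ▸ hpL)
      unfold Passes at this
      rw [e3, e4] at this
      push_cast at this
      linarith
  simp only [List.length_append] at hN
  rcases hR with ⟨rfl, rfl⟩ | ⟨HR, hR⟩
  · obtain ⟨rfl, rfl⟩ := hpR
    obtain rfl : m = k := le_antisymm hmk hkq
    conv => whnf
    exact ⟨_, _, _, _, rfl, hL, .nil, .inl ⟨rfl, u, hpL, rfl, rfl⟩, by omega⟩
  · cases Rs with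
    | nil => exact absurd rfl hR.hdr_for.ne
    | cons X Rs =>
      obtain ⟨c, rfl, -⟩ := id hR
      have hXb : k < X.b := by
        have := k2 X Rs rfl
        unfold Passes at this
        simp only [Arc.hdr] at this
        push_cast at this
        linarith
      simp only [List.length_cons] at hN
      conv => whnf
      refine (hR.o.uncons (N := N) (by simp; omega)).mono ?_
      rintro _ s2 ⟨x, r, rfl, hx, hr, hs2⟩
      obtain ⟨c', rfl, -⟩ := id hx
      conv => whnf
      refine ⟨fun h => ?_, fun h => ?_⟩
      · replace h : X.a < k := h
        conv => whnf
        refine (hX X (by simp) _ hx h hXb).mono ?_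
        rintro _ s3 ⟨l', r', X₁, X₂, rfl, hl', hr', hq, hs3⟩
        have hcut : Cut Q p y k q z (Ls ++ X :: Rs) (Ls ++ [X₁]) ([X₂] ++ Rs) :=
          .inr ⟨Ls, X, Rs, X₁, X₂, rfl, rfl, rfl, hq⟩
        obtain ⟨u', hp1, hp2⟩ := hcut.path hQ hp
        conv => whnf
        refine (hL.join hl' ⟨_, _, _, _, hp1⟩ (N := N) (by simp; omega)).mono ?_
        rintro l2 s4 ⟨hl2, hs4⟩
        conv => whnf
        refine (hr'.join hr ⟨_, _, _, _, hp2⟩ (N := N) (by simp; omega)).mono ?_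
        rintro r2 s5 ⟨hr2, hs5⟩
        exact ⟨_, _, _, _, rfl, hl2, hr2, hcut, by omega⟩
      · replace h : ¬ X.a < k := h
        have : m = k := by
          have := hpR.1.1
          linarith
        subst this
        conv => whnf
        exact ⟨_, _, _, _, rfl, hL, hR.o, .inl ⟨rfl, u, hpL, hpR⟩, by omega⟩

/-- The halves of a segment. -/
structure SegHalves (k : ℝ) (X X₁ X₂ : Arc) : Prop extends Ends k X X₁ X₂ where
  len₁ : X₁.len = 0
  len₂ : X₂.len = 0
  f₁ : ∀ x, X.a ≤ x → x ≤ k → X₁.F x = X.F x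
  f₂ : ∀ x, k ≤ x → x ≤ X.b → X₂.F x = X.F x
  g₁ : X₁.G = X₁.F
  g₂ : X₂.G = X₂.F
  t₁ : X₁.Tight
  t₂ : X₂.Tight

theorem halve_seg {X : Arc} {u : Val} {k : ℝ} (hu : Tree u X.hdr [X]) (h0 : X.len = 0)
    (h1 : X.a < k) (h2 : k < X.b) :
    Calls program fHalve (.cell u (.num k)) fun w s => ∃ l r X₁ X₂, w = .cell l r ∧
        OTree l [X₁] ∧ OTree r [X₂] ∧ SegHalves k X X₁ X₂ ∧ s ≤ 1000 := by
  obtain ⟨b, rfl, hR⟩ := hu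
  obtain ⟨t, c, rfl, ⟨rfl, -⟩ | ⟨K, Ss, hc, hS, hl⟩⟩ := hR.leaf_chain rfl
  swap
  · exact absurd (List.length_eq_zero_iff.mp (hl.symm.trans h0)) (hS.ne_nil X.lt)
  have hch := X.chord_mul
  have hlin : ∀ x, X.a ≤ x → x ≤ X.b → X.F x = X.F X.a + X.chord * (x - X.a) := by
    intro x h1 h2
    rw [X.lin h0 x h1 h2]; rfl
  refine Calls.of_sem halveBody rfl ?_
  conv => whnf
  refine (seg_spec X.a (X.F X.a) k (X.F X.a + X.chord * (k - X.a)) h1).mono ?_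
  rintro l s1 ⟨hl, hs1⟩
  conv => whnf
  refine (seg_spec k (X.F X.a + X.chord * (k - X.a)) X.b (X.F X.b) h2).mono ?_
  rintro r s2 ⟨hr, hs2⟩
  refine ⟨_, _, _, _, rfl, hl.o, hr.o, ?_, by omega⟩
  exact {
    a₁ := rfl
    fa := segArc_a _ _ _ _ _
    b₁ := rfl
    a₂ := rfl
    fk := (segArc_b _ _ _ _ _).trans (segArc_a _ _ _ _ _).symm
    b₂ := rfl
    fb := segArc_b _ _ _ _ _
    len₁ := rfl
    len₂ := rfl
    f₁ := fun x h3 h4 => by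
      rw [hlin x h3 (by linarith)]
      exact segArc_eq _ (by ring) rfl x
    f₂ := fun x h3 h4 => by
      rw [hlin x (by linarith) h4]
      exact segArc_eq _ rfl (by linarith) x
    g₁ := funext fun x => segArc_G _ _ _ _ _ x
    g₂ := funext fun x => segArc_G _ _ _ _ _ x
    t₁ := segArc_tight _ _ _ _ _
    t₂ := segArc_tight _ _ _ _ _ }

theorem splitAt_chain {F : ℝ → ℝ} {a b k : ℝ} {Ss : List Arc} {v : Val} {N : ℕ}
    (hv : OTree v Ss) (hc : Chain F a Ss b) (hak : a ≤ k) (hkb : k ≤ b) (hN : Ss.length + 1 ≤ N) :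
    Calls program fSplitAt (.cell v (.num k)) fun w s => ∃ l r Ls Rs, w = .cell l r ∧
      OTree l Ls ∧ OTree r Rs ∧ Chain F a Ls k ∧ Chain F k Rs b ∧
      Ls.length + Rs.length ≤ Ss.length + 1 ∧ s ≤ 40000 * ht N ^ 2 := by
  have h3 : 3 ≤ ht N := by unfold ht; omega
  have h9 : 9 ≤ ht N ^ 2 := by nlinarith
  refine (splitAt_core (Q := SegHalves k) hv hc.path hak hkb hN (fun X X₁ X₂ h => h.toEnds)
    fun X hX u hu h1 h2 => halve_seg hu (hc.flat X hX) h1 h2).mono ?_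
  rintro w s ⟨l, r, Ls, Rs, rfl, hl, hr, hcut, hs⟩
  refine ⟨l, r, Ls, Rs, rfl, hl, hr, ?_⟩
  have hs' : s ≤ 40000 * ht N ^ 2 := by omega
  rcases hcut with ⟨rfl, u, hp, -⟩ | ⟨Ls', X, Rs', X₁, X₂, rfl, rfl, rfl, h⟩
  · obtain ⟨m, h4, h5⟩ := chain_append.mp hc
    obtain ⟨rfl, -⟩ := h4.path.unique hp
    exact ⟨h4, h5, by simp, hs'⟩
  · obtain ⟨m, h4, h5, -, h7, h8⟩ := chain_append.mp hc
    have e := X₁.lt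
    have e' := X₂.lt
    rw [h.b₁] at e
    rw [h.a₂] at e'
    refine ⟨chain_append.mpr ⟨m, h4, ?_⟩, ⟨h.a₂, h.len₂, fun x h1 h2 => ?_, ?_⟩, by simp; omega,
      hs'⟩
    · refine ⟨h.a₁.trans h5, h.len₁, fun x h1 h2 => ?_, h.b₁⟩
      have := h.a₁
      have := h.b₂
      have := h.b₁
      rw [h.f₁ x (by linarith) (by linarith), h7 x (by linarith) (by linarith)]
    · have := h.a₁
      have := h.b₂
      have := h.a₂
      rw [h.f₂ x (by linarith) (by linarith), h7 x (by linarith) (by linarith)]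
    · rw [h.b₂]; exact h8

/-! ### Cutting concave arcs -/

/-- All slopes of `G` on `[a, b]` lie between `rho` and `lam`. -/
def SlopesIn (G : ℝ → ℝ) (a b rho lam : ℝ) : Prop :=
  ∀ x y, a ≤ x → x ≤ y → y ≤ b → rho * (y - x) ≤ G y - G x ∧ G y - G x ≤ lam * (y - x)

/-- The slopes of a concave function decrease, so bounds by lines through the two end points control
all of them. -/
theorem Conc.slopesIn {G : ℝ → ℝ} {a b rho lam : ℝ} (hG : Conc a b G)
    (hl : ∀ x, a ≤ x → x ≤ b → G x ≤ G a + lam * (x - a))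
    (hr : ∀ x, a ≤ x → x ≤ b → G x ≤ G b + rho * (x - b)) : SlopesIn G a b rho lam := by
  intro x y h1 h2 h3
  constructor
  · rcases eq_or_lt_of_le h3 with rfl | h
    · have := hr x h1 h2; linarith
    · have e := hG x y b h1 h2 h3 le_rfl
      have e1 := mul_le_mul_of_nonneg_right (hr y (by linarith) h3) (sub_nonneg.mpr h2)
      have : rho * (y - x) * (b - y) ≤ (G y - G x) * (b - y) := by linarith
      exact le_of_mul_le_mul_right this (by linarith)
  · rcases eq_or_lt_of_le h1 with rfl | h
    · have := hl y h2 h3; linarith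
    · have e := hG a x y le_rfl h1 h2 h3
      have e1 := mul_le_mul_of_nonneg_right (hl x h1 (by linarith)) (sub_nonneg.mpr h2)
      have : (G y - G x) * (x - a) ≤ lam * (y - x) * (x - a) := by linarith
      exact le_of_mul_le_mul_right this (by linarith)

theorem SlopesIn.mono {G : ℝ → ℝ} {a b a' b' rho lam : ℝ} (h : SlopesIn G a b rho lam)
    (ha : a ≤ a') (hb : b' ≤ b) : SlopesIn G a' b' rho lam :=
  fun x y h1 h2 h3 => h x y (ha.trans h1) h2 (h3.trans hb)

theorem Arc.slopesIn {A : Arc} (h : A.Tight) : SlopesIn A.G A.a A.b A.rho A.lam := by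
  refine A.G_conc.slopesIn (fun x _ _ => ?_) (fun x _ _ => ?_)
  · rw [Arc.G_a h]
    exact (min_le_right _ _).trans (min_le_left _ _)
  · rw [Arc.G_b h]
    exact (min_le_right _ _).trans (min_le_right _ _)

theorem chainArc_tight {F : ℝ → ℝ} {a b lam rho : ℝ} {n : ℕ} {h : a < b} {hF : Conc a b F}
    (hs : SlopesIn F a b rho lam) : (chainArc F a b lam rho n h hF).Tight := by
  obtain ⟨h1, h2⟩ := hs a b le_rfl h.le le_rfl
  constructor
  · change rho ≤ (F b - F a) / (b - a)
    rwa [le_div_iff₀ (by linarith)]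
  · change (F b - F a) / (b - a) ≤ lam
    rwa [div_le_iff₀ (by linarith)]

/-- Caps that contain all slopes are idle. So the parts of an arc whose caps have been worked in may
keep its caps. -/
theorem chainArc_G {F : ℝ → ℝ} {a b lam rho : ℝ} {n : ℕ} {h : a < b} {hF : Conc a b F}
    (hs : SlopesIn F a b rho lam) {x : ℝ} (h1 : a ≤ x) (h2 : x ≤ b) :
    (chainArc F a b lam rho n h hF).G x = F x := by
  apply min_eq_left
  apply le_min
  · have := (hs a x le_rfl h1 h2).2
    change F x ≤ F a + lam * (x - a)
    linarith
  · have := (hs x b h1 h2 le_rfl).1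
    change F x ≤ F b + rho * (x - b)
    linarith

theorem Arc.G_of_len {A : Arc} (h : A.Tight) (h0 : A.len = 0) {x : ℝ} (h1 : A.a ≤ x)
    (h2 : x ≤ A.b) : A.G x = A.F x := by
  have hch := A.chord_mul
  have e := A.lin h0 x h1 h2
  change A.F x = A.F A.a + A.chord * (x - A.a) at e
  have e1 := mul_le_mul_of_nonneg_right h.2 (sub_nonneg.mpr h1)
  have e2 := mul_le_mul_of_nonneg_right h.1 (sub_nonneg.mpr h2)
  apply min_eq_left
  apply le_min <;> linarith

/-- The halves of an arc. -/
structure Halves (k : ℝ) (X X₁ X₂ : Arc) : Prop extends Ends k X X₁ X₂ where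
  len : X₁.len + X₂.len ≤ X.len + 4
  g₁ : ∀ x, X.a ≤ x → x ≤ k → X₁.G x = X.G x
  g₂ : ∀ x, k ≤ x → x ≤ X.b → X₂.G x = X.G x
  t₁ : X₁.Tight
  t₂ : X₂.Tight

/-- Working in the caps yields at most `X.len + 3` segments and cutting the chain adds at most one,
whence the four extra segments in `Halves`. -/
theorem halve_spec {X : Arc} {u : Val} {k : ℝ} {N : ℕ} (hu : Tree u X.hdr [X]) (hX : X.Tight)
    (h1 : X.a < k) (h2 : k < X.b) (hN : X.len + 4 ≤ N) :
    Calls program fHalve (.cell u (.num k)) fun w s => ∃ l r X₁ X₂, w = .cell l r ∧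
        OTree l [X₁] ∧ OTree r [X₂] ∧ Halves k X X₁ X₂ ∧ s ≤ 120000 * ht N ^ 2 := by
  have h3 : 3 ≤ ht N := by unfold ht; omega
  have h9 : 9 ≤ ht N ^ 2 := by nlinarith
  by_cases h0 : X.len = 0
  · refine (halve_seg hu h0 h1 h2).mono ?_
    rintro w s ⟨l, r, X₁, X₂, rfl, hl, hr, h, hs⟩
    refine ⟨l, r, X₁, X₂, rfl, hl, hr, ⟨h.toEnds, ?_, ?_, ?_, h.t₁, h.t₂⟩, by omega⟩
    · rw [h.len₁, h.len₂]; omega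
    · intro x h4 h5
      rw [h.g₁, h.f₁ x h4 h5, Arc.G_of_len hX h0 h4 (by linarith)]
    · intro x h4 h5
      rw [h.g₂, h.f₂ x h4 h5, Arc.G_of_len hX h0 (by linarith) h5]
  have hu' := hu
  obtain ⟨b, rfl, hR⟩ := hu
  obtain ⟨t, c, rfl, ⟨-, h⟩ | ⟨K, Ss, ⟨c, rfl, -⟩, -, -⟩⟩ := hR.leaf_chain rfl
  · exact absurd h h0
  refine Calls.of_sem halveBody rfl ?_
  conv => whnf
  refine (mat_spec hu' hX hN).mono ?_
  rintro m s1 ⟨Ms, hm, hMc, hMl, hs1⟩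
  conv => whnf
  refine (splitAt_chain (N := N) hm hMc h1.le h2.le (by omega)).mono ?_
  rintro _ s2 ⟨l, r, Ls, Rs, rfl, hl, hr, hLc, hRc, hlen, hs2⟩
  have hS := Arc.slopesIn hX
  have hS1 := hS.mono le_rfl h2.le
  have hS2 := hS.mono h1.le le_rfl
  conv => whnf
  refine (arc_spec X.lam X.rho h1 (X.G_conc.mono le_rfl h2.le) hl hLc).mono ?_
  rintro l' s3 ⟨hl', hs3⟩
  conv => whnf
  refine (arc_spec X.lam X.rho h2 (X.G_conc.mono h1.le le_rfl) hr hRc).mono ?_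
  rintro r' s4 ⟨hr', hs4⟩
  refine ⟨_, _, _, _, rfl, hl'.o, hr'.o, ?_, by omega⟩
  exact {
    a₁ := rfl
    fa := Arc.G_a hX
    b₁ := rfl
    a₂ := rfl
    fk := rfl
    b₂ := rfl
    fb := Arc.G_b hX
    len := by
      have := List.length_pos_of_ne_nil (hLc.ne_nil h1)
      have := List.length_pos_of_ne_nil (hRc.ne_nil h2)
      simp only [chainArc]; omega
    g₁ := fun x h3 h4 => chainArc_G hS1 h3 h4
    g₂ := fun x h3 h4 => chainArc_G hS2 h3 h4
    t₁ := chainArc_tight hS1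
    t₂ := chainArc_tight hS2 }

theorem splitAt_spec {p y k q z : ℝ} {As : List Arc} {v : Val} {N : ℕ}
    (hv : OTree v As) (hp : Path p y As q z) (hpk : p ≤ k) (hkq : k ≤ q)
    (hN : As.length + 1 ≤ N) (hT : ∀ A ∈ As, A.Tight ∧ A.len + 4 ≤ N) :
    Calls program fSplitAt (.cell v (.num k)) fun w s => ∃ l r Ls Rs, w = .cell l r ∧
      OTree l Ls ∧ OTree r Rs ∧ Cut (Halves k) p y k q z As Ls Rs ∧ s ≤ 150000 * ht N ^ 2 := by
  refine (splitAt_core (Q := Halves k) hv hp hpk hkq hN (fun X X₁ X₂ h => h.toEnds)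
    fun X hX u hu h1 h2 => halve_spec hu (hT X hX).1 h1 h2 (hT X hX).2).mono ?_
  rintro w s ⟨l, r, Ls, Rs, rfl, hl, hr, hcut, hs⟩
  exact ⟨l, r, Ls, Rs, rfl, hl, hr, hcut, by omega⟩

/-! ## Waves -/

/-- The arc has integer end points and the values `f`. -/
structure Arc.Mod (f : ℤ → ℝ) (A : Arc) : Prop where
  tight : A.Tight
  ia : ∃ m : ℤ, A.a = m
  ib : ∃ m : ℤ, A.b = m
  val : ∀ k : ℤ, A.a ≤ k → (k : ℝ) ≤ A.b → A.G k = f k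

/-- `f'` is the left wave of `f` on the range from `i` to `j`. -/
def IsWave (i : ℤ) (α : ℝ) (f f' : ℤ → ℝ) (j : ℤ) : Prop :=
  ∀ k, i ≤ k → k ≤ j → (∀ t, i ≤ t → t ≤ k → f' k ≤ f t + ((k : ℝ) - t) * α) ∧
    ∃ t, i ≤ t ∧ t ≤ k ∧ f' k = f t + ((k : ℝ) - t) * α

/-- If the wave leaves the value at `m` unchanged, whatever reaches `k` from before `m` is matched
by what starts at `m`. -/
theorem IsWave.restart {i m j : ℤ} {α : ℝ} {f f' : ℤ → ℝ} (h : IsWave i α f f' j) (him : i ≤ m)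
    (hm : f' m = f m) : IsWave m α f f' j := by
  intro k hk hkj
  obtain ⟨h1, t, h2, h3, h4⟩ := h k (him.trans hk) hkj
  refine ⟨fun t ht => h1 t (him.trans ht), ?_⟩
  by_cases ht : m ≤ t
  · exact ⟨t, ht, h3, h4⟩
  · refine ⟨m, le_rfl, hk, ?_⟩
    have e1 := h1 m him hk
    have e2 := (h m him (hk.trans hkj)).1 t h2 (by omega)
    linarith

/-- Values on or above the line of slope `α` from `m` have no effect, because starting at `m` is at
least as good. They may be replaced by any values on or above the line. This justifies both merges.
-/
theorem IsWave.congr {m j : ℤ} {α : ℝ} {f g f' : ℤ → ℝ} (h : IsWave m α f f' j) (hm : g m = f m)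
    (h1 : ∀ t, m ≤ t → t ≤ j → min (f t) (f m + α * (t - m)) ≤ g t)
    (h2 : ∀ t, m ≤ t → t ≤ j → g t = f t ∨ f m + α * (t - m) ≤ f t) : IsWave m α g f' j := by
  have key : ∀ k t, m ≤ t → t ≤ k → k ≤ j → f' k ≤ f' t + ((k : ℝ) - t) * α := by
    intro k t h3 h4 h5
    obtain ⟨-, s, h6, h7, h8⟩ := h t h3 (h4.trans h5)
    have := (h k (h3.trans h4) h5).1 s h6 (h7.trans h4)
    linarith
  have low : ∀ t, m ≤ t → t ≤ j → f' t ≤ g t := by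
    intro t h3 h4
    refine le_trans ?_ (h1 t h3 h4)
    have e1 := (h t h3 h4).1 t h3 le_rfl
    have e2 := (h t h3 h4).1 m le_rfl h3
    apply le_min <;> linarith
  intro k hk hkj
  refine ⟨fun t h3 h4 => ?_, ?_⟩
  · have := key k t h3 h4 hkj
    have := low t h3 (h4.trans hkj)
    linarith
  · obtain ⟨h0, t, h3, h4, h5⟩ := h k hk hkj
    rcases h2 t h3 (h4.trans hkj) with h6 | h6
    · exact ⟨t, h3, h4, by rw [h6]; exact h5⟩
    · refine ⟨m, le_rfl, hk, ?_⟩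
      rw [hm]
      have := h0 m le_rfl hk
      linarith

theorem Arc.Mod.fa {f : ℤ → ℝ} {A : Arc} (h : A.Mod f) {m : ℤ} (hm : A.a = m) :
    A.F A.a = f m := by
  rw [← Arc.G_a h.tight, hm]
  exact h.val m hm.le (by have := A.lt; linarith)

theorem Arc.Mod.fb {f : ℤ → ℝ} {A : Arc} (h : A.Mod f) {m : ℤ} (hm : A.b = m) :
    A.F A.b = f m := by
  rw [← Arc.G_b h.tight, hm]
  exact h.val m (by have := A.lt; linarith) hm.ge

theorem Path.end_val {f : ℤ → ℝ} {As : List Arc} {p y q z : ℝ} (hp : Path p y As q z)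
    (hm : ∀ A ∈ As, A.Mod f) (hne : As ≠ []) {j : ℤ} (hj : q = j) : z = f j := by
  induction As generalizing p y with
  | nil => exact absurd rfl hne
  | cons A As ih =>
    cases As with
    | nil =>
      obtain ⟨-, rfl, rfl⟩ := hp
      exact (hm A (by simp)).fb hj
    | cons B Bs => exact ih hp.2 (fun C hC => hm C (by simp [hC])) (by simp)

/-- An arc whose chord is steeper than `α` lies above the line with slope `α` through its
left end. -/
theorem Arc.Mod.above {f : ℤ → ℝ} {A : Arc} (h : A.Mod f) {x0 y0 α : ℝ}
    (ha : y0 + α * (A.a - x0) ≤ A.F A.a) (hb : y0 + α * (A.b - x0) ≤ A.F A.b) {k : ℤ}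
    (h1 : A.a ≤ k) (h2 : (k : ℝ) ≤ A.b) : y0 + α * (k - x0) ≤ f k := by
  rw [← h.val k h1 h2]
  rw [← Arc.G_a h.tight] at ha
  rw [← Arc.G_b h.tight] at hb
  exact A.G_conc.ge_line ha hb A.lt h1 h2

theorem Arc.cap_G {A : Arc} {l r : ℝ} (hr : r ≤ A.rho) {x : ℝ} (hx : A.a ≤ x) :
    (A.cap l r).G x = min (A.G x) (A.F A.a + l * (x - A.a)) := by
  unfold Arc.G
  simp only [cap_a, cap_b, cap_F, cap_lam, cap_rho, max_eq_left hr]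
  rw [min_mul_of_nonneg _ _ (sub_nonneg.mpr hx), ← min_add_add_left]
  simp only [min_assoc, min_comm, min_left_comm]

/-- A chord slope of at most `α` means that the left end cannot lower the right end, so the wave
restarts at every arc. Inside an arc concavity leaves only `t = k` and the left end as candidates,
and their minimum is the graph with a new upper cap. -/
theorem wave_prefix {Ls : List Arc} {i m j : ℤ} {α r y w : ℝ} {f f' : ℤ → ℝ}
    (hW : IsWave i α f f' j) (hp : Path i y Ls m w) (hmj : m ≤ j) (hm : ∀ A ∈ Ls, A.Mod f)
    (hc : ∀ A ∈ Ls, A.chord ≤ α) (hr : ∀ A ∈ Ls, r ≤ A.rho) :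
    (∀ A ∈ Ls.map (Arc.cap α r), A.Mod f') ∧ IsWave m α f f' j := by
  induction Ls generalizing i y with
  | nil =>
    obtain ⟨h1, -⟩ := hp
    obtain rfl : i = m := by exact_mod_cast h1
    exact ⟨by simp, hW⟩
  | cons A Ls ih =>
    obtain ⟨⟨hia, rfl⟩, hp⟩ := hp
    simp only [List.mem_cons, forall_eq_or_imp] at hm hc hr
    obtain ⟨hA, hm⟩ := hm
    obtain ⟨n, hn⟩ := hA.ib
    have hlt := A.lt
    have hin : i < n := by
      have : (i : ℝ) < n := by rw [hia, ← hn]; exact hlt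
      exact_mod_cast this
    have hnm : n ≤ m := by
      have := hp.le
      rw [hn] at this
      exact_mod_cast this
    have hfa := hA.fa hia.symm
    have hval : ∀ k : ℤ, i ≤ k → k ≤ n → f' k = min (f k) (f i + α * (k - i)) := by
      intro k h1 h2
      obtain ⟨h3, t, h4, h5, h6⟩ := hW k h1 (by omega)
      have e1 := h3 k h1 le_rfl
      have e2 := h3 i le_rfl h1
      apply le_antisymm
      · apply le_min <;> linarith
      rw [h6]
      rcases eq_or_lt_of_le h5 with rfl | h7
      · simp
      have h8 : (i : ℝ) < k := by exact_mod_cast h4.trans_lt h7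
      have hk1 : A.a ≤ k := by rw [← hia]; exact h8.le
      have hk2 : (k : ℝ) ≤ A.b := by rw [hn]; exact_mod_cast h2
      have ht1 : A.a ≤ t := by rw [← hia]; exact_mod_cast h4
      have ht2 : (t : ℝ) ≤ k := by exact_mod_cast h5
      -- Both ends of the arc restricted up to `k` lie above the line of slope `α` that arrives at
      -- `k` with the claimed minimum; hence so does every intermediate `t`.
      have := (A.G_conc.mono le_rfl hk2).ge_line (x0 := k) (α := α)
        (y0 := min (f k) (f i + α * (k - i))) (by
          rw [Arc.G_a hA.tight, hfa, ← hia]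
          have := min_le_right (f k) (f i + α * (k - i))
          linarith) (by
          rw [hA.val k hk1 hk2]
          have := min_le_left (f k) (f i + α * (k - i))
          linarith) (by rw [← hia]; exact h8) ht1 ht2
      rw [hA.val t ht1 (ht2.trans hk2)] at this
      linarith
    have hn' : f' n = f n := by
      rw [hval n hin.le le_rfl, min_eq_left]
      rw [← hfa, ← hA.fb hn, hia, ← hn]
      have := A.chord_mul
      have := mul_le_mul_of_nonneg_right hc.1 (sub_nonneg.mpr hlt.le)
      linarith
    rw [hn] at hp
    obtain ⟨h1, h2⟩ := ih (hW.restart hin.le hn') hp hm hc.2 hr.2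
    refine ⟨?_, h2⟩
    simp only [List.map_cons, List.mem_cons, forall_eq_or_imp]
    refine ⟨⟨hA.tight.cap hc.1 (hr.1.trans hA.tight.1), hA.ia, hA.ib, ?_⟩, h1⟩
    intro k hk1 hk2
    simp only [Arc.cap_a, Arc.cap_b] at hk1 hk2
    rw [Arc.cap_G hr.1 hk1, hA.val k hk1 hk2, hfa, ← hia]
    exact (hval k (by rw [← hia] at hk1; exact_mod_cast hk1)
      (by rw [hn] at hk2; exact_mod_cast hk2)).symm

/-! ### The potential, and the wave on a list of arcs -/

/-- The potential: it bounds the number of arcs and the sizes of their chains. -/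
def pot (As : List Arc) : ℕ := (As.map fun A => A.len + 5).sum

@[simp] theorem pot_nil : pot [] = 0 := rfl
@[simp] theorem pot_cons (A : Arc) (As : List Arc) : pot (A :: As) = A.len + 5 + pot As := by
  simp [pot]
@[simp] theorem pot_append (As Bs : List Arc) : pot (As ++ Bs) = pot As + pot Bs := by
  simp [pot]
@[simp] theorem pot_map_cap (l r : ℝ) (As : List Arc) : pot (As.map (Arc.cap l r)) = pot As := by
  simp [pot, Function.comp_def]

@[simp] theorem pot_appL (t : Tag) (As : List Arc) : pot (appL t As) = pot As := by
  unfold appL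
  split_ifs <;> simp [pot, Function.comp_def, List.sum_reverse]

theorem length_le_pot (As : List Arc) : 5 * As.length ≤ pot As := by
  induction As with
  | nil => simp
  | cons A As ih => simp; omega

theorem len_le_pot {As : List Arc} {A : Arc} (h : A ∈ As) : A.len + 5 ≤ pot As := by
  induction As with
  | nil => simp at h
  | cons B As ih =>
    rcases List.mem_cons.mp h with rfl | h
    · simp
    · have := ih h
      simp; omega

/-- The segment over two arcs that lie above a line. -/
theorem merge_seg {X Y : Arc} {f f' : ℤ → ℝ} {m j : ℤ} {α : ℝ} (hX : X.Mod f) (hY : Y.Mod f)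
    (hm : X.a = m) (hxy : X.b = Y.a) (hFxy : X.F X.b = Y.F Y.a) (hlt : X.a < Y.b)
    (hα : α < X.chord) (hYb : X.F X.a + α * (Y.b - X.a) ≤ Y.F Y.b) (hW : IsWave m α f f' j) :
    ∃ g : ℤ → ℝ, IsWave m α g f' j ∧ (segArc X.a (X.F X.a) Y.b (Y.F Y.b) hlt).Mod g ∧
      ∀ k : ℤ, Y.b ≤ k → g k = f k := by
  set S := segArc X.a (X.F X.a) Y.b (Y.F Y.b) hlt with hS
  obtain ⟨n, hn⟩ := hY.ib
  have hfa := hX.fa hm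
  have hXlt := X.lt
  have hXb : X.F X.a + α * (X.b - X.a) ≤ X.F X.b := by
    have := X.chord_mul
    have := mul_le_mul_of_nonneg_right hα.le (sub_nonneg.mpr hXlt.le)
    linarith
  have habove : ∀ t : ℤ, X.a ≤ t → (t : ℝ) ≤ Y.b → X.F X.a + α * (t - X.a) ≤ f t := by
    intro t h1 h2
    rcases le_total (t : ℝ) X.b with h | h
    · exact hX.above (by simp) hXb h1 h
    · refine hY.above ?_ hYb (by rw [← hxy]; exact h) h2
      rw [← hFxy, ← hxy]; exact hXb
  -- Up to the end of `Y` both the old values and the segment lie on or above the line, so the wave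
  -- cannot tell them apart.
  refine ⟨fun k => if (k : ℝ) ≤ Y.b then S.F k else f k, ?_, ?_, ?_⟩
  · refine hW.congr ?_ (fun t h1 h2 => ?_) (fun t h1 h2 => ?_)
    · simp only [← hm]
      rw [if_pos hlt.le, ← hfa]
      exact segArc_a _ _ _ _ _
    · have h1' : X.a ≤ t := by rw [hm]; exact_mod_cast h1
      split_ifs with h
      · refine (min_le_right _ _).trans ?_
        rw [← hfa, ← hm]
        exact S.conc.ge_line (x0 := X.a) (y0 := X.F X.a)
          (by rw [show S.a = X.a from rfl, hS, segArc_a]; simp)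
          (by rw [show S.b = Y.b from rfl, hS, segArc_b]; exact hYb) S.lt h1' h
      · exact min_le_left _ _
    · have h1' : X.a ≤ t := by rw [hm]; exact_mod_cast h1
      split_ifs with h
      · right
        rw [← hfa, ← hm]
        exact habove t h1' h
      · exact .inl rfl
  · refine ⟨segArc_tight _ _ _ _ _, ⟨m, hm⟩, ⟨n, hn⟩, fun k _ h2 => ?_⟩
    rw [if_pos (show (k : ℝ) ≤ Y.b from h2), segArc_G]
  · intro k hk
    simp only
    split_ifs with h
    · have : (k : ℝ) = n := by rw [← hn]; exact le_antisymm h hk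
      have : k = n := by exact_mod_cast this
      subst this
      rw [← hn, hS, segArc_b]
      exact hY.fb hn
    · rfl

/-- The arc that consists of a line over `X`, continued into `Y`. -/
theorem merge_arc {X Y : Arc} {f f' : ℤ → ℝ} {m j : ℤ} {α : ℝ} (hX : X.Mod f) (hY : Y.Mod f)
    (hm : X.a = m) (hxy : X.b = Y.a) (hFxy : X.F X.b = Y.F Y.a) (hlt : X.a < Y.b)
    (hα : α < X.chord) (hYb : Y.F Y.b < X.F X.a + α * (Y.b - X.a)) (hW : IsWave m α f f' j)
    (hC : Conc X.a Y.b (clipped Y.G Y.a X.a (X.F X.a) α)) (c : ℕ) :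
    ∃ g : ℤ → ℝ, IsWave m α g f' j ∧
      (chainArc (clipped Y.G Y.a X.a (X.F X.a) α) X.a Y.b α Y.rho c hlt hC).Mod g ∧
      ∀ k : ℤ, Y.b ≤ k → g k = f k := by
  obtain ⟨n, hn⟩ := hY.ib
  have hfa := hX.fa hm
  have hXlt := X.lt
  have hYlt := Y.lt
  have hXb : X.F X.a + α * (X.b - X.a) ≤ X.F X.b := by
    have := X.chord_mul
    have := mul_le_mul_of_nonneg_right hα.le (sub_nonneg.mpr hXlt.le)
    linarith
  set F := clipped Y.G Y.a X.a (X.F X.a) α with hF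
  have hYb' : F Y.b = Y.F Y.b := by
    rw [hF, clipped_of_ge hYlt.le (by rw [Arc.G_b hY.tight]; exact hYb.le), Arc.G_b hY.tight]
  have hXa : F X.a = X.F X.a := by
    rw [hF, clipped_of_le (fun h => by linarith)]; ring
  -- `Y` starts on or above the line and ends below it, so its chord is flatter than `α`. Hence the
  -- initial line respects the lower cap `Y.rho`, which the new arc keeps.
  have hrho : Y.rho < α := by
    have e1 := Y.chord_mul
    have e2 := mul_le_mul_of_nonneg_right hY.tight.1 (sub_nonneg.mpr hYlt.le)
    rw [hxy] at hXb
    rw [hxy] at hFxy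
    by_contra h
    push Not at h
    have e3 := mul_le_mul_of_nonneg_right h (sub_nonneg.mpr hYlt.le)
    linarith
  have hS : SlopesIn F X.a Y.b Y.rho α := by
    refine hC.slopesIn (fun x _ _ => ?_) (fun x h1 h2 => ?_)
    · rw [hXa]
      exact clipped_le
    · rw [hYb']
      by_cases h : x < Y.a
      · have e1 : Y.G Y.a ≤ Y.F Y.b + Y.rho * (Y.a - Y.b) :=
          (min_le_right _ _).trans (min_le_right _ _)
        rw [Arc.G_a hY.tight, ← hFxy] at e1
        rw [hxy] at hXb
        rw [hxy] at e1
        have e2 : F x = X.F X.a + α * (x - X.a) := if_pos h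
        rw [e2]
        have e3 := mul_le_mul_of_nonneg_right hrho.le (sub_nonneg.mpr h.le)
        linarith
      · have e2 : F x = min (Y.G x) _ := if_neg h
        rw [e2]
        exact (min_le_left _ _).trans ((min_le_right _ _).trans (min_le_right _ _))
  set Z := chainArc F X.a Y.b α Y.rho c hlt hC with hZ
  have hZG : ∀ x, X.a ≤ x → x ≤ Y.b → Z.G x = F x := fun x => chainArc_G hS
  refine ⟨fun k => if (k : ℝ) ≤ Y.b then F k else f k, ?_, ?_, ?_⟩
  · refine hW.congr ?_ (fun t h1 h2 => ?_) (fun t h1 h2 => ?_)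
    · simp only [← hm]
      rw [if_pos hlt.le, ← hfa, hXa]
    · have h1' : X.a ≤ t := by rw [hm]; exact_mod_cast h1
      split_ifs with h
      · rw [← hfa, ← hm]
        by_cases h3 : (t : ℝ) < Y.a
        · have e2 : F t = X.F X.a + α * (t - X.a) := if_pos h3
          rw [e2]; exact min_le_right _ _
        · have e2 : F t = min (Y.G t) _ := if_neg h3
          rw [e2, hY.val t (not_lt.mp h3) h]
      · exact min_le_left _ _
    · have h1' : X.a ≤ t := by rw [hm]; exact_mod_cast h1
      split_ifs with h
      · rw [← hfa, ← hm]
        by_cases h3 : (t : ℝ) < Y.a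
        · exact .inr (hX.above (by simp) hXb h1' (by rw [hxy]; exact h3.le))
        · have e2 : F t = min (Y.G t) _ := if_neg h3
          rw [e2, hY.val t (not_lt.mp h3) h]
          rcases le_total (f t) (X.F X.a + α * (t - X.a)) with h4 | h4
          · exact .inl (min_eq_left h4)
          · exact .inr h4
      · exact .inl rfl
  · refine ⟨chainArc_tight hS, ⟨m, hm⟩, ⟨n, hn⟩, fun k h1 h2 => ?_⟩
    rw [if_pos (show (k : ℝ) ≤ Y.b from h2), hZG k h1 h2]
  · intro k hk
    simp only
    split_ifs with h
    · have : (k : ℝ) = n := by rw [← hn]; exact le_antisymm h hk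
      have : k = n := by exact_mod_cast this
      subst this
      rw [← hn, hYb']
      exact hY.fb hn
    · rfl

/-- The arc lies above the line through its left end, so the minimum is always attained at the left
end. -/
theorem wave_last {X : Arc} {f f' : ℤ → ℝ} {m j : ℤ} {α : ℝ} (hX : X.Mod f)
    (hm : X.a = m) (hj : X.b = j) (hα : α < X.chord) (hW : IsWave m α f f' j) :
    (segArc X.a (X.F X.a) X.b (X.F X.a + α * (X.b - X.a)) X.lt).Mod f' := by
  have hfa := hX.fa hm
  have hXlt := X.lt
  have hXb : X.F X.a + α * (X.b - X.a) ≤ X.F X.b := by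
    have := X.chord_mul
    have := mul_le_mul_of_nonneg_right hα.le (sub_nonneg.mpr hXlt.le)
    linarith
  refine ⟨segArc_tight _ _ _ _ _, ⟨m, hm⟩, ⟨j, hj⟩, fun k h1 h2 => ?_⟩
  replace h1 : X.a ≤ k := h1
  replace h2 : (k : ℝ) ≤ X.b := h2
  rw [segArc_G, segArc_eq X.lt (by ring) rfl]
  have hmk : m ≤ k := by rw [hm] at h1; exact_mod_cast h1
  obtain ⟨h3, t, h4, h5, h6⟩ := hW k hmk (by rw [hj] at h2; exact_mod_cast h2)
  have e1 := h3 m le_rfl hmk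
  have h5' : (t : ℝ) ≤ k := by exact_mod_cast h5
  have e2 := hX.above (by simp) hXb (k := t) (by rw [hm]; exact_mod_cast h4) (by linarith)
  rw [hfa, hm] at *
  linarith

/-- Passing the lower cap of the root as `r` makes the lower part of the cap idle. -/
theorem OTree.capHi {v : Val} {As : List Arc} (h : OTree v As) (α : ℝ) :
    Calls program fCapHi (.cell v (.num α)) fun w s => ∃ r,
      OTree w (As.map (Arc.cap α r)) ∧ (∀ A ∈ As, r ≤ A.rho) ∧ s ≤ 250 := by
  rcases h with ⟨rfl, rfl⟩ | ⟨H, h⟩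
  · refine Calls.of_sem capHiBody rfl ?_
    conv => whnf
    exact ⟨0, .nil', by simp, by omega⟩
  · have hF := h.hdr_for
    obtain ⟨b, rfl, h⟩ := h
    refine Calls.of_sem capHiBody rfl ?_
    conv => whnf
    refine (h.cap α H.rho).mono ?_
    rintro u s ⟨hu, hs⟩
    exact ⟨H.rho, hu.o, fun A hA => (hF.caps A hA).2, by omega⟩

set_option maxHeartbeats 1000000 in
-- The target `f'` stays fixed while the current values change from `f` to `g`: the invariant is
-- that `f'` is the wave of the current values. The cost inequality is amortized: every round beyond
-- the final one removes an arc, which pays `160000 * ht N ^ 2`.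
theorem wave_spec {i j : ℤ} {α y z : ℝ} {f' : ℤ → ℝ} {N : ℕ} (n : ℕ) {f : ℤ → ℝ} {As : List Arc}
    {v : Val} (hv : OTree v As) (hp : Path i y As j z) (hm : ∀ A ∈ As, A.Mod f) (hne : As ≠ [])
    (hW : IsWave i α f f' j) (hN : pot As ≤ N) (hn : As.length ≤ n) :
    Calls program fWave (.cell v (.num α)) fun w s => ∃ As' z', OTree w As' ∧ As' ≠ [] ∧
      Path i y As' j z' ∧ (∀ A ∈ As', A.Mod f') ∧ pot As' ≤ pot As ∧
      s + 160000 * ht N ^ 2 * As'.length ≤ 160000 * ht N ^ 2 * (As.length + 1) := by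
  have h3 : 3 ≤ ht N := by unfold ht; omega
  have h9 : 3 * ht N ≤ ht N ^ 2 := by nlinarith
  induction n generalizing f As v i y with
  | zero => exact absurd (List.length_eq_zero_iff.mp (by omega)) hne
  | succ n ih =>
    obtain ⟨H, hv⟩ := hv.tree hne
    have hF := hv.hdr_for
    have hv' := hv
    obtain ⟨b, rfl, -⟩ := hv
    have hlenpot := length_le_pot As
    refine Calls.of_sem waveBody rfl ?_
    conv => whnf
    refine ⟨fun hα => ?_, fun hα => ?_⟩
    swap
    · replace hα : ¬ α < H.hi := hα
      conv => whnf
      refine (hv'.o.capHi α).mono ?_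
      rintro w s ⟨r, hw, hr, hs⟩
      refine ⟨_, z, hw, by simpa using hne, path_map_cap.mpr hp,
        (wave_prefix hW hp le_rfl hm ((hF.hi α).mp (not_lt.mp hα)) hr).1, by simp, ?_⟩
      simp only [List.length_map, Nat.mul_add]
      omega
    replace hα : α < H.hi := hα
    conv => whnf
    -- The test is that the largest chord slope is at most `α`, so the first arc after the prefix is
    -- the first steep one.
    refine (hv'.o.split (N := N) ((0 : ℤ) : ℝ) ((0 : ℤ) : ℝ) ((1 : ℤ) : ℝ) α
      (.inr (by simp)) (by simp) (by omega)).mono ?_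
    rintro _ s1 ⟨L, R, Ls, Rs, rfl, hL, hR, rfl, k1, k2, hs1⟩
    have hLc : ∀ A ∈ Ls, A.chord ≤ α := by
      rcases hL with ⟨-, rfl⟩ | ⟨HL, hL⟩
      · simp
      · have := k1 _ hL.hdr_for
        rw [← hL.hdr_for.hi]
        unfold Passes at this
        push_cast at this
        linarith
    rcases Rs with _ | ⟨X, Rs⟩
    · simp only [List.append_nil] at hF
      exact absurd ((hF.hi α).mpr hLc) (not_le.mpr hα)
    have hXc : α < X.chord := by
      have := k2 X Rs rfl
      unfold Passes at this
      simp only [Arc.hdr] at this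
      push_cast at this
      linarith
    obtain ⟨m', u, hpL, ⟨rfl, rfl⟩, hpR⟩ := path_append.mp hp
    have hX := hm X (by simp)
    obtain ⟨m, hXa⟩ := hX.ia
    have hXlt := X.lt
    have hmj : m ≤ j := by
      have := hpR.le
      rw [hXa] at hXlt
      have : (m : ℝ) ≤ j := by linarith
      exact_mod_cast this
    have hlp := length_le_pot Ls
    have hrp := length_le_pot Rs
    rw [List.length_append, List.length_cons] at *
    simp only [pot_append, pot_cons] at hN ⊢
    conv => whnf
    refine (hL.capHi α).mono ?_
    rintro L' s2 ⟨r, hL', hr, hs2⟩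
    obtain ⟨hLm, hWm⟩ := wave_prefix hW (hXa ▸ hpL) hmj (fun A hA => hm A (by simp [hA])) hLc hr
    have hpL' := path_map_cap (l := α) (r := r).mpr hpL
    conv => whnf
    refine (hR.uncons (N := N) (by simp; omega)).mono ?_
    rintro _ s3 ⟨x, R1, rfl, hx, hR1, hs3⟩
    obtain ⟨bx, rfl, -⟩ := id hx
    rcases hR1 with ⟨rfl, rfl⟩ | ⟨HR1, hR1⟩
    · obtain ⟨hXj, rfl⟩ := hpR
      conv => whnf
      refine (seg_spec X.a (X.F X.a) X.b (X.F X.a + α * (X.b - X.a)) X.lt).mono ?_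
      rintro t s4 ⟨ht, hs4⟩
      set S := segArc X.a (X.F X.a) X.b (X.F X.a + α * (X.b - X.a)) X.lt with hS
      have hpath : Path i y (Ls.map (Arc.cap α r) ++ [S]) j (X.F X.a + α * (X.b - X.a)) :=
        path_append.mpr ⟨_, _, hpL', ⟨rfl, (segArc_a _ _ _ _ _).symm⟩, hXj, segArc_b _ _ _ _ _⟩
      conv => whnf
      refine (hL'.join ht.o ⟨_, _, _, _, hpath⟩ (N := N) (by simp; omega)).mono ?_
      rintro w s5 ⟨hw, hs5⟩
      refine ⟨_, _, hw, by simp, hpath, ?_, by simp [hS, segArc], ?_⟩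
      · intro A hA
        rcases List.mem_append.mp hA with hA | hA
        · exact hLm A hA
        · rw [List.mem_singleton.mp hA]
          exact wave_last hX hXa hXj hXc hWm
      · simp only [List.length_append, List.length_map, List.length_singleton, List.length_nil,
          Nat.mul_add]
        omega
    rcases Rs with _ | ⟨Y, Rs⟩
    · exact absurd rfl hR1.hdr_for.ne
    obtain ⟨⟨hxy, hFxy⟩, hpR⟩ := hpR
    have hY := hm Y (by simp)
    have hYlt := Y.lt
    have hlt : X.a < Y.b := by linarith
    have hXb : X.F X.a + α * (X.b - X.a) ≤ X.F X.b := by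
      have := X.chord_mul
      have := mul_le_mul_of_nonneg_right hXc.le (sub_nonneg.mpr hXlt.le)
      linarith
    simp only [pot_cons, List.length_cons] at hN hrp hn ⊢
    obtain ⟨b1, rfl, -⟩ := id hR1
    conv => whnf
    refine (hR1.o.uncons (N := N) (by simp; omega)).mono ?_
    rintro _ s4 ⟨yv, R2, rfl, hy, hR2, hs4⟩
    obtain ⟨_, rfl, -⟩ := id hy
    conv => whnf
    -- The common end of both merges: `Z` replaces `X` and `Y`, the wave continues from `m`, and the
    -- capped prefix is put in front. `Z` may have four segments more than `Y`, which the five units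
    -- of potential of the lost arc cover.
    have finish : ∀ (Z : Arc) (zt : Val) (g : ℤ → ℝ) (s : ℕ), Tree zt Z.hdr [Z] →
        Z.a = X.a → Z.F Z.a = X.F X.a → Z.b = Y.b → Z.F Z.b = Y.F Y.b → Z.len ≤ Y.len + 4 →
        IsWave m α g f' j → Z.Mod g → (∀ k : ℤ, Y.b ≤ k → g k = f k) →
        s ≤ 140000 * ht N ^ 2 → Calls program fJoin (zt.cell R2) fun w s' =>
          Calls program fWave (.cell w (.num α)) fun w' s'' =>
          Calls program fJoin (.cell L' w') fun w s5 => ∃ As' z', OTree w As' ∧ As' ≠ [] ∧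
            Path i y As' j z' ∧ (∀ A ∈ As', A.Mod f') ∧
            pot As' ≤ pot Ls + (X.len + 5 + (Y.len + 5 + pot Rs)) ∧
            s + s' + s'' + s5 + 1000 + 160000 * ht N ^ 2 * As'.length ≤
              160000 * ht N ^ 2 * (Ls.length + (Rs.length + 1 + 1) + 1) := by
      intro Z zt g s hz ha hFa hb hFb hlen hWg hZ hg hs
      have hpZ : Path m (X.F X.a) ([Z] ++ Rs) j z :=
        ⟨⟨by rw [ha, hXa], hFa.symm⟩, by rw [hFb, hb]; exact hpR⟩
      refine (hz.o.join hR2 ⟨_, _, _, _, hpZ⟩ (N := N) (by simp; omega)).mono ?_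
      rintro w s5 ⟨hw, hs5⟩
      refine (ih (As := [Z] ++ Rs) hw hpZ ?_ (by simp) hWg (by simp; omega)
        (by simp; omega)).mono ?_
      · intro A hA
        rcases List.mem_append.mp hA with hA | hA
        · rwa [List.mem_singleton.mp hA]
        · have hA' := hm A (by simp [hA])
          refine ⟨hA'.tight, hA'.ia, hA'.ib, fun k h1 h2 => ?_⟩
          rw [hg k ((hpR.mem hA).1.trans h1)]
          exact hA'.val k h1 h2
      rintro w' s6 ⟨As', z', hw', hne', hp', hm', hpot', hs6⟩
      have hpath : Path i y (Ls.map (Arc.cap α r) ++ As') j z' :=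
        path_append.mpr ⟨_, _, hpL', hXa ▸ hp'⟩
      have h5 := length_le_pot As'
      simp only [List.singleton_append, pot_cons, List.length_cons] at hpot' hs6
      refine (hL'.join hw' ⟨_, _, _, _, hpath⟩ (N := N) (by simp; omega)).mono ?_
      rintro w'' s7 ⟨hw'', hs7⟩
      refine ⟨_, _, hw'', by simp [hne'], hpath, ?_, by simp; omega, ?_⟩
      · intro A hA
        rcases List.mem_append.mp hA with hA | hA
        · exact hLm A hA
        · exact hm' A hA
      · simp only [List.length_append, List.length_map, Nat.mul_add] at hs6 ⊢
        omega
    refine ⟨fun hlt' => ?_, fun hlt' => ?_⟩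
    · replace hlt' : Y.F Y.b < X.F X.a + α * (Y.b - X.a) := hlt'
      conv => whnf
      refine (mat_spec (N := N) hy hY.tight (by omega)).mono ?_
      rintro mt s5 ⟨Ms, hmt, hMc, hMl, hs5⟩
      have hcl : X.F X.a + α * (Y.a - X.a) ≤ Y.G Y.a := by
        rw [Arc.G_a hY.tight, ← hFxy, ← hxy]; exact hXb
      conv => whnf
      refine (clip_spec (N := N) hYlt Y.G_conc (by linarith) hcl hmt hMc (by omega)).mono ?_
      rintro ct s6 ⟨Ts, hct, hTc, hTl, hs6⟩
      have hC := clipped_conc (x0 := X.a) Y.G_conc hcl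
      obtain ⟨g, hWg, hZ, hg⟩ := merge_arc hX hY hXa hxy hFxy hlt hXc hlt' hWm hC (Ts.length - 1)
      conv => whnf
      refine (arc_spec α Y.rho hlt hC hct hTc).mono ?_
      rintro zt s7 ⟨hz, hs7⟩
      conv => whnf
      refine (finish _ zt g (s1 + s2 + s3 + s4 + s5 + s6 + s7 + 1000) hz rfl ?_ rfl ?_ ?_ hWg hZ hg
        (by omega)).mono ?_
      · change clipped _ _ _ _ _ X.a = _
        rw [clipped_of_le (fun h => by linarith)]; ring
      · change clipped _ _ _ _ _ Y.b = _
        rw [clipped_of_ge hYlt.le (by rw [Arc.G_b hY.tight]; exact hlt'.le), Arc.G_b hY.tight]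
      · simp only [chainArc]; omega
      intro w s8 h
      conv => whnf
      refine h.mono ?_
      intro w' s9 h
      conv => whnf
      refine h.mono ?_
      rintro w'' s10 ⟨As', z', h1, h2, h3, h4, h5, h6⟩
      exact ⟨As', z', h1, h2, h3, h4, h5, by omega⟩
    · replace hlt' : ¬ Y.F Y.b < X.F X.a + α * (Y.b - X.a) := hlt'
      obtain ⟨g, hWg, hZ, hg⟩ := merge_seg hX hY hXa hxy hFxy hlt hXc (not_lt.mp hlt') hWm
      conv => whnf
      refine (seg_spec X.a (X.F X.a) Y.b (Y.F Y.b) hlt).mono ?_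
      rintro zt s7 ⟨hz, hs7⟩
      conv => whnf
      refine (finish _ zt g (s1 + s2 + s3 + s4 + s7 + 1000) hz rfl (segArc_a _ _ _ _ _) rfl
        (segArc_b _ _ _ _ _) (by simp [segArc]) hWg hZ hg (by omega)).mono ?_
      intro w s8 h
      conv => whnf
      refine h.mono ?_
      intro w' s9 h
      conv => whnf
      refine h.mono ?_
      rintro w'' s10 ⟨As', z', h1, h2, h3, h4, h5, h6⟩
      exact ⟨As', z', h1, h2, h3, h4, h5, by omega⟩

/-! ## Trees for functions on a range of integers -/

/-- The tree `v` with the arcs `As` stands for the values of `f` on the range from `p` to `q`. -/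
structure Sound (f : ℤ → ℝ) (p q : ℤ) (v : Val) (As : List Arc) : Prop where
  tree : OTree v As
  path : Path p (f p) As q (f q)
  mod : ∀ A ∈ As, A.Mod f

theorem Arc.Mod.congr {f g : ℤ → ℝ} {A : Arc} (h : A.Mod f)
    (hg : ∀ k : ℤ, A.a ≤ k → (k : ℝ) ≤ A.b → g k = f k) : A.Mod g :=
  ⟨h.tight, h.ia, h.ib, fun k h1 h2 => (h.val k h1 h2).trans (hg k h1 h2).symm⟩

theorem Sound.le {f : ℤ → ℝ} {p q : ℤ} {v : Val} {As : List Arc} (h : Sound f p q v As) :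
    p ≤ q := by
  exact_mod_cast h.path.le

theorem Sound.ne_nil {f : ℤ → ℝ} {p q : ℤ} {v : Val} {As : List Arc} (h : Sound f p q v As)
    (hpq : p < q) : As ≠ [] := by
  rintro rfl
  have : p = q := by exact_mod_cast h.path.1
  omega

theorem Sound.congr {f g : ℤ → ℝ} {p q : ℤ} {v : Val} {As : List Arc} (h : Sound f p q v As)
    (hg : ∀ k, p ≤ k → k ≤ q → g k = f k) : Sound g p q v As := by
  refine ⟨h.tree, ?_, fun A hA => (h.mod A hA).congr fun k h1 h2 => hg k ?_ ?_⟩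
  · rw [hg p le_rfl h.le, hg q h.le le_rfl]; exact h.path
  · exact_mod_cast (h.path.mem hA).1.trans h1
  · exact_mod_cast h2.trans (h.path.mem hA).2

/-- The end points of a tree can be read off at its root. -/
theorem Sound.root {f : ℤ → ℝ} {p q : ℤ} {v : Val} {As : List Arc} (h : Sound f p q v As)
    (hpq : p < q) : ∃ x b, v = .cell (.cell (.cell (.cell (.num p) (.num (f p)))
      (.cell (.num q) (.num (f q)))) x) b := by
  obtain ⟨H, hv⟩ := h.tree.tree (h.ne_nil hpq)
  have hF := hv.hdr_for
  obtain ⟨b, rfl, -⟩ := hv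
  obtain ⟨h1, h2⟩ := hF.path.start h.path hF.ne
  obtain ⟨h3, h4⟩ := hF.path.unique (h1 ▸ h2 ▸ h.path)
  rw [← h1, ← h2, ← h3, ← h4]
  exact ⟨_, b, rfl⟩

theorem Sound.join {f : ℤ → ℝ} {p m q : ℤ} {v w : Val} {As Bs : List Arc} {N : ℕ}
    (hv : Sound f p m v As) (hw : Sound f m q w Bs) (hN : (As ++ Bs).length ≤ N) :
    Calls program fJoin (.cell v w) fun u s =>
      Sound f p q u (As ++ Bs) ∧ s ≤ 8000 * ht N := by
  have hp := path_append.mpr ⟨_, _, hv.path, hw.path⟩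
  refine (hv.tree.join hw.tree ⟨_, _, _, _, hp⟩ hN).mono ?_
  rintro u s ⟨hu, hs⟩
  refine ⟨⟨hu, hp, fun A hA => ?_⟩, hs⟩
  rcases List.mem_append.mp hA with hA | hA
  · exact hv.mod A hA
  · exact hw.mod A hA

/-- A segment between two neighbouring positions. -/
theorem Sound.seg {f : ℤ → ℝ} {p q : ℤ} (hpq : q = p + 1) {x y x' y' : ℝ} (hx : x = p)
    (hy : y = f p) (hx' : x' = q) (hy' : y' = f q) :
    Calls program fSeg (.cell (.cell (.num x) (.num y)) (.cell (.num x') (.num y')))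
      fun w s => ∃ A, A.len = 0 ∧ Sound f p q w [A] ∧ s ≤ 100 := by
  subst hx hy hx' hy'
  have hlt : (p : ℝ) < q := by exact_mod_cast (by omega : p < q)
  refine (seg_spec p (f p) q (f q) hlt).mono ?_
  rintro w s ⟨hw, hs⟩
  refine ⟨_, rfl, ⟨hw.o, ⟨⟨rfl, (segArc_a _ _ _ _ _).symm⟩, rfl, segArc_b _ _ _ _ _⟩, ?_⟩, hs⟩
  intro A hA
  obtain rfl := List.mem_singleton.mp hA
  refine ⟨segArc_tight _ _ _ _ _, ⟨p, rfl⟩, ⟨q, rfl⟩, fun k h1 h2 => ?_⟩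
  have h3 : p ≤ k := (Int.cast_le (R := ℝ)).mp h1
  have h4 : k ≤ q := (Int.cast_le (R := ℝ)).mp h2
  rw [segArc_G]
  obtain rfl | rfl : k = p ∨ k = q := by omega
  · exact segArc_a _ _ _ _ _
  · exact segArc_b _ _ _ _ _

theorem Sound.flip {f : ℤ → ℝ} {p q : ℤ} {v : Val} {As : List Arc} (h : Sound f p q v As) :
    Calls program fApp (.cell v (.cell (.num ((-1 : ℤ) : ℝ))
      (.cell (.num ((0 : ℤ) : ℝ)) (.num ((0 : ℤ) : ℝ))))) fun w s =>
      Sound (fun k => f (-k)) (-q) (-p) w (appL Tag.flip As) ∧ s ≤ 500 := by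
  rw [flipTag_enc]
  refine (h.tree.app Tag.flip).mono fun w s hw => ⟨⟨hw.1, ?_, fun A hA => ?_⟩, hw.2⟩
  · have := h.path.app Tag.flip
    simpa [Tag.flip] using this
  · obtain ⟨B, hB, rfl⟩ := mem_appL.mp hA
    have hB := h.mod B hB
    obtain ⟨m, hm⟩ := hB.ia
    obtain ⟨n, hn⟩ := hB.ib
    refine ⟨hB.tight.app _, ⟨-n, by simp [Arc.app, Tag.flip, hn]⟩,
      ⟨-m, by simp [Arc.app, Tag.flip, hm]⟩, fun k h1 h2 => ?_⟩
    simp only [Arc.app, Tag.flip, if_true] at h1 h2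
    have := hB.val (-k) (by push_cast; linarith) (by push_cast; linarith)
    rw [Arc.app_G, ← this]
    simp [Tag.flip]

theorem Sound.addLin {f : ℤ → ℝ} {p q : ℤ} {v : Val} {As : List Arc} (h : Sound f p q v As)
    (c g : ℝ) :
    Calls program fApp (.cell v (.cell (.num ((1 : ℤ) : ℝ)) (.cell (.num c) (.num g))))
      fun w s => Sound (fun k => f k + (c + g * k)) p q w (appL ⟨false, c, g⟩ As) ∧ s ≤ 500 := by
  have e : Val.cell (.num ((1 : ℤ) : ℝ)) (.cell (.num c) (.num g)) = Tag.enc ⟨false, c, g⟩ := by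
    simp [Tag.enc]
  rw [e]
  refine (h.tree.app _).mono fun w s hw => ⟨⟨hw.1, ?_, fun A hA => ?_⟩, hw.2⟩
  · have := h.path.app ⟨false, c, g⟩
    simpa using this
  · obtain ⟨B, hB, rfl⟩ := mem_appL.mp hA
    have hB := h.mod B hB
    refine ⟨hB.tight.app _, hB.ia, hB.ib, fun k h1 h2 => ?_⟩
    simp only [Arc.app, Bool.false_eq_true, if_false] at h1 h2
    rw [Arc.app_G, ← hB.val k h1 h2]
    simp

/-- There is just one arc between neighbouring positions. -/
theorem Sound.length_le {f : ℤ → ℝ} {p q : ℤ} {v : Val} {As : List Arc} (h : Sound f p q v As)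
    (hpq : q = p + 1) : ∃ A, As = [A] := by
  rcases As with _ | ⟨A, _ | ⟨B, As⟩⟩
  · exact absurd rfl (h.ne_nil (by omega))
  · exact ⟨A, rfl⟩
  · obtain ⟨m, hm⟩ := (h.mod A (by simp)).ib
    have h1 : (p : ℝ) < m := by rw [← hm, h.path.1.1]; exact A.lt
    have h2 : (m : ℝ) < q := by rw [← hm]; exact h.path.2.lt (by simp)
    norm_cast at h1 h2
    omega

/-- A cut may add one arc, worth five units, and four segments; hence the 9. -/
theorem Sound.splitAt {f : ℤ → ℝ} {p q : ℤ} {v : Val} {As : List Arc} (h : Sound f p q v As)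
    {k : ℤ} {x : ℝ} (hx : x = k) (hpk : p ≤ k) (hkq : k ≤ q) {N : ℕ} (hN : pot As + 1 ≤ N) :
    Calls program fSplitAt (.cell v (.num x)) fun w s => ∃ l r Ls Rs, w = .cell l r ∧
      Sound f p k l Ls ∧ Sound f k q r Rs ∧ pot Ls + pot Rs ≤ pot As + 9 ∧
      Ls.length + Rs.length ≤ As.length + 1 ∧ s ≤ 150000 * ht N ^ 2 := by
  subst hx
  have hlp := length_le_pot As
  refine (splitAt_spec (N := N) h.tree h.path (k := k) (by exact_mod_cast hpk)
    (by exact_mod_cast hkq) (by omega) fun A hA => ⟨(h.mod A hA).tight, ?_⟩).mono ?_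
  · have := len_le_pot hA
    omega
  rintro w s ⟨l, r, Ls, Rs, rfl, hl, hr, hcut, hs⟩
  obtain ⟨u, hp1, hp2⟩ := hcut.path (fun X X₁ X₂ h => h.toEnds) h.path
  have hmod : (∀ A ∈ Ls, A.Mod f) ∧ (∀ A ∈ Rs, A.Mod f) ∧ pot Ls + pot Rs ≤ pot As + 9 ∧
      Ls.length + Rs.length ≤ As.length + 1 := by
    have hm := h.mod
    rcases hcut with ⟨rfl, -⟩ | ⟨Ls', X, Rs', X₁, X₂, rfl, rfl, rfl, e⟩
    · exact ⟨fun A hA => hm A (by simp [hA]), fun A hA => hm A (by simp [hA]), by simp, by simp⟩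
    · have hX := hm X (by simp)
      have h1 : X.a ≤ k := by rw [← e.a₁, ← e.b₁]; exact X₁.lt.le
      have h2 : k ≤ X.b := by rw [← e.a₂, ← e.b₂]; exact X₂.lt.le
      refine ⟨fun A hA => ?_, fun A hA => ?_, ?_, by simp; omega⟩
      · rcases List.mem_append.mp hA with hA | hA
        · exact hm A (by simp [hA])
        · obtain rfl := List.mem_singleton.mp hA
          refine ⟨e.t₁, e.a₁ ▸ hX.ia, ⟨k, e.b₁⟩, fun m h3 h4 => ?_⟩
          rw [e.a₁] at h3
          rw [e.b₁] at h4
          rw [e.g₁ m h3 h4, hX.val m h3 (h4.trans h2)]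
      · rcases List.mem_cons.mp hA with rfl | hA
        · refine ⟨e.t₂, ⟨k, e.a₂⟩, e.b₂ ▸ hX.ib, fun m h3 h4 => ?_⟩
          rw [e.a₂] at h3
          rw [e.b₂] at h4
          rw [e.g₂ m h3 h4, hX.val m (h1.trans h3) h4]
        · exact hm A (by simp [hA])
      · have := e.len
        simp only [pot_append, pot_cons, pot_nil]
        omega
  obtain ⟨hm1, hm2, hpot, hlen⟩ := hmod
  have hu : u = f k := by
    by_cases h1 : Ls = []
    · subst h1
      obtain ⟨h3, rfl⟩ := hp1
      have : p = k := by exact_mod_cast h3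
      rw [this]
    · exact hp1.end_val hm1 h1 rfl
  subst hu
  exact ⟨l, r, Ls, Rs, rfl, ⟨hl, hp1, hm1⟩, ⟨hr, hp2, hm2⟩, hpot, hlen, hs⟩

theorem IsWave.first {i j : ℤ} {α : ℝ} {f f' : ℤ → ℝ} (h : IsWave i α f f' j) (hij : i ≤ j) :
    f' i = f i := by
  obtain ⟨-, t, h1, h2, h3⟩ := h i le_rfl hij
  obtain rfl : t = i := by omega
  simpa using h3

/-- The wave keeps the value at `i` but may change the one at `j`. So only the gap from `j` to `j +
1` needs a new segment, and the wave is run on the tree between `i` and `j`. For `j ≤ i` nothing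
changes. -/
theorem leftWave_spec {f f' : ℤ → ℝ} {p q i j : ℤ} {α xi xj : ℝ} {v : Val} {As : List Arc} {N : ℕ}
    (h : Sound f p q v As) (hi : xi = i) (hj : xj = j) (hpi : p ≤ i) (hjq : j + 1 ≤ q)
    (hW : IsWave i α f f' j) (ho : ∀ k, k < i ∨ j < k → f' k = f k) (hN : pot As + 40 ≤ N) :
    Calls program fLeftWave (.cell v (.cell (.num xi) (.cell (.num xj) (.num α)))) fun w s =>
      ∃ As', Sound f' p q w As' ∧ pot As' ≤ pot As + 40 ∧
        s + 160000 * ht N ^ 2 * As'.length ≤ 160000 * ht N ^ 2 * (As.length + 20) := by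
  have h3 : 3 ≤ ht N := by unfold ht; omega
  have h9 : 3 * ht N ≤ ht N ^ 2 := by nlinarith
  subst hi hj
  refine Calls.of_sem leftWaveBody rfl ?_
  conv => whnf
  refine ⟨fun hij => ?_, fun hij => ?_⟩
  swap
  · replace hij : ¬ (i : ℝ) < j := hij
    have hij : j ≤ i := by exact_mod_cast not_lt.mp hij
    conv => whnf
    refine ⟨As, h.congr fun k _ _ => ?_, by omega, by rw [Nat.mul_add]; omega⟩
    by_cases hk : k < i ∨ j < k
    · exact ho k hk
    · obtain rfl : k = i := by omega
      exact hW.first (by omega)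
  replace hij : (i : ℝ) < j := hij
  have hij : i < j := by exact_mod_cast hij
  conv => whnf
  refine (h.splitAt (k := i) rfl hpi (by omega) (N := N) (by omega)).mono ?_
  rintro _ s1 ⟨v1, r1, A1, B1, rfl, hv1, hr1, hp1, hl1, hs1⟩
  conv => whnf
  refine (hr1.splitAt (k := j) rfl hij.le (by omega) (N := N) (by omega)).mono ?_
  rintro _ s2 ⟨v2, r2, A2, B2, rfl, hv2, hr2, hp2, hl2, hs2⟩
  conv => whnf
  refine (hr2.splitAt (k := j + 1) (by push_cast; rfl) (by omega) hjq (N := N) (by omega)).mono ?_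
  rintro _ s3 ⟨v3, r3, A3, B3, rfl, hv3, hr3, hp3, hl3, hs3⟩
  conv => whnf
  have hne := hv2.ne_nil hij
  refine (wave_spec (N := N) A2.length hv2.tree hv2.path hv2.mod hne hW (by omega) le_rfl).mono ?_
  rintro m s4 ⟨M, z, hm, hMne, hMp, hMm, hMpot, hs4⟩
  obtain rfl : z = f' j := hMp.end_val hMm hMne rfl
  have hM : Sound f' i j m M := by
    refine ⟨hm, ?_, hMm⟩
    rw [hW.first hij.le]
    exact hMp
  have g1 : Sound f' p i v1 A1 := hv1.congr fun k _ hk => by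
    rcases eq_or_lt_of_le hk with rfl | hk
    · exact hW.first hij.le
    · exact ho k (.inl hk)
  have g3 : Sound f' (j + 1) q r3 B3 := hr3.congr fun k hk _ => ho k (.inr (by omega))
  obtain ⟨x, b, rfl⟩ := hM.root hij
  obtain ⟨x', b', rfl⟩ := hv3.root (by omega)
  obtain ⟨U, rfl⟩ := hv3.length_le rfl
  conv => whnf
  refine (Sound.seg (f := f') (p := j) (q := j + 1) rfl rfl rfl rfl
    (ho _ (.inr (by omega))).symm).mono ?_
  rintro S s5 ⟨T, hT, hS, hs5⟩
  have p1 := length_le_pot A1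
  have p2 := length_le_pot M
  have p3 := length_le_pot B3
  simp only [pot_cons, pot_nil, List.length_cons, List.length_nil] at hp3 hl3
  conv => whnf
  refine (hS.join g3 (N := N) (by simp; omega)).mono ?_
  rintro w1 s6 ⟨hw1, hs6⟩
  refine (hM.join hw1 (N := N) (by simp; omega)).mono ?_
  rintro w2 s7 ⟨hw2, hs7⟩
  refine (g1.join hw2 (N := N) (by simp; omega)).mono ?_
  rintro w3 s8 ⟨hw3, hs8⟩
  refine ⟨_, hw3, by simp [hT]; omega, ?_⟩
  have key : 160000 * ht N ^ 2 * (A1.length + A2.length + B3.length) ≤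
    160000 * ht N ^ 2 * (As.length + 3) := Nat.mul_le_mul_left _ (by omega)
  simp only [List.length_append, List.length_cons, List.length_nil, Nat.mul_add] at hs4 key ⊢
  omega

/-- The added values may jump at both ends of the range. The two unit gaps contain no positions in
their interior, so they can be filled with segments that carry the jumps. For `i = j` the middle
tree is empty. -/
theorem addLin_spec {f f' : ℤ → ℝ} {p q i j : ℤ} {c g xi xj : ℝ} {v : Val} {As : List Arc} {N : ℕ}
    (h : Sound f p q v As) (hi : xi = i) (hj : xj = j) (hpi : p + 1 ≤ i) (hjq : j + 1 ≤ q)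
    (hW : ∀ k, i ≤ k → k ≤ j → f' k = f k + (c + g * k)) (ho : ∀ k, k < i ∨ j < k → f' k = f k)
    (hN : pot As + 60 ≤ N) :
    Calls program fAddLin (.cell v (.cell (.num xi) (.cell (.num xj) (.cell (.num c) (.num g)))))
      fun w s => ∃ As', Sound f' p q w As' ∧ pot As' ≤ pot As + 60 ∧
        s + 160000 * ht N ^ 2 * As'.length ≤ 160000 * ht N ^ 2 * (As.length + 20) := by
  have h3 : 3 ≤ ht N := by unfold ht; omega
  have h9 : 3 * ht N ≤ ht N ^ 2 := by nlinarith
  subst hi hj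
  refine Calls.of_sem addLinBody rfl ?_
  conv => whnf
  refine ⟨fun hij => ?_, fun hij => ?_⟩
  · replace hij : (j : ℝ) < i := hij
    have hij : j < i := by exact_mod_cast hij
    conv => whnf
    exact ⟨As, h.congr fun k _ _ => ho k (by omega), by omega, by rw [Nat.mul_add]; omega⟩
  replace hij : ¬ (j : ℝ) < i := hij
  have hij : i ≤ j := by exact_mod_cast not_lt.mp hij
  conv => whnf
  refine (h.splitAt (k := i - 1) (by push_cast; rfl) (by omega) (by omega) (N := N)
    (by omega)).mono ?_
  rintro _ s1 ⟨v1, r1, A1, B1, rfl, hv1, hr1, hp1, hl1, hs1⟩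
  conv => whnf
  refine (hr1.splitAt (k := i) rfl (by omega) (by omega) (N := N) (by omega)).mono ?_
  rintro _ s2 ⟨v2, r2, A2, B2, rfl, hv2, hr2, hp2, hl2, hs2⟩
  conv => whnf
  refine (hr2.splitAt (k := j) rfl (by omega) (by omega) (N := N) (by omega)).mono ?_
  rintro _ s3 ⟨v3, r3, A3, B3, rfl, hv3, hr3, hp3, hl3, hs3⟩
  conv => whnf
  refine (hr3.splitAt (k := j + 1) (by push_cast; rfl) (by omega) hjq (N := N) (by omega)).mono ?_
  rintro _ s4 ⟨v4, r4, A4, B4, rfl, hv4, hr4, hp4, hl4, hs4⟩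
  obtain ⟨x2, b2, rfl⟩ := hv2.root (by omega)
  obtain ⟨x4, b4, rfl⟩ := hv4.root (by omega)
  obtain ⟨U, rfl⟩ := hv2.length_le (by omega)
  obtain ⟨W, rfl⟩ := hv4.length_le rfl
  have g1 : Sound f' p (i - 1) v1 A1 := hv1.congr fun k _ hk => ho k (.inl (by omega))
  have g4 : Sound f' (j + 1) q r4 B4 := hr4.congr fun k hk _ => ho k (.inr (by omega))
  conv => whnf
  refine (Sound.seg (f := f') (p := i - 1) (q := i) (by omega) rfl (ho _ (.inl (by omega))).symm
    (by push_cast; ring) (hW i le_rfl hij).symm).mono ?_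
  rintro S s5 ⟨S', hS', hS, hs5⟩
  conv => whnf
  refine (hv3.addLin c g).mono ?_
  rintro M s6 ⟨hM, hs6⟩
  have hM := hM.congr hW
  conv => whnf
  refine (Sound.seg (f := f') (p := j) (q := j + 1) rfl (by push_cast; ring)
    (hW j hij le_rfl).symm rfl (ho _ (.inr (by omega))).symm).mono ?_
  rintro T s7 ⟨T', hT', hT, hs7⟩
  have p1 := length_le_pot A1
  have p2 := length_le_pot A3
  have p3 := length_le_pot B4
  simp only [pot_cons, pot_nil, List.length_cons, List.length_nil] at hp2 hp4 hl2 hl4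
  conv => whnf
  refine (hT.join g4 (N := N) (by simp; omega)).mono ?_
  rintro w1 s8 ⟨hw1, hs8⟩
  refine (hM.join hw1 (N := N) (by simp; omega)).mono ?_
  rintro w2 s9 ⟨hw2, hs9⟩
  refine (hS.join hw2 (N := N) (by simp; omega)).mono ?_
  rintro w3 s10 ⟨hw3, hs10⟩
  refine (g1.join hw3 (N := N) (by simp; omega)).mono ?_
  rintro w4 s11 ⟨hw4, hs11⟩
  refine ⟨_, hw4, by simp [hS', hT']; omega, ?_⟩
  have key : 160000 * ht N ^ 2 * (A1.length + A3.length + B4.length) ≤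
    160000 * ht N ^ 2 * (As.length + 4) := Nat.mul_le_mul_left _ (by omega)
  simp only [List.length_append, List.length_cons, List.length_nil, length_appL, Nat.mul_add]
    at key ⊢
  omega

/-! ## The data structure -/

theorem isWave_of_left {i j : ℕ} {α : ℝ} {A : ℕ → ℝ} {f f' : ℤ → ℝ}
    (hf : ∀ k : ℕ, i ≤ k → k ≤ j → f k = A k)
    (hf' : ∀ k : ℕ, i ≤ k → k ≤ j → f' k = (Op.leftLinearWave i j α).apply A k) :
    IsWave i α f f' j := by
  intro k h1 h2
  lift k to ℕ using by omega
  have h1 : i ≤ k := by omega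
  have h2 : k ≤ j := by omega
  rw [hf' k h1 h2]
  simp only [Op.apply, h1, h2, and_self, dite_true]
  constructor
  · intro t h3 h4
    lift t to ℕ using by omega
    have h3 : i ≤ t := by omega
    have h4 : t ≤ k := by omega
    rw [hf t h3 (by omega)]
    exact Finset.inf'_le _ (Finset.mem_Icc.mpr ⟨h3, h4⟩)
  · obtain ⟨t, ht, e⟩ := Finset.exists_mem_eq_inf' (Finset.nonempty_Icc.mpr h1)
      fun t : ℕ => A t + ((k : ℝ) - t) * α
    obtain ⟨h3, h4⟩ := Finset.mem_Icc.mp ht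
    refine ⟨t, by omega, by omega, ?_⟩
    rw [e, hf t h3 (by omega)]
    rfl

/-- The reflection `k ↦ -k` turns the range into `[-j..-i]` and the right wave into a left wave. -/
theorem isWave_of_right {i j : ℕ} {α : ℝ} {A : ℕ → ℝ} {f f' : ℤ → ℝ}
    (hf : ∀ k : ℕ, i ≤ k → k ≤ j → f k = A k)
    (hf' : ∀ k : ℕ, i ≤ k → k ≤ j → f' k = (Op.rightLinearWave i j α).apply A k) :
    IsWave (-j) α (fun k => f (-k)) (fun k => f' (-k)) (-i) := by
  intro k h1 h2
  obtain ⟨k, rfl⟩ : ∃ m : ℕ, k = -m := ⟨(-k).toNat, by omega⟩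
  have h1 : i ≤ k := by omega
  have h2 : k ≤ j := by omega
  simp only [neg_neg]
  rw [hf' k h1 h2]
  simp only [Op.apply, h1, h2, and_self, dite_true]
  constructor
  · intro t h3 h4
    obtain ⟨t, rfl⟩ : ∃ m : ℕ, t = -m := ⟨(-t).toNat, by omega⟩
    have h3 : t ≤ j := by omega
    have h4 : k ≤ t := by omega
    rw [neg_neg, hf t (by omega) h3]
    refine (Finset.inf'_le _ (Finset.mem_Icc.mpr ⟨h4, h3⟩)).trans (le_of_eq ?_)
    push_cast; ring
  · obtain ⟨t, ht, e⟩ := Finset.exists_mem_eq_inf' (Finset.nonempty_Icc.mpr h2)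
      fun t : ℕ => A t + ((t : ℝ) - k) * α
    obtain ⟨h3, h4⟩ := Finset.mem_Icc.mp ht
    refine ⟨-t, by omega, by omega, ?_⟩
    rw [e, neg_neg, hf t (by omega) h4]
    push_cast; ring

/-- The state `st`, with the arcs `As`, stands for the array `A` of size `n`. -/
def State (n : ℕ) (A : ℕ → ℝ) (st : Val) (As : List Arc) : Prop :=
  ∃ f : ℤ → ℝ, Sound f 0 (n + 1) st As ∧ ∀ k : ℕ, 1 ≤ k → k ≤ n → f k = A k

/-- The values `A` at the positions from `i` to `j`, and the values `f` elsewhere. -/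
noncomputable def patch (i j : ℕ) (A : ℕ → ℝ) (f : ℤ → ℝ) (k : ℤ) : ℝ :=
  if i ≤ k ∧ k ≤ j then A k.toNat else f k

theorem patch_mem {i j k : ℕ} {A : ℕ → ℝ} {f : ℤ → ℝ} (h1 : i ≤ k) (h2 : k ≤ j) :
    patch i j A f k = A k := by
  unfold patch
  rw [if_pos ⟨by omega, by omega⟩, Int.toNat_natCast]

theorem patch_of_not {i j : ℕ} {k : ℤ} {A : ℕ → ℝ} {f : ℤ → ℝ} (h : k < i ∨ j < k) :
    patch i j A f k = f k :=
  if_neg (by omega)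

theorem patch_state {n i j : ℕ} {A A' : ℕ → ℝ} {f : ℤ → ℝ}
    (hf : ∀ k : ℕ, 1 ≤ k → k ≤ n → f k = A k) (ho : ∀ k, ¬ (i ≤ k ∧ k ≤ j) → A' k = A k) (k : ℕ)
    (h1 : 1 ≤ k) (h2 : k ≤ n) : patch i j A' f k = A' k := by
  by_cases h : i ≤ k ∧ k ≤ j
  · exact patch_mem h.1 h.2
  · rw [patch_of_not (by omega), hf k h1 h2, ho k h]

/-- What an operation may cost, and how it may change the arcs. -/
def Cost (N : ℕ) (As As' : List Arc) (s : ℕ) : Prop :=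
  pot As' ≤ pot As + 60 ∧
    s + 160000 * ht N ^ 2 * As'.length ≤ 160000 * ht N ^ 2 * (As.length + 21)

section

variable {n : ℕ} {A : ℕ → ℝ} {st : Val} {As : List Arc} {N i j : ℕ}

theorem addLin_state (h : State n A st As) (hN : pot As + 100 ≤ N) (hi : 1 ≤ i) (hj : j ≤ n)
    {c g : ℝ} {A' : ℕ → ℝ}
    (hA : ∀ k, A' k = if i ≤ k ∧ k ≤ j then A k + (c + g * k) else A k) :
    Calls program fAddLin (.cell st (.cell (.num (i : ℝ)) (.cell (.num (j : ℝ))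
      (.cell (.num c) (.num g))))) fun w s => ∃ As', State n A' w As' ∧ pot As' ≤ pot As + 60 ∧
        s + 160000 * ht N ^ 2 * As'.length ≤ 160000 * ht N ^ 2 * (As.length + 20) := by
  obtain ⟨f, hS, hf⟩ := h
  refine (addLin_spec (i := i) (j := j) (f' := patch i j A' f) (N := N) hS (by simp) (by simp)
    (by omega) (by omega) ?_ (fun k hk => patch_of_not hk) (by omega)).mono ?_
  · intro k h1 h2
    lift k to ℕ using by omega
    have h1 : i ≤ k := by omega
    have h2 : k ≤ j := by omega
    rw [patch_mem h1 h2, hA, if_pos ⟨h1, h2⟩, hf k (by omega) (by omega)]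
    simp
  · rintro w s ⟨As', hw, h1, h2⟩
    exact ⟨As', ⟨_, hw, patch_state hf fun k hk => by rw [hA, if_neg hk]⟩, h1, h2⟩

theorem addConst_state (h : State n A st As) (hN : pot As + 100 ≤ N) (hi : 1 ≤ i) (hj : j ≤ n)
    (c : ℝ) : ∃ st' t As', Eval program [updateInput st i j c] theDataStructure.addConst st' t ∧
      State n ((Op.addConst i j c).apply A) st' As' ∧ Cost N As As' t := by
  have h3 : 3 ≤ ht N := by unfold ht; omega
  have h9 : 9 ≤ ht N ^ 2 := by nlinarith
  have : Sem program theDataStructure.addConst [updateInput st i j c] 0 fun w s => ∃ As',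
      State n ((Op.addConst i j c).apply A) w As' ∧ Cost N As As' s := by
    conv => whnf
    refine (addLin_state h hN hi hj (A' := (Op.addConst i j c).apply A) ?_).mono ?_
    · intro k
      simp [Op.apply]
    · rintro w s ⟨As', hw, h1, h2⟩
      refine ⟨As', hw, h1, ?_⟩
      rw [Nat.mul_add] at h2 ⊢
      omega
  obtain ⟨w, s, h1, As', h2, h4⟩ := this.sound
  exact ⟨w, s, As', h1, h2, by simpa using h4⟩

theorem addGradient_state (h : State n A st As) (hN : pot As + 100 ≤ N) (hi : 1 ≤ i) (hj : j ≤ n)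
    (g : ℝ) : ∃ st' t As', Eval program [updateInput st i j g] theDataStructure.addGradient st' t ∧
      State n ((Op.addGradient i j g).apply A) st' As' ∧ Cost N As As' t := by
  have h3 : 3 ≤ ht N := by unfold ht; omega
  have h9 : 9 ≤ ht N ^ 2 := by nlinarith
  have : Sem program theDataStructure.addGradient [updateInput st i j g] 0 fun w s => ∃ As',
      State n ((Op.addGradient i j g).apply A) w As' ∧ Cost N As As' s := by
    conv => whnf
    refine (addLin_state h hN hi hj (A' := (Op.addGradient i j g).apply A) ?_).mono ?_
    · intro k
      simp [Op.apply, mul_comm]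
    · rintro w s ⟨As', hw, h1, h2⟩
      refine ⟨As', hw, h1, ?_⟩
      rw [Nat.mul_add] at h2 ⊢
      omega
  obtain ⟨w, s, h1, As', h2, h4⟩ := this.sound
  exact ⟨w, s, As', h1, h2, by simpa using h4⟩

theorem leftLinearWave_state (h : State n A st As) (hN : pot As + 100 ≤ N) (hi : 1 ≤ i)
    (hj : j ≤ n) (α : ℝ) :
    ∃ st' t As', Eval program [updateInput st i j α] theDataStructure.leftLinearWave st' t ∧
      State n ((Op.leftLinearWave i j α).apply A) st' As' ∧ Cost N As As' t := by
  have h3 : 3 ≤ ht N := by unfold ht; omega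
  have h9 : 9 ≤ ht N ^ 2 := by nlinarith
  obtain ⟨f, hS, hf⟩ := h
  have : Sem program theDataStructure.leftLinearWave [updateInput st i j α] 0 fun w s => ∃ As',
      State n ((Op.leftLinearWave i j α).apply A) w As' ∧ Cost N As As' s := by
    conv => whnf
    refine (leftWave_spec (i := i) (j := j)
      (f' := patch i j ((Op.leftLinearWave i j α).apply A) f) (N := N) hS (by simp) (by simp)
      (by omega) (by omega) (isWave_of_left (fun k h1 h2 => hf k (by omega) (by omega))
        fun k h1 h2 => patch_mem h1 h2) (fun k hk => patch_of_not hk) (by omega)).mono ?_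
    rintro w s ⟨As', hw, h1, h2⟩
    refine ⟨As', ⟨_, hw, patch_state hf fun k hk => dif_neg hk⟩, by omega, ?_⟩
    rw [Nat.mul_add] at h2 ⊢
    omega
  obtain ⟨w, s, h1, As', h2, h4⟩ := this.sound
  exact ⟨w, s, As', h1, h2, by simpa using h4⟩

theorem rightLinearWave_state (h : State n A st As) (hN : pot As + 100 ≤ N) (hi : 1 ≤ i)
    (hj : j ≤ n) (α : ℝ) :
    ∃ st' t As', Eval program [updateInput st i j α] theDataStructure.rightLinearWave st' t ∧
      State n ((Op.rightLinearWave i j α).apply A) st' As' ∧ Cost N As As' t := by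
  have h3 : 3 ≤ ht N := by unfold ht; omega
  have h9 : 9 ≤ ht N ^ 2 := by nlinarith
  obtain ⟨f, hS, hf⟩ := h
  set f' := patch i j ((Op.rightLinearWave i j α).apply A) f with hf'
  have : Sem program theDataStructure.rightLinearWave [updateInput st i j α] 0 fun w s => ∃ As',
      State n ((Op.rightLinearWave i j α).apply A) w As' ∧ Cost N As As' s := by
    conv => whnf
    refine hS.flip.mono ?_
    rintro w1 s1 ⟨hw1, hs1⟩
    conv => whnf
    refine (leftWave_spec (i := -j) (j := -i) (f' := fun k => f' (-k)) (N := N) hw1 (by simp)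
      (by simp) (by omega) (by omega)
      (isWave_of_right (fun k h1 h2 => hf k (by omega) (by omega))
        fun k h1 h2 => patch_mem h1 h2) (fun k hk => patch_of_not (by omega))
      (by rw [pot_appL]; omega)).mono ?_
    rintro w2 s2 ⟨As', hw2, h1, h2⟩
    conv => whnf
    refine hw2.flip.mono ?_
    rintro w3 s3 ⟨hw3, hs3⟩
    simp only [neg_neg, neg_zero] at hw3
    refine ⟨_, ⟨f', hw3, patch_state hf fun k hk => dif_neg hk⟩, ?_, ?_⟩
    · rw [pot_appL] at h1 ⊢
      omega
    · rw [length_appL] at h2 ⊢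
      rw [Nat.mul_add] at h2 ⊢
      omega
  obtain ⟨w, s, h1, As', h2, h4⟩ := this.sound
  exact ⟨w, s, As', h1, h2, by simpa using h4⟩

/-- After a cut at `i` the value is the ordinate of the right end of the left part, nonempty because
of the sentinel at 0. Records are immutable, so the old state is returned and the number of arcs is
unaffected. -/
theorem lookup_state (h : State n A st As) (hN : pot As + 100 ≤ N) (hi : 1 ≤ i) (hj : i ≤ n) :
    ∃ t, Eval program [.cell st (.num (i : ℝ))] theDataStructure.lookup
      (.cell st (.num (A i))) t ∧ Cost N As As t := by
  have h3 : 3 ≤ ht N := by unfold ht; omega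
  have h9 : 9 ≤ ht N ^ 2 := by nlinarith
  obtain ⟨f, hS, hf⟩ := h
  have : Sem program theDataStructure.lookup [.cell st (.num (i : ℝ))] 0 fun w s =>
      w = .cell st (.num (A i)) ∧ Cost N As As s := by
    conv => whnf
    refine (hS.splitAt (k := i) (by simp) (by omega) (by omega) (N := N) (by omega)).mono ?_
    rintro _ s ⟨l, r, Ls, Rs, rfl, hl, -, -, -, hs⟩
    obtain ⟨x, b, rfl⟩ := hl.root (by omega)
    conv => whnf
    refine ⟨by rw [hf i hi hj], by omega, ?_⟩
    rw [Nat.mul_add]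
    omega
  obtain ⟨w, s, h1, rfl, h4⟩ := this.sound
  exact ⟨s, h1, by simpa using h4⟩

end

/-! ### Initialization and whole sequences of operations -/

theorem init_state (n : ℕ) : ∃ st t As, Eval program [.num (n : ℝ)] theDataStructure.init st t ∧
    State n (fun _ => 0) st As ∧ As.length = 1 ∧ pot As = 5 ∧ t ≤ 200 := by
  have hlt : ((0 : ℤ) : ℝ) < (n : ℝ) + ((1 : ℤ) : ℝ) := by push_cast; positivity
  have : Sem program theDataStructure.init [.num (n : ℝ)] 0 fun w s => ∃ As,
      State n (fun _ => 0) w As ∧ As.length = 1 ∧ pot As = 5 ∧ s ≤ 200 := by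
    conv => whnf
    refine (seg_spec ((0 : ℤ) : ℝ) ((0 : ℤ) : ℝ) _ ((0 : ℤ) : ℝ) hlt).mono ?_
    rintro w s ⟨hw, hs⟩
    refine ⟨_, ⟨fun _ => 0, ⟨hw.o, ?_, ?_⟩, fun k _ _ => rfl⟩, rfl, rfl, by omega⟩
    · simp [Path, segArc]
    · intro A hA
      obtain rfl := List.mem_singleton.mp hA
      refine ⟨segArc_tight _ _ _ _ _, ⟨0, rfl⟩, ⟨n + 1, by simp [segArc]⟩, fun k _ _ => ?_⟩
      rw [segArc_G]
      simp [segArc]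
  obtain ⟨w, s, h1, As, h2, h3, h4, h5⟩ := this.sound
  exact ⟨w, s, As, h1, h2, h3, h4, by omega⟩

/-- `N` belongs to the analysis only; the program does not know it. The potential grows by at most
60 per operation, so one `N` serves the whole sequence, and the amortized costs telescope. -/
theorem runs_of_state {n N : ℕ} (ops : List Op) {A : ℕ → ℝ} {st : Val} {As : List Arc}
    (h : State n A st As) (hv : ∀ o ∈ ops, o.Valid n) (hN : pot As + 60 * ops.length + 100 ≤ N) :
    ∃ T, theDataStructure.Runs st ops (answers A ops) T ∧
      T ≤ 160000 * ht N ^ 2 * (As.length + 21 * ops.length) := by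
  induction ops generalizing A st As with
  | nil => exact ⟨0, .nil, by omega⟩
  | cons o ops ih =>
    simp only [List.mem_cons, forall_eq_or_imp, List.length_cons] at hv hN
    have step : ∀ {A' st' As' t}, State n A' st' As' → Cost N As As' t →
        ∃ T, theDataStructure.Runs st' ops (answers A' ops) T ∧
          t + T ≤ 160000 * ht N ^ 2 * (As.length + 21 * (ops.length + 1)) := by
      rintro A' st' As' t h' ⟨h1, h2⟩
      obtain ⟨T, h3, h4⟩ := ih h' hv.2 (by omega)
      refine ⟨T, h3, ?_⟩
      have e : 160000 * ht N ^ 2 * (As.length + 21 * (ops.length + 1)) =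
        160000 * ht N ^ 2 * (As.length + 21) + 160000 * ht N ^ 2 * (21 * ops.length) := by ring
      rw [Nat.mul_add _ As'.length] at h4
      omega
    cases o with
    | lookup i =>
      obtain ⟨h1, h2⟩ := hv.1
      obtain ⟨t, he, hc⟩ := lookup_state (N := N) h (by omega) h1 h2
      obtain ⟨T, h3, h4⟩ := step h hc
      exact ⟨_, .lookup he h3, h4⟩
    | addConst i j c =>
      obtain ⟨⟨h1, -⟩, -, h2⟩ := hv.1
      obtain ⟨st', t, As', he, hs, hc⟩ := addConst_state (N := N) h (by omega) h1 h2 c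
      obtain ⟨T, h3, h4⟩ := step hs hc
      exact ⟨_, .addConst he h3, h4⟩
    | addGradient i j g =>
      obtain ⟨⟨h1, -⟩, -, h2⟩ := hv.1
      obtain ⟨st', t, As', he, hs, hc⟩ := addGradient_state (N := N) h (by omega) h1 h2 g
      obtain ⟨T, h3, h4⟩ := step hs hc
      exact ⟨_, .addGradient he h3, h4⟩
    | leftLinearWave i j α =>
      obtain ⟨⟨h1, -⟩, -, h2⟩ := hv.1
      obtain ⟨st', t, As', he, hs, hc⟩ := leftLinearWave_state (N := N) h (by omega) h1 h2 α
      obtain ⟨T, h3, h4⟩ := step hs hc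
      exact ⟨_, .leftLinearWave he h3, h4⟩
    | rightLinearWave i j α =>
      obtain ⟨⟨h1, -⟩, -, h2⟩ := hv.1
      obtain ⟨st', t, As', he, hs, hc⟩ := rightLinearWave_state (N := N) h (by omega) h1 h2 α
      obtain ⟨T, h3, h4⟩ := step hs hc
      exact ⟨_, .rightLinearWave he h3, h4⟩

/-- The initial potential is 5, each operation adds at most 60, and 100 is slack. For `s ≥ 1` the
total is below `2 ^ 8 * s`, so the logarithm grows by at most 8, and `2 * 8 + 3 = 19`. -/
theorem ht_le {s : ℕ} (hs : 1 ≤ s) : ht (5 + 60 * s + 100) ≤ 19 * (Nat.log 2 s + 1) := by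
  have h : Nat.log 2 (5 + 60 * s + 100) ≤ Nat.log 2 s + 8 := by
    have h1 : s < 2 ^ (Nat.log 2 s + 1) := Nat.lt_pow_succ_log_self (by norm_num) s
    have : Nat.log 2 (5 + 60 * s + 100) < Nat.log 2 s + 1 + 8 := by
      apply Nat.log_lt_of_lt_pow (by omega)
      rw [pow_add]
      omega
    omega
  unfold ht
  omega

end RangeArray

theorem theoremt :
    ∃ (D : RangeArray.DataStructure) (C d : ℕ), ∀ n : ℕ,
      ∃ (st₀ : RangeArray.Val) (t₀ : ℕ),
        RangeArray.Eval D.procs [RangeArray.Val.num (n : ℝ)] D.init st₀ t₀ ∧ t₀ ≤ C ∧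
        ∀ ops : List RangeArray.Op, (∀ o ∈ ops, o.Valid n) →
          ∃ T : ℕ, D.Runs st₀ ops (RangeArray.answers (fun _ => 0) ops) T ∧
            T ≤ C * ops.length * (Nat.log 2 ops.length + 1) ^ d := by
  -- Here `361 = 19 ^ 2` comes from `ht_le`, and 22 from `1 + 21 * s ≤ 22 * s` with the single
  -- initial arc.
  refine ⟨RangeArray.theDataStructure, 160000 * 361 * 22, 2, fun n => ?_⟩
  obtain ⟨st, t, As, he, hS, hl, hp, ht⟩ := RangeArray.init_state n
  refine ⟨st, t, he, ht.trans (by norm_num), fun ops hv => ?_⟩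
  rcases Nat.eq_zero_or_pos ops.length with h0 | h0
  · obtain rfl := List.length_eq_zero_iff.mp h0
    exact ⟨0, .nil, by simp⟩
  · obtain ⟨T, hT, hle⟩ := RangeArray.runs_of_state ops hS hv (N := 5 + 60 * ops.length + 100)
      (by omega)
    refine ⟨T, hT, hle.trans ?_⟩
    rw [hl]
    calc 160000 * RangeArray.ht (5 + 60 * ops.length + 100) ^ 2 * (1 + 21 * ops.length)
        ≤ 160000 * (19 * (Nat.log 2 ops.length + 1)) ^ 2 * (22 * ops.length) := by
          gcongr
          · exact RangeArray.ht_le h0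
          · omega
      _ = 160000 * 361 * 22 * ops.length * (Nat.log 2 ops.length + 1) ^ 2 := by ring
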